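/- Let $n$ be a dimension, $a_0\ge 0$, and let $a:(0,\infty)\to\mathbb R$ be a measurable kernel that is integrable on $(0,1)$ and bounded on $[\epsilon,\infty)$ for every $\epsilon>0$; assume that $a_0$ and $a$ do not both vanish (that is, not both $a_0=0$ and $a=0$ almost everywhere). Write $\tilde a(z)=\int_0^\infty e^{-zt}a(t)\,dt$ for $\operatorname{Re}z>0$, and $A(t)=a_0+\int_0^t a(\tau)\,d\tau$. Assume: 1. $u_0\in L^1(\mathbb R^n)\cap H^s(\mathbb R^n)$ for some $s\ge 0$; 2. for some $\alpha>0$, $\tilde a$ extends to a function on $\{\operatorname{Re}z\ge-\alpha\}$ that is continuous and bounded there and holomorphic in $\{\operatorname{Re}z>-\alpha\}$, and, denoting the extension again by $\tilde a$, either $a_0>0$ and $a_0+\operatorname{Re}\tilde a(i\omega)>0$ for all $\omega\in\mathbb R$, or $\operatorname{Re}\tilde a(-\alpha+i\omega)\ge 0$ for all $\omega\in\mathbb R$. Let $u\in C([0,\infty),H^s(\mathbb R^n))$ be the solution, in the sense of distributions on $\mathbb R^n\times[0,\infty)$, of $$u_t(\cdot,t)=a_0\Delta u(\cdot,t)+\int_0^t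 a(t-\tau)\,\Delta u(\cdot,\tau)\,d\tau,\qquad u(\cdot,0)=u_0 .$$ Set $k(t)=\sqrt{tA(t)}$ (defined for all large $t$), $u_{T,k}(x,t)=k(T)^n\,u(k(T)x,Tt)$, $U_0=\int_{\mathbb R^n}u_0(x)\,dx$, and let $u_\infty(x,t)=(4\pi t)^{-n/2}e^{-|x|^2/(4t)}$ be the heat kernel, so that $\int_{\mathbb R^n}e^{-i\langle x,\xi\rangle}u_\infty(x,t)\,dx=e^{-|\xi|^2t}$. Then for every compact interval $[c,d]\subset(0,\infty)$, $$\sup_{t\in[c,d]}\bigl\|u_{T,k}(\cdot,t)-U_0\,u_\infty(\cdot,t)\bigr\|_{H^s(\mathbb R^n)}\longrightarrow 0\qquad\text{as }T\to\infty .$$ -/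

import Mathlib

open MeasureTheory Set Filter Topology
open scoped ENNReal FourierTransform ContDiff

noncomputable section

/-- The Laplace transform `∫₀^∞ e^{-zt} a(t) dt` of a real kernel. -/
def laplaceTransform (a : ℝ → ℝ) (z : ℂ) : ℂ :=
  ∫ t in Ioi (0 : ℝ), Complex.exp (-(z * (t : ℂ))) * ((a t : ℝ) : ℂ)

/-- The standing assumptions on the memory kernel: it is measurable on `(0, ∞)`, integrable on
`(0, 1)`, and bounded on every half line `[ε, ∞)` with `ε > 0`. -/
structure IsMemoryKernel (a : ℝ → ℝ) : Prop where
  aestronglyMeasurable : AEStronglyMeasurable a (volume.restrict (Ioi (0 : ℝ)))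
  integrableOn : IntegrableOn a (Ioo (0 : ℝ) 1)
  bounded : ∀ ε : ℝ, 0 < ε → ∃ M : ℝ, ∀ t : ℝ, ε ≤ t → |a t| ≤ M

/-- `F` extends the Laplace transform of `a` from the open right half plane to the half plane
`{Re z ≥ -α}`: it is holomorphic in `{Re z > -α}`, continuous and bounded on `{Re z ≥ -α}`, and
agrees with the Laplace integral (which converges absolutely there) for `Re z > 0`. -/
structure IsLaplaceExtension (a : ℝ → ℝ) (α : ℝ) (F : ℂ → ℂ) : Prop where
  differentiableOn : DifferentiableOn ℂ F {z : ℂ | -α < z.re}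
  continuousOn : ContinuousOn F {z : ℂ | -α ≤ z.re}
  bounded : ∃ M : ℝ, ∀ z : ℂ, -α ≤ z.re → ‖F z‖ ≤ M
  eq_laplaceTransform : ∀ z : ℂ, 0 < z.re → F z = laplaceTransform a z

/-- The integrated kernel `A(t) = a₀ + ∫₀ᵗ a(s) ds`. -/
def integratedKernel (a₀ : ℝ) (a : ℝ → ℝ) (t : ℝ) : ℝ :=
  a₀ + ∫ s in (0 : ℝ)..t, a s

/-- The scaling function `k(t) = √(t A(t))`. -/
def scalingFunction (a₀ : ℝ) (a : ℝ → ℝ) (t : ℝ) : ℝ :=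
  Real.sqrt (t * integratedKernel a₀ a t)

/-- The `H^s(ℝⁿ)`-norm (for `s ≥ 0`), with values in `[0, ∞]`: the `L²`-norm of
`(1 + |2πξ|²)^{s/2} (𝓕 f)(ξ)`, where `𝓕` is the `L²`-Fourier transform with kernel
`e^{-2πi⟨x, ξ⟩}`; functions outside `L²` have infinite norm. -/
def sobolevENorm {n : ℕ} (s : ℝ) (f : EuclideanSpace ℝ (Fin n) → ℂ) : ℝ≥0∞ :=
  open scoped Classical in
  if hf : MemLp f 2 (volume : Measure (EuclideanSpace ℝ (Fin n))) then
    eLpNorm (fun ξ : EuclideanSpace ℝ (Fin n) =>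
      (((1 + ‖(2 * Real.pi) • ξ‖ ^ 2) ^ (s / 2) : ℝ) : ℂ) *
        (𝓕 (hf.toLp f) : Lp ℂ 2 (volume : Measure (EuclideanSpace ℝ (Fin n)))) ξ) 2 volume
  else ⊤

/-- `f ∈ H^s(ℝⁿ)`, for `s ≥ 0`. -/
def MemHs {n : ℕ} (s : ℝ) (f : EuclideanSpace ℝ (Fin n) → ℂ) : Prop :=
  sobolevENorm s f < ⊤

/-- `u ∈ C([0, ∞), H^s(ℝⁿ))`. -/
def IsContinuousInHs {n : ℕ} (s : ℝ) (u : ℝ → EuclideanSpace ℝ (Fin n) → ℂ) : Prop :=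
  (∀ t : ℝ, 0 ≤ t → MemHs s (u t)) ∧
    ∀ t : ℝ, 0 ≤ t →
      Tendsto (fun r : ℝ => sobolevENorm s (u r - u t)) (𝓝[Ici 0] t) (𝓝 0)

/-- `u` solves `u_t = a₀ Δu + a * Δu` in `ℝⁿ × (0, ∞)` in the sense of distributions, with initial
value `u(·, 0)`. Test functions are the restrictions to `t ≥ 0` of smooth, compactly supported
functions of `(t, x)`. -/
def SolvesInDistributions {n : ℕ} (a₀ : ℝ) (a : ℝ → ℝ)
    (u : ℝ → EuclideanSpace ℝ (Fin n) → ℂ) : Prop :=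
  ∀ Φ : ℝ × EuclideanSpace ℝ (Fin n) → ℂ, ContDiff ℝ ∞ Φ → HasCompactSupport Φ →
    (∫ s in Ioi (0 : ℝ), ∫ x : EuclideanSpace ℝ (Fin n),
        u s x * (deriv (fun τ : ℝ => Φ (τ, x)) s
          + (a₀ : ℂ) * Laplacian.laplacian (fun y => Φ (s, y)) x
          + ∫ t in Ioi s, ((a (t - s) : ℝ) : ℂ) * Laplacian.laplacian (fun y => Φ (t, y)) x))
      + (∫ x : EuclideanSpace ℝ (Fin n), u 0 x * Φ (0, x)) = 0

/-- `u ∈ C([0, ∞), H^s(ℝⁿ))` is a distributional solution of `u_t = a₀ Δu + a * Δu` with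
`u(·, 0) = u₀`. -/
structure IsHsSolution {n : ℕ} (s a₀ : ℝ) (a : ℝ → ℝ) (u₀ : EuclideanSpace ℝ (Fin n) → ℂ)
    (u : ℝ → EuclideanSpace ℝ (Fin n) → ℂ) : Prop where
  continuousInHs : IsContinuousInHs s u
  solves : SolvesInDistributions a₀ a u
  initial : u 0 =ᵐ[volume] u₀

/-- The rescaled function `u_{T,k}(x, t) = k(T)ⁿ u(k(T) x, T t)`. -/
def rescale {n : ℕ} (k : ℝ → ℝ) (u : ℝ → EuclideanSpace ℝ (Fin n) → ℂ) (T t : ℝ)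
    (x : EuclideanSpace ℝ (Fin n)) : ℂ :=
  ((k T ^ n : ℝ) : ℂ) * u (T * t) (k T • x)

/-- The heat kernel `(4πt)^{-n/2} e^{-|x|²/(4t)}` on `ℝⁿ`. -/
def heatKernel {n : ℕ} (t : ℝ) (x : EuclideanSpace ℝ (Fin n)) : ℂ :=
  (((4 * Real.pi * t) ^ (-(n : ℝ) / 2) * Real.exp (-‖x‖ ^ 2 / (4 * t)) : ℝ) : ℂ)

/-- In the convention `f̂(η) = ∫ e^{-i⟨x, η⟩} f(x) dx`, that is `f̂(2πξ) = (𝓕 f)(ξ)`, the heat kernel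
has the Fourier transform `e^{-|η|² t}`. -/
theorem fourier_heatKernel {n : ℕ} {t : ℝ} (ht : 0 < t) (ξ : EuclideanSpace ℝ (Fin n)) :
    𝓕 (heatKernel t : EuclideanSpace ℝ (Fin n) → ℂ) ξ
      = Complex.exp (-((‖(2 * Real.pi) • ξ‖ : ℝ) : ℂ) ^ 2 * (t : ℂ)) := by
  have hb : 0 < (((4 * t)⁻¹ : ℝ) : ℂ).re := by
    rw [Complex.ofReal_re]; positivity
  have h4 : (0 : ℝ) < 4 * Real.pi * t := by positivity
  have h1 : (heatKernel t : EuclideanSpace ℝ (Fin n) → ℂ)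
      = (((4 * Real.pi * t) ^ (-(n : ℝ) / 2) : ℝ) : ℂ) •
        fun v : EuclideanSpace ℝ (Fin n) =>
          Complex.exp (-(((4 * t)⁻¹ : ℝ) : ℂ) * (‖v‖ : ℂ) ^ 2) := by
    funext v
    simp only [heatKernel, Pi.smul_apply, smul_eq_mul, Complex.ofReal_mul, Complex.ofReal_exp]
    congr 2
    push_cast
    rw [div_eq_mul_inv]
    ring
  have h2 : ((Real.pi : ℂ) / (((4 * t)⁻¹ : ℝ) : ℂ)) = ((4 * Real.pi * t : ℝ) : ℂ) := by
    push_cast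
    rw [div_inv_eq_mul]
    ring
  have h3 : ((((4 * Real.pi * t) ^ (-(n : ℝ) / 2) : ℝ) : ℂ)
      * ((4 * Real.pi * t : ℝ) : ℂ) ^ ((n : ℂ) / 2)) = 1 := by
    have : ((n : ℂ) / 2) = (((n : ℝ) / 2 : ℝ) : ℂ) := by push_cast; rfl
    rw [this, ← Complex.ofReal_cpow h4.le, ← Complex.ofReal_mul, ← Real.rpow_add h4]
    have h0 : -(n : ℝ) / 2 + (n : ℝ) / 2 = 0 := by ring
    rw [h0, Real.rpow_zero, Complex.ofReal_one]
  have h5 (c : ℂ) (g : EuclideanSpace ℝ (Fin n) → ℂ) : 𝓕 (c • g) ξ = c * 𝓕 g ξ := by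
    simp only [Real.fourier_eq, Pi.smul_apply, ← MeasureTheory.integral_const_mul, smul_eq_mul]
    congr 1
    funext v
    simp only [Circle.smul_def, smul_eq_mul]
    ring
  rw [h1, h5, fourier_gaussian_innerProductSpace hb, h2,
    finrank_euclideanSpace_fin, ← mul_assoc, h3, one_mul]
  congr 1
  rw [norm_smul, Real.norm_of_nonneg (by positivity)]
  have ht' : (t : ℂ) ≠ 0 := by exact_mod_cast ht.ne'
  push_cast
  field_simp
  ring

end

/-! The Fourier transform decouples the equation. With `ρ = |2πξ|²` the transform of the solution at
time `t` is that of `u₀` times a scalar resolvent `R(ρ, t)`, whose Laplace transform is `1 / D` with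
`D(z) = z + ρ G(z)` and `G = a₀ + ã`. The theorem thus reduces to estimates for `R` and dominated
convergence in `L²`.

The hypotheses on `ã` make `G` bounded and holomorphic with strictly positive real part on some half
plane `{Re z > -β}`, `β > 0` (`IsLaplaceExtension.exists_isPassiveSymbol`); strictness is the
maximum principle together with the nontriviality of `(a₀, a)`. Positivity yields Schwarz-type
bounds on `G'` and on the argument of `G`. A contour shift combined with a Tauberian step gives
`A(t) → G(0) > 0` (`IsPassiveSymbol.tendsto_integratedKernel`), so `k(T)² ~ G(0) T` and the scaling
is asymptotically parabolic.

As `1 / D` decays only like `1 / z`, the inversion integral is written for `t R(ρ, t)`, whose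
transform `-(1 / D)' = D' / D²` is absolutely integrable. Three facts about `R` carry the proof. For
small `ρ`, `|R| ≤ C e^{-cρt}` (`exists_norm_resolventKernel_le_low`). For `ρ ≥ ρ₀`, `|R| ≤ C e^{-δt}
/ t` uniformly in `ρ` (`exists_norm_resolventKernel_le_high`); this is the delicate point, and it
rests on bounding `|D'| / |D|²` by `Re (1 / D)` plus an integrable function, the integral of `Re (1
/ D)` being known through comparison with `1 / (z + 1)`. Finally `R(ρ, τ) - e^{-q} → 0` when `τ → ∞`
and `ρ τ G(0) - q → 0` with `q` bounded (`tendsto_resolventKernel_sub`).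

After the dilation by `k(T)`, the high frequencies contribute a power of `T` times `e^{-δcT}`, while
the low frequencies are dominated by a Gaussian and converge pointwise to the transform of `U₀`
times the heat kernel. -/

/-! ### Integrals along vertical lines. -/

theorem integrable_of_le_div_sq {f : ℝ → ℂ} {C Y : ℝ} (hf : Continuous f)
    (hb : ∀ y, Y ≤ |y| → ‖f y‖ ≤ C / y ^ 2) : Integrable f := by
  have key : ∀ y, max Y 1 ≤ |y| → ‖f y‖ ≤ 2 * |C| * ‖(1 + y ^ 2)⁻¹‖ := by
    intro y hy
    have h1 : 1 ≤ y ^ 2 := by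
      rw [← sq_abs]; nlinarith [le_max_right Y 1, abs_nonneg y]
    refine (hb y ((le_max_left _ _).trans hy)).trans ?_
    rw [Real.norm_of_nonneg (by positivity), ← div_eq_mul_inv, div_le_div_iff₀ (by positivity)
      (by positivity)]
    nlinarith [le_abs_self C, abs_nonneg C]
  refine hf.locallyIntegrable.integrable_of_isBigO_atBot_atTop
    (g := fun y : ℝ => (1 + y ^ 2)⁻¹) (g' := fun y : ℝ => (1 + y ^ 2)⁻¹) ?_
    (integrable_inv_one_add_sq.integrableAtFilter _) ?_
    (integrable_inv_one_add_sq.integrableAtFilter _)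
  · refine Asymptotics.IsBigO.of_bound (2 * |C|) ?_
    filter_upwards [eventually_le_atBot (-(max Y 1))] with y hy
    exact key y (le_abs.2 (Or.inr (by linarith)))
  · refine Asymptotics.IsBigO.of_bound (2 * |C|) ?_
    filter_upwards [eventually_ge_atTop (max Y 1)] with y hy
    exact key y (le_abs.2 (Or.inl hy))

theorem continuous_vertical {h : ℂ → ℂ} {x : ℝ}
    (hd : ∀ z : ℂ, z.re = x → ContinuousAt h z) :
    Continuous fun y : ℝ => h (x + y * Complex.I) := by
  rw [continuous_iff_continuousAt]
  intro y
  refine ContinuousAt.comp (f := fun y : ℝ => ((x : ℂ) + y * Complex.I)) (hd _ (by simp)) ?_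
  fun_prop

theorem integrable_vertical {h : ℂ → ℂ} {x C Y : ℝ}
    (hd : ∀ z : ℂ, z.re = x → ContinuousAt h z)
    (hb : ∀ z : ℂ, z.re = x → Y ≤ |z.im| → ‖h z‖ ≤ C / z.im ^ 2) :
    Integrable fun y : ℝ => h (x + y * Complex.I) :=
  integrable_of_le_div_sq (continuous_vertical hd) fun y hy => by
    simpa using hb (x + y * Complex.I) (by simp) (by simpa using hy)

/-- Vertical lines of integration may be shifted inside a strip of holomorphy. -/
theorem integral_vertical_eq {h : ℂ → ℂ} {x₁ x₂ C Y : ℝ} (hx : x₁ ≤ x₂)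
    (hd : ∀ z : ℂ, x₁ ≤ z.re → z.re ≤ x₂ → DifferentiableAt ℂ h z)
    (hb : ∀ z : ℂ, x₁ ≤ z.re → z.re ≤ x₂ → Y ≤ |z.im| → ‖h z‖ ≤ C / z.im ^ 2) :
    ∫ y : ℝ, h (x₁ + y * Complex.I) = ∫ y : ℝ, h (x₂ + y * Complex.I) := by
  have i₁ : Integrable fun y : ℝ => h (x₁ + y * Complex.I) :=
    integrable_vertical (fun z hz => (hd z hz.ge (hz.trans_le hx)).continuousAt)
      fun z hz => hb z hz.ge (hz.trans_le hx)
  have i₂ : Integrable fun y : ℝ => h (x₂ + y * Complex.I) :=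
    integrable_vertical (fun z hz => (hd z (hx.trans hz.ge) hz.le).continuousAt)
      fun z hz => hb z (hx.trans hz.ge) hz.le
  have t₁ := intervalIntegral_tendsto_integral i₁ tendsto_neg_atTop_atBot tendsto_id
  have t₂ := intervalIntegral_tendsto_integral i₂ tendsto_neg_atTop_atBot tendsto_id
  -- The sign `s = ±1` treats the top and bottom edges of the rectangle together.
  have hsmall : ∀ s : ℝ, |s| = 1 → Tendsto (fun N : ℝ =>
      ∫ x in x₁..x₂, h (x + ((s * N : ℝ) : ℂ) * Complex.I)) atTop (𝓝 0) := by
    intro s hs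
    have hlim : Tendsto (fun N : ℝ => C / N ^ 2 * |x₂ - x₁|) atTop (𝓝 0) := by
      have : Tendsto (fun N : ℝ => C / N ^ 2) atTop (𝓝 0) :=
        tendsto_const_nhds.div_atTop (tendsto_pow_atTop two_ne_zero)
      simpa using this.mul_const |x₂ - x₁|
    refine squeeze_zero_norm' ?_ hlim
    filter_upwards [eventually_ge_atTop (max Y 0)] with N hN
    refine intervalIntegral.norm_integral_le_of_norm_le_const fun x hx' => ?_
    rw [uIoc_of_le hx] at hx'
    have hN0 : 0 ≤ N := (le_max_right _ _).trans hN
    have := hb (x + ((s * N : ℝ) : ℂ) * Complex.I) (by simpa using hx'.1.le)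
      (by simpa using hx'.2)
      (by simp [abs_mul, hs, abs_of_nonneg hN0, (le_max_left _ _).trans hN])
    refine this.trans_eq ?_
    have : (s * N) ^ 2 = N ^ 2 := by rw [mul_pow, ← sq_abs s, hs]; ring
    simp [-mul_eq_mul_left_iff, this]
  have rect : ∀ N : ℝ, 0 ≤ N → Complex.I • (∫ y in (-N)..N, h (x₂ + y * Complex.I))
      - Complex.I • (∫ y in (-N)..N, h (x₁ + y * Complex.I))
      = (∫ x in x₁..x₂, h (x + ((1 * N : ℝ) : ℂ) * Complex.I))
        - ∫ x in x₁..x₂, h (x + (((-1) * N : ℝ) : ℂ) * Complex.I) := by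
    intro N hN
    have := Complex.integral_boundary_rect_eq_zero_of_differentiableOn h
      ⟨x₁, -N⟩ ⟨x₂, N⟩ (by
        intro z hz
        rw [Complex.mem_reProdIm] at hz
        simp only [uIcc_of_le hx] at hz
        exact (hd z hz.1.1 hz.1.2).differentiableWithinAt)
    simp only at this
    rw [one_mul, neg_one_mul]
    linear_combination this
  have lim1 := ((t₂.const_smul Complex.I).sub (t₁.const_smul Complex.I))
  have lim2 := (hsmall 1 (by simp)).sub (hsmall (-1) (by simp))
  have lim3 := lim2.congr' (by
    filter_upwards [eventually_ge_atTop 0] with N hN using (rect N hN).symm)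
  have := tendsto_nhds_unique lim1 lim3
  rw [sub_zero, sub_eq_zero] at this
  simpa using this.symm

/-! ### Holomorphic functions with nonnegative real part; Phragmén–Lindelöf and three lines. -/

/-- The gradient estimate for holomorphic functions with nonnegative real part. -/
theorem norm_deriv_mul_le_two_re {f : ℂ → ℂ} {z : ℂ} {r : ℝ} (hr : 0 < r)
    (hd : DifferentiableOn ℂ f (Metric.ball z r)) (hre : ∀ w ∈ Metric.ball z r, 0 ≤ (f w).re) :
    ‖deriv f z‖ * r ≤ 2 * (f z).re := by
  have hz : z ∈ Metric.ball z r := Metric.mem_ball_self hr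
  -- Adding `ε` makes the real part strictly positive. The Cayley transform `g` centred at `c = f z
  -- + ε` then maps the disc into the unit disc with `g z = 0` and `g' z = f' z / (2 Re c)`, so the
  -- Schwarz lemma applies.
  have key : ∀ ε : ℝ, 0 < ε → ‖deriv f z‖ * r ≤ 2 * ((f z).re + ε) := by
    intro ε hε
    set c : ℂ := f z + ε with hc
    have hcre : 0 < c.re := by simp [hc]; linarith [hre z hz]
    have hden : ∀ w ∈ Metric.ball z r, f w + ε + starRingEnd ℂ c ≠ 0 := by
      intro w hw h0
      have := congrArg Complex.re h0
      simp at this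
      simp [hc] at hcre
      linarith [hre w hw, hre z hz, show c.re = (f z).re + ε by simp [hc]]
    set g : ℂ → ℂ := fun w => (f w + ε - c) / (f w + ε + starRingEnd ℂ c) with hg
    have hgd : DifferentiableOn ℂ g (Metric.ball z r) :=
      ((hd.add_const _).sub_const _).div ((hd.add_const _).add_const _) hden
    have hgz : g z = 0 := by simp [hg, hc]
    have hmap : MapsTo g (Metric.ball z r) (Metric.closedBall (g z) 1) := by
      intro w hw
      rw [hgz, mem_closedBall_zero_iff, hg]
      simp only [norm_div]
      refine div_le_one_of_le₀ ?_ (norm_nonneg _)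
      rw [← sq_le_sq₀ (norm_nonneg _) (norm_nonneg _), ← Complex.normSq_eq_norm_sq,
        ← Complex.normSq_eq_norm_sq, Complex.normSq_apply, Complex.normSq_apply]
      simp
      nlinarith [mul_nonneg (add_nonneg (hre w hw) hε.le) hcre.le]
    have h1 := Complex.norm_deriv_le_div_of_mapsTo_ball hgd hmap hr
    have hfz : HasDerivAt f (deriv f z) z :=
      (hd.differentiableAt (Metric.isOpen_ball.mem_nhds hz)).hasDerivAt
    have hder : HasDerivAt g (deriv f z / (2 * c.re : ℝ)) z := by
      have := ((hfz.add_const (ε : ℂ)).sub_const c).div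
        ((hfz.add_const (ε : ℂ)).add_const (starRingEnd ℂ c)) (hden z hz)
      refine this.congr_deriv ?_
      have e : f z + ε + starRingEnd ℂ c = ((2 * c.re : ℝ) : ℂ) := by
        rw [← hc, Complex.add_conj]
      have h0 : ((2 * c.re : ℝ) : ℂ) ≠ 0 := by exact_mod_cast (by positivity : 2 * c.re ≠ 0)
      rw [e, ← hc, sub_self]
      field_simp
      ring
    rw [hder.deriv, norm_div, Complex.norm_real, Real.norm_of_nonneg (by positivity),
      div_le_div_iff₀ (by positivity) hr] at h1
    simp [hc] at h1
    linarith
  refine le_of_forall_pos_le_add fun ε hε => ?_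
  linarith [key (ε / 2) (by positivity)]

/-- A holomorphic function on the right half plane with nonnegative real part which is real on
the real axis satisfies `|arg f(z)| ≤ |arg z|`. -/
theorem re_mul_abs_im_le_of_conj_symm {f : ℂ → ℂ} (hd : DifferentiableOn ℂ f {z | 0 < z.re})
    (hre : ∀ z : ℂ, 0 < z.re → 0 ≤ (f z).re)
    (hconj : ∀ z : ℂ, 0 < z.re → f (starRingEnd ℂ z) = starRingEnd ℂ (f z))
    {ζ : ℂ} (hζ : 0 < ζ.re) : ζ.re * |(f ζ).im| ≤ |ζ.im| * (f ζ).re := by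
  have key : ∀ ε : ℝ, 0 < ε → ζ.re * |(f ζ).im| ≤ |ζ.im| * ((f ζ).re + ε) := by
    intro ε hε
    set b : ℂ := f ζ + ε with hb
    have hbre : 0 < b.re := by simp [hb]; linarith [hre ζ hζ]
    -- The Möbius map from the unit disc to the right half plane with `0 ↦ ζ`. The Schwarz lemma is
    -- applied to the Cayley transform of `f ∘ ψ`.
    let ψ : ℂ → ℂ := fun q => (ζ + starRingEnd ℂ ζ * q) / (1 - q)
    have h1 : ∀ q ∈ Metric.ball (0 : ℂ) 1, (1 - q) ≠ 0 := by
      intro q hq h0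
      rw [sub_eq_zero] at h0
      simp [← h0] at hq
    have hψre : ∀ q ∈ Metric.ball (0 : ℂ) 1, 0 < (ψ q).re := by
      intro q hq
      have hn : Complex.normSq q < 1 := by
        rw [Complex.normSq_eq_norm_sq]
        have : ‖q‖ < 1 := by simpa using hq
        nlinarith [norm_nonneg q]
      have hpos : 0 < Complex.normSq (1 - q) := Complex.normSq_pos.2 (h1 q hq)
      have : (ψ q).re = ζ.re * (1 - Complex.normSq q) / Complex.normSq (1 - q) := by
        simp only [ψ, Complex.div_re]
        field_simp
        simp [Complex.normSq_apply]
        ring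
      rw [this]
      exact div_pos (mul_pos hζ (by linarith)) hpos
    have hψd : DifferentiableOn ℂ ψ (Metric.ball 0 1) := by
      refine DifferentiableOn.div (by fun_prop) (by fun_prop) h1
    have hden : ∀ q ∈ Metric.ball (0 : ℂ) 1, f (ψ q) + ε + starRingEnd ℂ b ≠ 0 := by
      intro q hq h0
      have := congrArg Complex.re h0
      simp at this
      linarith [hre _ (hψre q hq)]
    let g : ℂ → ℂ := fun q => (f (ψ q) + ε - b) / (f (ψ q) + ε + starRingEnd ℂ b)
    have hfψ : DifferentiableOn ℂ (fun q => f (ψ q)) (Metric.ball 0 1) :=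
      hd.comp hψd hψre
    have hgd : DifferentiableOn ℂ g (Metric.ball 0 1) :=
      ((hfψ.add_const _).sub_const _).div ((hfψ.add_const _).add_const _) hden
    have hg0 : g 0 = 0 := by simp [g, ψ, hb]
    have hmap : MapsTo g (Metric.ball 0 1) (Metric.closedBall 0 1) := by
      intro q hq
      rw [mem_closedBall_zero_iff]
      simp only [g, norm_div]
      refine div_le_one_of_le₀ ?_ (norm_nonneg _)
      rw [← sq_le_sq₀ (norm_nonneg _) (norm_nonneg _), ← Complex.normSq_eq_norm_sq,
        ← Complex.normSq_eq_norm_sq, Complex.normSq_apply, Complex.normSq_apply]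
      simp
      nlinarith [mul_nonneg (add_nonneg (hre _ (hψre q hq)) hε.le) hbre.le]
    -- The preimage of the conjugate of `ζ` under `ψ`. Here `|q|` is the sine of `|arg ζ|`, and by
    -- conjugation symmetry `|g q|` is the sine of `|arg b|`, so `|g q| ≤ |q|` compares the two
    -- arguments.
    set q : ℂ := (starRingEnd ℂ ζ - ζ) / (2 * starRingEnd ℂ ζ) with hq
    have hζ0 : starRingEnd ℂ ζ ≠ 0 := by
      intro h0
      have := congrArg Complex.re h0
      simp at this
      linarith
    have hnζ : 0 < ‖ζ‖ := by simpa using hζ0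
    have hqn : ‖q‖ = |ζ.im| / ‖ζ‖ := by
      rw [hq, ← Complex.conj_conj ζ, Complex.conj_conj (starRingEnd ℂ ζ), norm_div, norm_mul]
      have : starRingEnd ℂ ζ - starRingEnd ℂ (starRingEnd ℂ ζ)
          = ((-2 * ζ.im : ℝ) : ℂ) * Complex.I := by
        apply Complex.ext <;> simp; ring
      rw [this]
      simp
      field_simp
    have hq1 : ‖q‖ < 1 := by
      rw [hqn, div_lt_one hnζ]
      rw [← abs_of_pos hnζ, ← sq_lt_sq, ← Complex.normSq_eq_norm_sq, Complex.normSq_apply]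
      nlinarith
    have hψq : ψ q = starRingEnd ℂ ζ := by
      have h2 : (1 : ℂ) - q ≠ 0 := h1 q (by simpa using hq1)
      simp only [ψ]
      rw [div_eq_iff h2, hq]
      field_simp
      ring
    have h3 := Complex.norm_le_norm_of_mapsTo_ball hgd hmap hg0 hq1
    have hgq : ‖g q‖ = |(f ζ).im| / ‖b‖ := by
      simp only [g]
      rw [hψq, hconj ζ hζ]
      have e1 : starRingEnd ℂ (f ζ) + ε = starRingEnd ℂ b := by simp [hb]
      have e2 : starRingEnd ℂ b - b = ((-2 * b.im : ℝ) : ℂ) * Complex.I := by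
        apply Complex.ext <;> simp; ring
      rw [e1, e2, ← two_mul, norm_div, norm_mul, norm_mul]
      have e3 : b.im = (f ζ).im := by simp [hb]
      have hb0 : 0 < ‖b‖ := norm_pos_iff.2 (by intro h; simp [h] at hbre)
      simp [e3]
      field_simp
    rw [hqn, hgq] at h3
    have hb0 : 0 < ‖b‖ := norm_pos_iff.2 (by intro h; simp [h] at hbre)
    rw [div_le_div_iff₀ hb0 hnζ] at h3
    have h4 : (|(f ζ).im| * ‖ζ‖) ^ 2 ≤ (|ζ.im| * ‖b‖) ^ 2 := by gcongr
    rw [mul_pow, mul_pow, ← Complex.normSq_eq_norm_sq, ← Complex.normSq_eq_norm_sq,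
      Complex.normSq_apply, Complex.normSq_apply, sq_abs, sq_abs,
      show b.im = (f ζ).im by simp [hb]] at h4
    have h5 : b.re = (f ζ).re + ε := by simp [hb]
    rw [← h5]
    refine abs_le_of_sq_le_sq' ?_ (by positivity) |>.2
    rw [mul_pow, mul_pow, sq_abs, sq_abs]
    nlinarith
  by_contra! hcon
  have : 0 < |ζ.im| + 1 := by positivity
  have := key ((ζ.re * |(f ζ).im| - |ζ.im| * (f ζ).re) / (2 * (|ζ.im| + 1)))
    (div_pos (by linarith) (by positivity))
  have h6 : |ζ.im| * ((ζ.re * |(f ζ).im| - |ζ.im| * (f ζ).re) / (2 * (|ζ.im| + 1)))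
      ≤ (ζ.re * |(f ζ).im| - |ζ.im| * (f ζ).re) / 2 := by
    rw [mul_div_assoc', div_le_div_iff₀ (by positivity) (by positivity)]
    nlinarith [abs_nonneg ζ.im]
  linarith

/-- A bounded holomorphic function on a half plane inherits lower bounds of its real part from the
boundary. -/
theorem le_re_of_le_re_boundary {f : ℂ → ℂ} {x₀ c M : ℝ}
    (hd : DifferentiableOn ℂ f {z | x₀ < z.re}) (hc : ContinuousOn f {z | x₀ ≤ z.re})
    (hM : ∀ z : ℂ, x₀ ≤ z.re → ‖f z‖ ≤ M)
    (hb : ∀ y : ℝ, c ≤ (f (x₀ + Complex.I * y)).re) {z : ℂ} (hz : x₀ ≤ z.re) : c ≤ (f z).re := by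
  have hcl : closure {z : ℂ | 0 < z.re} = {z : ℂ | 0 ≤ z.re} := Complex.closure_setOfPred_lt_re 0
  have hbd : ∀ z : ℂ, 0 ≤ z.re → ‖Complex.exp (-f (z + x₀))‖ ≤ Real.exp M := by
    intro z hz
    rw [Complex.norm_exp]
    refine Real.exp_le_exp.2 ?_
    have := hM (z + x₀) (by simpa using hz)
    have h2 := (abs_le.1 ((Complex.abs_re_le_norm (f (z + x₀))))).1
    simp only [Complex.neg_re]
    linarith
  -- Since `|e^{-f}| = e^{-Re f}`, a lower bound for `Re f` is an upper bound for `|e^{-f}|`;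
  -- boundedness of `f` supplies the growth conditions.
  have := PhragmenLindelof.right_half_plane_of_bounded_on_real
    (f := fun z => Complex.exp (-f (z + x₀))) (C := Real.exp (-c)) (z := z - x₀) ?_ ?_ ?_ ?_
    (by simpa using hz)
  · rw [Complex.norm_exp, Real.exp_le_exp] at this
    simpa using this
  · constructor
    · refine (hd.comp (by fun_prop) ?_).neg.cexp
      intro z hz
      simpa using hz
    · rw [hcl]
      refine (hc.comp (by fun_prop) ?_).neg.cexp
      intro z hz
      simpa using hz
  · refine ⟨1, by norm_num, 0, Asymptotics.IsBigO.of_bound (Real.exp M) ?_⟩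
    rw [eventually_inf_principal]
    refine Eventually.of_forall fun z hz => ?_
    simpa using hbd z (le_of_lt hz)
  · refine isBoundedUnder_of_eventually_le (a := Real.exp M) ?_
    filter_upwards [eventually_ge_atTop 0] with x hx
    exact hbd x (by simpa using hx)
  · intro y
    rw [Complex.norm_exp, Real.exp_le_exp]
    have := hb y
    rw [show (y : ℂ) * Complex.I + x₀ = x₀ + Complex.I * y by ring]
    simpa using this

/-- If a bounded holomorphic function on a half plane tends to zero along one vertical line, it
tends to zero in every vertical strip. -/
theorem norm_le_of_tendsto_zero_vertical {f : ℂ → ℂ} {α M x₀ : ℝ} (hα : -1 < α) (hx₀ : -α < x₀)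
    (hd : DifferentiableOn ℂ f {z | -α < z.re}) (hc : ContinuousOn f {z | -α ≤ z.re})
    (hM : ∀ z : ℂ, -α ≤ z.re → ‖f z‖ ≤ M)
    (h1 : Tendsto (fun y : ℝ => f (1 + y * Complex.I)) (cocompact ℝ) (𝓝 0)) {ε : ℝ} (hε : 0 < ε) :
    ∃ Y : ℝ, ∀ z : ℂ, x₀ ≤ z.re → z.re ≤ 1 → Y ≤ |z.im| → ‖f z‖ ≤ ε := by
  have hα1 : 0 < 1 + α := by linarith
  have hM0 : 0 ≤ M := (norm_nonneg _).trans (hM 1 (by simp; linarith))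
  set K : ℝ := Real.exp (α ^ 2 + 1) with hK
  set P : ℝ := max (M * K) 1 with hP
  have hP1 : 1 ≤ P := le_max_right _ _
  -- The three lines exponent at abscissa `x₀`, the smallest one in the strip `x₀ ≤ Re z ≤ 1`.
  set θ : ℝ := (x₀ + α) / (1 + α) with hθ
  have hθ0 : 0 < θ := div_pos (by linarith) hα1
  obtain ⟨b, hb0, hb1, hbε⟩ : ∃ b : ℝ, 0 < b ∧ b ≤ 1 ∧ P * b ^ θ ≤ ε := by
    have : Tendsto (fun b : ℝ => P * b ^ θ) (𝓝[>] 0) (𝓝 (P * (0 : ℝ) ^ θ)) :=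
      ((Real.continuousAt_rpow_const 0 θ (Or.inr hθ0.le)).tendsto.mono_left
        nhdsWithin_le_nhds).const_mul P
    rw [Real.zero_rpow hθ0.ne', mul_zero] at this
    have h2 := (this.eventually (gt_mem_nhds hε)).and
      (Ioc_mem_nhdsGT (zero_lt_one' ℝ))
    obtain ⟨b, hb, hb'⟩ := h2.exists
    exact ⟨b, hb'.1, hb'.2, hb.le⟩
  set e' : ℝ := b / (Real.exp 1 * (M + 1)) with he'
  have he'0 : 0 < e' := by positivity
  obtain ⟨Y₁, hY₁⟩ : ∃ Y₁ : ℝ, ∀ y : ℝ, Y₁ ≤ |y| → ‖f (1 + y * Complex.I)‖ ≤ e' := by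
    have := (tendsto_zero_iff_norm_tendsto_zero.1 h1).eventually (gt_mem_nhds he'0)
    obtain ⟨r, hr⟩ := ((Metric.hasBasis_cobounded_compl_closedBall (0 : ℝ)).eventually_iff.1
      (by rwa [Metric.cobounded_eq_cocompact]))
    refine ⟨r + 1, fun y hy => (hr.2 (x := y) ?_).le⟩
    simp
    linarith
  obtain ⟨Y₂, hY₂⟩ : ∃ Y₂ : ℝ, ∀ y : ℝ, Y₂ ≤ |y| → Real.exp (-y ^ 2) ≤ e' := by
    refine ⟨max 1 (-Real.log e'), fun y hy => ?_⟩
    rw [← Real.log_le_log_iff (Real.exp_pos _) he'0, Real.log_exp]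
    have h1 := (le_max_left _ _).trans hy
    have h2 := (le_max_right _ _).trans hy
    rw [← sq_abs]
    nlinarith
  refine ⟨Y₁ + max Y₂ 0, fun z hz1 hz2 hzY => ?_⟩
  -- A Gaussian factor recentred at the height of `z`. On `Re w = 1` either `|Im w|` is large and
  -- the Gaussian is small, or the height is still large and `f` is small. At the real point `w = Re
  -- z` the factor has modulus at least one, so nothing is lost there.
  let g : ℂ → ℂ := fun w => f (w + z.im * Complex.I) * Complex.exp (w ^ 2)
  have hexp : ∀ w : ℂ, -α ≤ w.re → w.re ≤ 1 → ‖Complex.exp (w ^ 2)‖ ≤ K := by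
    intro w hw1 hw2
    rw [Complex.norm_exp, hK, Real.exp_le_exp, sq, Complex.mul_re]
    rcases le_total 0 w.re with h | h <;> nlinarith [sq_nonneg w.im, sq_nonneg α]
  have hcl : closure (Complex.HadamardThreeLines.verticalStrip (-α) 1)
      = Complex.HadamardThreeLines.verticalClosedStrip (-α) 1 := by
    rw [Complex.HadamardThreeLines.verticalStrip, Complex.HadamardThreeLines.verticalClosedStrip,
      Complex.closure_preimage_re, closure_Ioo (by linarith)]
  have hgb : ∀ w ∈ Complex.HadamardThreeLines.verticalClosedStrip (-α) 1, ‖g w‖ ≤ M * K := by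
    intro w hw
    simp only [g, norm_mul]
    exact mul_le_mul (hM _ (by simpa using hw.1)) (hexp w hw.1 hw.2) (norm_nonneg _) hM0
  have h3 := Complex.HadamardThreeLines.norm_le_interp_of_mem_verticalClosedStrip'
    (f := g) (z := (z.re : ℂ)) (a := M * K) (b := b) (l := -α) (u := 1) (by linarith)
    ⟨by simpa using (hx₀.le.trans hz1), by simpa using hz2⟩ ?_ ?_ ?_ ?_
  · have h4 : ‖f z‖ ≤ ‖g z.re‖ := by
      have h5 : (z.re : ℂ) + z.im * Complex.I = z := Complex.re_add_im z
      simp only [g, norm_mul, h5]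
      refine le_mul_of_one_le_right (norm_nonneg _) ?_
      rw [Complex.norm_exp, sq, ← Complex.ofReal_mul, Complex.ofReal_re]
      exact Real.one_le_exp (mul_self_nonneg _)
    have hMK : 0 ≤ M * K := by positivity
    rw [Complex.ofReal_re] at h3
    set q : ℝ := (z.re - -α) / (1 - -α) with hq
    have hq0 : θ ≤ q := by
      rw [hθ, hq, sub_neg_eq_add, sub_neg_eq_add]
      gcongr
    have hq1 : q ≤ 1 := by
      rw [hq, div_le_one (by linarith)]; linarith
    calc ‖f z‖ ≤ (M * K) ^ (1 - q) * b ^ q := h4.trans h3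
      _ ≤ P * b ^ θ := by
        gcongr ?_ * ?_
        · calc (M * K) ^ (1 - q) ≤ P ^ (1 - q) :=
                Real.rpow_le_rpow hMK (le_max_left _ _) (by linarith)
            _ ≤ P ^ (1 : ℝ) := Real.rpow_le_rpow_of_exponent_le hP1 (by linarith)
            _ = P := Real.rpow_one P
        · exact Real.rpow_le_rpow_of_exponent_ge hb0 hb1 hq0
      _ ≤ ε := hbε
  · constructor
    · refine (hd.comp (by fun_prop) ?_).mul (by fun_prop)
      intro w hw
      simpa using hw.1
    · rw [hcl]
      refine (hc.comp (by fun_prop) ?_).mul (by fun_prop)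
      intro w hw
      simpa using hw.1
  · exact ⟨M * K, by rintro _ ⟨w, hw, rfl⟩; exact hgb w hw⟩
  · intro w hw
    have hw' : w.re = -α := hw
    exact hgb w ⟨hw'.ge, by show w.re ≤ 1; linarith⟩
  · intro w hw
    have hw' : w.re = 1 := hw
    have ew : w + z.im * Complex.I = 1 + ((w.im + z.im : ℝ) : ℂ) * Complex.I := by
      apply Complex.ext <;> simp [hw']
    have en : ‖Complex.exp (w ^ 2)‖ = Real.exp 1 * Real.exp (-w.im ^ 2) := by
      rw [Complex.norm_exp, sq, Complex.mul_re, hw', ← Real.exp_add]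
      ring_nf
    have hle : Real.exp (-w.im ^ 2) ≤ 1 := Real.exp_le_one_iff.2 (by nlinarith [sq_nonneg w.im])
    have hbe : Real.exp 1 * ((M + 1) * e') = b := by
      rw [he']; field_simp
    simp only [g, norm_mul, en]
    rw [← hbe, mul_left_comm]
    gcongr ?_ * ?_
    rcases le_total Y₂ |w.im| with h | h
    · refine mul_le_mul ((hM _ ?_).trans (by linarith)) (hY₂ _ h) (Real.exp_pos _).le (by linarith)
      simp [hw']; linarith
    · rw [ew, mul_comm (M + 1)]
      refine mul_le_mul (hY₁ _ ?_) (hle.trans (by linarith)) (Real.exp_pos _).le he'0.le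
      have := abs_sub_abs_le_abs_sub z.im (-w.im)
      rw [abs_neg, sub_neg_eq_add, add_comm] at this
      have := le_max_left Y₂ 0
      linarith

/-! ### The Laplace transform and its inversion. -/

/-- The Laplace transform of a complex valued function. -/
noncomputable def complexLaplace (f : ℝ → ℂ) (z : ℂ) : ℂ :=
  ∫ t in Ioi (0 : ℝ), Complex.exp (-(z * (t : ℂ))) * f t

theorem laplaceTransform_eq_complexLaplace (a : ℝ → ℝ) (z : ℂ) :
    laplaceTransform a z = complexLaplace (fun t => (a t : ℂ)) z := rfl

theorem norm_exp_neg_mul_ofReal (z : ℂ) (t : ℝ) :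
    ‖Complex.exp (-(z * (t : ℂ)))‖ = Real.exp (-(z.re * t)) := by
  rw [Complex.norm_exp]; simp

/-- Absolute convergence of the Laplace integral at `z`. -/
def LaplaceConverges (f : ℝ → ℂ) (z : ℂ) : Prop :=
  IntegrableOn (fun t : ℝ => Complex.exp (-(z * (t : ℂ))) * f t) (Ioi 0)

theorem LaplaceConverges.of_exp_bound {f : ℝ → ℂ} {C K : ℝ} {z : ℂ}
    (hm : AEStronglyMeasurable f (volume.restrict (Ioi 0)))
    (hf : ∀ t, 0 < t → ‖f t‖ ≤ C * Real.exp (K * t)) (hz : K < z.re) : LaplaceConverges f z := by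
  have hi : IntegrableOn (fun t : ℝ => C * Real.exp (-(z.re - K) * t)) (Ioi 0) :=
    (exp_neg_integrableOn_Ioi 0 (by linarith)).const_mul C
  refine Integrable.mono' hi ((Continuous.aestronglyMeasurable (by fun_prop)).mul hm) ?_
  filter_upwards [ae_restrict_mem measurableSet_Ioi] with t ht
  rw [norm_mul, norm_exp_neg_mul_ofReal]
  calc Real.exp (-(z.re * t)) * ‖f t‖ ≤ Real.exp (-(z.re * t)) * (C * Real.exp (K * t)) := by
        gcongr; exact hf t ht
    _ = C * (Real.exp (-(z.re * t)) * Real.exp (K * t)) := by ring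
    _ = C * Real.exp (-(z.re - K) * t) := by rw [← Real.exp_add]; ring_nf

theorem LaplaceConverges.add {f g : ℝ → ℂ} {z : ℂ} (hf : LaplaceConverges f z)
    (hg : LaplaceConverges g z) : LaplaceConverges (fun t => f t + g t) z := by
  exact IntegrableOn.congr_fun (Integrable.add hf hg) (fun t _ => by simp [mul_add])
    measurableSet_Ioi

theorem complexLaplace_add {f g : ℝ → ℂ} {z : ℂ} (hf : LaplaceConverges f z)
    (hg : LaplaceConverges g z) :
    complexLaplace (fun t => f t + g t) z = complexLaplace f z + complexLaplace g z := by
  simp only [complexLaplace, mul_add]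
  exact integral_add hf hg

theorem complexLaplace_const (c : ℂ) {z : ℂ} (hz : 0 < z.re) :
    complexLaplace (fun _ => c) z = c / z := by
  have h := integral_exp_mul_complex_Ioi (a := -z) (by simpa using hz) 0
  simp only [complexLaplace, integral_mul_const]
  have h2 : ∀ t : ℝ, Complex.exp (-(z * t)) = Complex.exp (-z * t) := fun t => by rw [neg_mul]
  simp only [h2, h]
  simp
  ring

theorem laplaceConverges_const (c : ℂ) {z : ℂ} (hz : 0 < z.re) :
    LaplaceConverges (fun _ => c) z :=
  .of_exp_bound (C := ‖c‖) (K := 0) aestronglyMeasurable_const (by simp) hz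

/-- The weight is multiplicative, `e^{-zt} = e^{-zs} e^{-z(t-s)}`, so the weighted convolution is
the convolution of the weighted functions. -/
theorem laplaceConverges_convolution {f g : ℝ → ℂ} {z : ℂ} (hf : LaplaceConverges f z)
    (hg : LaplaceConverges g z) :
    LaplaceConverges (fun t => ∫ s in (0 : ℝ)..t, f s * g (t - s)) z := by
  have h := integrable_posConvolution hf hg (ContinuousLinearMap.mul ℝ ℂ)
  have h2 := h.integrableOn (s := Ioi (0 : ℝ))
  refine h2.congr_fun (fun t ht => ?_) measurableSet_Ioi
  simp only [posConvolution, indicator_of_mem ht]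
  rw [← intervalIntegral.integral_const_mul]
  refine intervalIntegral.integral_congr fun s _ => ?_
  simp only [ContinuousLinearMap.mul_apply']
  rw [show -(z * (t : ℂ)) = -(z * (s : ℂ)) + -(z * ((t - s : ℝ) : ℂ)) by push_cast; ring,
    Complex.exp_add]
  ring

theorem complexLaplace_convolution {f g : ℝ → ℂ} {z : ℂ} (hf : LaplaceConverges f z)
    (hg : LaplaceConverges g z) :
    complexLaplace (fun t => ∫ s in (0 : ℝ)..t, f s * g (t - s)) z
      = complexLaplace f z * complexLaplace g z := by
  have h := integral_posConvolution hf hg (ContinuousLinearMap.mul ℝ ℂ)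
  simp only [ContinuousLinearMap.mul_apply'] at h
  rw [complexLaplace, complexLaplace, complexLaplace, ← h]
  refine setIntegral_congr_fun measurableSet_Ioi fun t _ => ?_
  rw [← intervalIntegral.integral_const_mul]
  refine intervalIntegral.integral_congr fun s _ => ?_
  rw [show -(z * (t : ℂ)) = -(z * (s : ℂ)) + -(z * ((t - s : ℝ) : ℂ)) by push_cast; ring,
    Complex.exp_add]
  ring

theorem laplaceConverges_primitive {f : ℝ → ℂ} {z : ℂ} (hz : 0 < z.re)
    (hf : LaplaceConverges f z) : LaplaceConverges (fun t => ∫ s in (0 : ℝ)..t, f s) z := by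
  simpa using laplaceConverges_convolution hf (laplaceConverges_const 1 hz)

theorem complexLaplace_primitive {f : ℝ → ℂ} {z : ℂ} (hz : 0 < z.re)
    (hf : LaplaceConverges f z) :
    complexLaplace (fun t => ∫ s in (0 : ℝ)..t, f s) z = complexLaplace f z / z := by
  have := complexLaplace_convolution hf (laplaceConverges_const 1 hz)
  rw [complexLaplace_const 1 hz] at this
  simpa [div_eq_mul_inv] using this

/-- The inversion formula for the Laplace transform. -/
theorem eq_integral_complexLaplace {f : ℝ → ℂ} {σ : ℝ} (hf : Continuous f)
    (h0 : ∀ t ≤ 0, f t = 0) (hc : LaplaceConverges f σ)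
    (hi : Integrable fun y : ℝ => complexLaplace f (σ + y * Complex.I)) (t : ℝ) :
    f t = (2 * Real.pi : ℝ)⁻¹ •
      ∫ y : ℝ, Complex.exp ((σ + y * Complex.I) * t) * complexLaplace f (σ + y * Complex.I) := by
  -- Laplace inversion is Fourier inversion for `e^{-σt} f(t)`, which is continuous and integrable
  -- on the whole line because `f` vanishes for `t ≤ 0`.
  let g : ℝ → ℂ := fun t => Complex.exp (-(σ * (t : ℂ))) * f t
  have hgc : Continuous g := by fun_prop
  have hgi : Integrable g := by
    rw [← integrableOn_univ, ← Iic_union_Ioi (a := (0 : ℝ))]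
    refine IntegrableOn.union ?_ hc
    exact integrableOn_zero.congr_fun (fun t ht => by simp [g, h0 t ht]) measurableSet_Iic
  have hg0 : ∀ t ∉ Ioi (0 : ℝ), g t = 0 := fun t ht => by simp [g, h0 t (not_lt.1 ht)]
  have hFg : ∀ v : ℝ, 𝓕 g v = complexLaplace f (σ + ((2 * Real.pi * v : ℝ) : ℂ) * Complex.I) := by
    intro v
    rw [Real.fourier_eq', complexLaplace,
      ← setIntegral_eq_integral_of_forall_compl_eq_zero (s := Ioi (0 : ℝ))
        (fun x hx => by simp [hg0 x hx])]
    refine integral_congr_ae (.of_forall fun t => ?_)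
    simp only [g, smul_eq_mul, ← mul_assoc, ← Complex.exp_add]
    rw [show (inner ℝ t v : ℝ) = v * t from rfl]
    congr 2
    push_cast
    ring
  have hp : (2 * Real.pi) ≠ 0 := by positivity
  have hFi : Integrable (𝓕 g) := by
    have := hi.comp_mul_left' hp
    refine this.congr (.of_forall fun v => ?_)
    simp only [hFg]
  have hinv := congrFun (hgc.fourierInv_fourier_eq hgi hFi) t
  rw [Real.fourierInv_eq'] at hinv
  have h2 : ∫ v : ℝ, Complex.exp (↑(2 * Real.pi * inner ℝ v t) * Complex.I) • 𝓕 g v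
      = (2 * Real.pi : ℝ)⁻¹ • ∫ y : ℝ, Complex.exp (y * t * Complex.I)
          * complexLaplace f (σ + y * Complex.I) := by
    have := Measure.integral_comp_mul_left (fun y : ℝ => Complex.exp (y * t * Complex.I)
          * complexLaplace f (σ + y * Complex.I)) (2 * Real.pi)
    rw [abs_of_pos (by positivity)] at this
    rw [← this]
    refine integral_congr_ae (.of_forall fun v => ?_)
    simp only [hFg, smul_eq_mul]
    congr 2
    simp
    ring
  rw [h2] at hinv
  have h3 : f t = Complex.exp (σ * (t : ℂ)) * g t := by
    simp only [g, ← mul_assoc, ← Complex.exp_add]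
    simp
  rw [h3, ← hinv, mul_smul_comm, ← integral_const_mul]
  congr 1
  refine integral_congr_ae (.of_forall fun y => ?_)
  simp only [← mul_assoc, ← Complex.exp_add]
  congr 2
  ring

theorem hasDerivAt_complexLaplace {f : ℝ → ℂ} {C K : ℝ} {z : ℂ}
    (hm : AEStronglyMeasurable f (volume.restrict (Ioi 0)))
    (hf : ∀ t, 0 < t → ‖f t‖ ≤ C * Real.exp (K * t)) (hz : K < z.re) :
    HasDerivAt (complexLaplace f) (-complexLaplace (fun t => t * f t) z) z := by
  -- The gap between `K` and `K'` absorbs the factor `t` from differentiation; the gap between `K'`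
  -- and `K''` leaves an integrable majorant, valid for all `w` with `Re w > K''`.
  obtain ⟨K', hK, hK'⟩ := exists_between hz
  obtain ⟨K'', hK'', hK'z⟩ := exists_between hK'
  have hC : 0 ≤ C := by
    have := (norm_nonneg _).trans (hf 1 one_pos)
    exact nonneg_of_mul_nonneg_left this (Real.exp_pos _)
  have hte : ∀ t : ℝ, 0 < t → t ≤ (K' - K)⁻¹ * Real.exp ((K' - K) * t) := by
    intro t ht
    rw [inv_mul_eq_div, le_div_iff₀ (by linarith)]
    have := Real.add_one_le_exp ((K' - K) * t)
    nlinarith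
  have h := hasDerivAt_integral_of_dominated_loc_of_deriv_le
    (μ := volume.restrict (Ioi (0 : ℝ))) (x₀ := z) (s := {w : ℂ | K'' < w.re})
    (F := fun w t => Complex.exp (-(w * (t : ℂ))) * f t)
    (F' := fun w t => -(t : ℂ) * Complex.exp (-(w * (t : ℂ))) * f t)
    (bound := fun t => (K' - K)⁻¹ * C * Real.exp (-(K'' - K') * t))
    ((isOpen_lt continuous_const Complex.continuous_re).mem_nhds hK'z)
    (.of_forall fun w => (Continuous.aestronglyMeasurable (by fun_prop)).mul hm)
    (LaplaceConverges.of_exp_bound hm hf hz)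
    ((Continuous.aestronglyMeasurable (by fun_prop)).mul hm) ?_
    ((exp_neg_integrableOn_Ioi 0 (by linarith)).const_mul _) ?_
  · refine h.2.congr_deriv ?_
    rw [complexLaplace, ← integral_neg]
    refine integral_congr_ae (.of_forall fun t => ?_)
    simp only
    ring
  · filter_upwards [ae_restrict_mem measurableSet_Ioi] with t ht w hw
    have ht' : (0 : ℝ) < t := ht
    have hw' : K'' < w.re := hw
    rw [norm_mul, norm_mul, norm_exp_neg_mul_ofReal, norm_neg, Complex.norm_real,
      Real.norm_of_nonneg ht'.le]
    calc t * Real.exp (-(w.re * t)) * ‖f t‖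
        ≤ ((K' - K)⁻¹ * Real.exp ((K' - K) * t)) * Real.exp (-(K'' * t))
            * (C * Real.exp (K * t)) := by
          have := hf t ht
          have := hte t ht
          gcongr
      _ = (K' - K)⁻¹ * C * (Real.exp ((K' - K) * t) * Real.exp (-(K'' * t))
            * Real.exp (K * t)) := by ring
      _ = _ := by rw [← Real.exp_add, ← Real.exp_add]; ring_nf
  · filter_upwards with t w _
    have : HasDerivAt (fun w : ℂ => Complex.exp (-(w * (t : ℂ))) * f t)
        (Complex.exp (-(z * (t : ℂ))) * (-(1 * t)) * f t) z :=
      (((hasDerivAt_id z).mul_const (t : ℂ)).neg.cexp).mul_const _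
    have : HasDerivAt (fun w : ℂ => Complex.exp (-(w * (t : ℂ))) * f t)
        (Complex.exp (-(w * (t : ℂ))) * (-(1 * t)) * f t) w :=
      (((hasDerivAt_id w).mul_const (t : ℂ)).neg.cexp).mul_const _
    refine this.congr_deriv ?_
    ring

/-! ### The memory kernel and its primitive. -/

section Kernel

variable {a : ℝ → ℝ}

theorem IsMemoryKernel.integrableOn_Ioc (ha : IsMemoryKernel a) (T : ℝ) :
    IntegrableOn a (Ioc 0 T) := by
  obtain ⟨M, hM⟩ := ha.bounded 1 one_pos
  have h1 : IntegrableOn a (Icc 1 T) := by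
    rcases le_or_gt 1 T with h | h
    · refine Integrable.of_bound ?_ M ?_
      · exact ha.aestronglyMeasurable.mono_measure
          (Measure.restrict_mono (s := Icc 1 T)
          (fun x hx => lt_of_lt_of_le one_pos hx.1) le_rfl)
      · filter_upwards [ae_restrict_mem measurableSet_Icc] with t ht using hM t ht.1
    · simp [Icc_eq_empty (not_le.2 h)]
  refine (ha.integrableOn.union h1).mono_set fun t ht => ?_
  rcases lt_or_ge t 1 with h | h
  · exact Or.inl ⟨ht.1, h⟩
  · exact Or.inr ⟨h, ht.2⟩

theorem IsMemoryKernel.intervalIntegrable (ha : IsMemoryKernel a) {s t : ℝ} (hs : 0 ≤ s)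
    (ht : 0 ≤ t) : IntervalIntegrable a volume s t := by
  rw [intervalIntegrable_iff]
  refine (ha.integrableOn_Ioc (max s t)).mono_set ?_
  rw [uIoc]
  exact Ioc_subset_Ioc_left (le_min hs ht)

theorem IsMemoryKernel.laplaceConverges (ha : IsMemoryKernel a) {z : ℂ} (hz : 0 < z.re) :
    LaplaceConverges (fun t => (a t : ℂ)) z := by
  obtain ⟨M, hM⟩ := ha.bounded 1 one_pos
  have hm : AEStronglyMeasurable (fun t : ℝ => Complex.exp (-(z * (t : ℂ))) * (a t : ℂ))
      (volume.restrict (Ioi 0)) :=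
    (Continuous.aestronglyMeasurable (by fun_prop)).mul
      (Complex.continuous_ofReal.comp_aestronglyMeasurable ha.aestronglyMeasurable)
  rw [LaplaceConverges, ← Ioc_union_Ioi_eq_Ioi zero_le_one]
  refine IntegrableOn.union ?_ ?_
  · refine Integrable.mono (ha.integrableOn_Ioc 1) (hm.mono_measure
      (Measure.restrict_mono Ioc_subset_Ioi_self le_rfl)) ?_
    filter_upwards [ae_restrict_mem measurableSet_Ioc] with t ht
    rw [norm_mul, norm_exp_neg_mul_ofReal, Complex.norm_real]
    refine mul_le_of_le_one_left (norm_nonneg _) (Real.exp_le_one_iff.2 ?_)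
    have := mul_pos hz ht.1
    linarith
  · have hi : IntegrableOn (fun t : ℝ => M * Real.exp (-z.re * t)) (Ioi 1) :=
      (exp_neg_integrableOn_Ioi 1 hz).const_mul M
    refine Integrable.mono' hi (hm.mono_measure
      (Measure.restrict_mono (Ioi_subset_Ioi zero_le_one) le_rfl)) ?_
    filter_upwards [ae_restrict_mem measurableSet_Ioi] with t ht
    rw [norm_mul, norm_exp_neg_mul_ofReal, Complex.norm_real, mul_comm, neg_mul]
    gcongr
    exact hM t (le_of_lt ht)

theorem IsMemoryKernel.continuousOn_integratedKernel (ha : IsMemoryKernel a) (a₀ : ℝ) :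
    ContinuousOn (integratedKernel a₀ a) (Ici 0) := by
  intro t ht
  have ht' : (0 : ℝ) ≤ t := ht
  have h := intervalIntegral.continuousOn_primitive_interval (a := 0) (b := t + 1) (f := a)
    (μ := volume) (by
      rw [uIcc_of_le (by linarith), integrableOn_Icc_iff_integrableOn_Ioc]
      exact ha.integrableOn_Ioc _)
  rw [uIcc_of_le (by linarith)] at h
  have h2 : ContinuousWithinAt (integratedKernel a₀ a) (Icc 0 (t + 1)) t :=
    continuousWithinAt_const.add (h t ⟨ht, by linarith⟩)
  refine h2.mono_of_mem_nhdsWithin ?_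
  rw [← Ici_inter_Iic]
  exact inter_mem self_mem_nhdsWithin (mem_nhdsWithin_of_mem_nhds (Iic_mem_nhds (by linarith)))

/-- The kernel is bounded on `[1, ∞)`, so its primitive grows at most linearly. The crude majorant
`e^t` suffices for the later Grönwall argument. -/
theorem IsMemoryKernel.exists_abs_integratedKernel_le (ha : IsMemoryKernel a) (a₀ : ℝ) :
    ∃ C : ℝ, 0 ≤ C ∧ ∀ t, 0 ≤ t → |integratedKernel a₀ a t| ≤ C * Real.exp t := by
  obtain ⟨M, hM⟩ := ha.bounded 1 one_pos
  have hM0 : 0 ≤ M := (abs_nonneg _).trans (hM 1 le_rfl)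
  obtain ⟨B, hB⟩ := isCompact_Icc.exists_bound_of_continuousOn
    ((ha.continuousOn_integratedKernel a₀).mono (Icc_subset_Ici_self : Icc (0 : ℝ) 1 ⊆ Ici 0))
  have hB0 : 0 ≤ B := (norm_nonneg _).trans (hB 0 (by simp))
  refine ⟨B + M, by positivity, fun t ht => ?_⟩
  have he : 1 ≤ Real.exp t := Real.one_le_exp ht
  rcases le_total t 1 with h | h
  · have := hB t ⟨ht, h⟩
    rw [Real.norm_eq_abs] at this
    nlinarith
  · have h1 : integratedKernel a₀ a t = integratedKernel a₀ a 1 + ∫ s in (1 : ℝ)..t, a s := by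
      simp only [integratedKernel]
      rw [add_assoc, intervalIntegral.integral_add_adjacent_intervals
        (ha.intervalIntegrable le_rfl zero_le_one) (ha.intervalIntegrable zero_le_one ht)]
    have h2 : ‖∫ s in (1 : ℝ)..t, a s‖ ≤ M * |t - 1| :=
      intervalIntegral.norm_integral_le_of_norm_le_const fun s hs => by
        rw [uIoc_of_le h] at hs
        exact hM s hs.1.le
    have h3 := hB 1 (by simp)
    rw [Real.norm_eq_abs] at h2 h3
    rw [abs_of_nonneg (by linarith : (0 : ℝ) ≤ t - 1)] at h2
    rw [h1]
    refine (abs_add_le _ _).trans ?_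
    have := Real.add_one_le_exp t
    nlinarith

theorem IsMemoryKernel.laplaceConverges_integratedKernel (ha : IsMemoryKernel a) (a₀ : ℝ) {z : ℂ}
    (hz : 0 < z.re) : LaplaceConverges (fun t => (integratedKernel a₀ a t : ℂ)) z := by
  have := (laplaceConverges_const (a₀ : ℂ) hz).add
    (laplaceConverges_primitive hz (ha.laplaceConverges hz))
  simpa only [integratedKernel, Complex.ofReal_add, intervalIntegral.integral_ofReal] using this

theorem IsMemoryKernel.complexLaplace_integratedKernel (ha : IsMemoryKernel a) (a₀ : ℝ) {z : ℂ}
    (hz : 0 < z.re) : complexLaplace (fun t => (integratedKernel a₀ a t : ℂ)) z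
      = (a₀ + laplaceTransform a z) / z := by
  have := complexLaplace_add (laplaceConverges_const (a₀ : ℂ) hz)
    (laplaceConverges_primitive hz (ha.laplaceConverges hz))
  rw [complexLaplace_const _ hz, complexLaplace_primitive hz (ha.laplaceConverges hz)] at this
  simp only [integratedKernel, Complex.ofReal_add, ← intervalIntegral.integral_ofReal]
  rw [this, laplaceTransform_eq_complexLaplace]
  ring

/-- A memory kernel is determined by its Laplace transform. -/
theorem IsMemoryKernel.ae_eq_zero (ha : IsMemoryKernel a)
    (h : ∀ z : ℂ, 0 < z.re → laplaceTransform a z = 0) :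
    a =ᵐ[volume.restrict (Ioi (0 : ℝ))] 0 := by
  -- Inversion needs a continuous function, hence the passage to the primitive, which is constant
  -- zero for negative times. Lebesgue differentiation then returns to the kernel.
  let f : ℝ → ℂ := fun t => (integratedKernel 0 a (max t 0) : ℂ)
  have hfc : Continuous f := by
    refine Complex.continuous_ofReal.comp ?_
    exact (ha.continuousOn_integratedKernel 0).comp_continuous (by fun_prop) fun t =>
      le_max_right t 0
  have hf0 : ∀ t ≤ 0, f t = 0 := fun t ht => by simp [f, max_eq_right ht, integratedKernel]
  have hfe : EqOn (fun t => (integratedKernel 0 a t : ℂ)) f (Ioi 0) := fun t ht => by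
    simp [f, max_eq_left (le_of_lt (show (0 : ℝ) < t from ht))]
  have hfi : LaplaceConverges f ((1 : ℝ) : ℂ) := by
    refine IntegrableOn.congr_fun (ha.laplaceConverges_integratedKernel 0
      (z := ((1 : ℝ) : ℂ)) (by simp)) (fun t ht => ?_) measurableSet_Ioi
    simp only [hfe ht]
  have hfl : ∀ z : ℂ, 0 < z.re → complexLaplace f z = 0 := by
    intro z hz
    have := ha.complexLaplace_integratedKernel 0 hz
    rw [h z hz] at this
    rw [complexLaplace] at this ⊢
    rw [← setIntegral_congr_fun measurableSet_Ioi (fun t ht => by rw [← hfe ht]), this]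
    simp
  have hz : ∀ y : ℝ, complexLaplace f ((1 : ℝ) + y * Complex.I) = 0 := fun y => hfl _ (by simp)
  have hf : ∀ t, f t = 0 := by
    intro t
    rw [eq_integral_complexLaplace hfc hf0 hfi (by simp only [hz]; exact integrable_zero _ _ _) t]
    simp only [hz]
    simp
  have hloc : ∀ t, 0 ≤ t → ∫ s in (0 : ℝ)..t, a s = 0 := by
    intro t ht
    have := hf t
    simpa [f, max_eq_left ht, integratedKernel] using this
  have hlocint : LocallyIntegrable ((Ioi (0 : ℝ)).indicator a) := by
    refine fun x => ⟨Iio (|x| + 1), Iio_mem_nhds (by linarith [le_abs_self x]), ?_⟩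
    rw [IntegrableOn, integrable_indicator_iff measurableSet_Ioi, IntegrableOn,
      Measure.restrict_restrict measurableSet_Ioi]
    refine (ha.integrableOn_Ioc (|x| + 1)).mono_set ?_
    rintro y ⟨hy1, hy2⟩
    exact ⟨hy1, le_of_lt hy2⟩
  have hae := LocallyIntegrable.ae_hasDerivAt_integral hlocint
  rw [EventuallyEq, ae_restrict_iff' measurableSet_Ioi]
  filter_upwards [hae] with x hx hx0
  have h1 := hx 0
  have h2 : (fun t => ∫ s in (0 : ℝ)..t, (Ioi (0 : ℝ)).indicator a s) =ᶠ[𝓝 x] fun _ => 0 := by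
    filter_upwards [Ioi_mem_nhds hx0] with t ht
    refine Eq.trans ?_ (hloc t (le_of_lt ht))
    refine intervalIntegral.integral_congr_ae (.of_forall fun s hs => ?_)
    rw [uIoc_of_le (le_of_lt ht)] at hs
    exact indicator_of_mem (show s ∈ Ioi (0 : ℝ) from hs.1) a
  have h3 := h1.unique ((hasDerivAt_const x (0 : ℝ)).congr_of_eventuallyEq h2)
  rwa [indicator_of_mem hx0] at h3

end Kernel

/-! ### Passive symbols and decay of the scalar resolvent. -/

theorem integrable_inv_one_add_mul_sq {c : ℝ} (hc : 0 < c) :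
    Integrable fun y : ℝ => (1 + (c * y) ^ 2)⁻¹ :=
  integrable_inv_one_add_sq.comp_mul_left' hc.ne'

theorem integral_inv_one_add_mul_sq {c : ℝ} (hc : 0 < c) :
    ∫ y : ℝ, (1 + (c * y) ^ 2)⁻¹ = Real.pi / c := by
  have := Measure.integral_comp_mul_left (fun y : ℝ => (1 + y ^ 2)⁻¹) c
  rw [this, integral_univ_inv_one_add_sq, abs_of_pos (inv_pos.2 hc), smul_eq_mul]
  ring

/-- A bounded holomorphic symbol with positive real part on `{Re z > -β}` and bounded derivative
that is real on the real axis. -/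
structure IsPassiveSymbol (G : ℂ → ℂ) (β M L : ℝ) : Prop where
  pos : 0 < β
  differentiableOn : DifferentiableOn ℂ G {z | -β < z.re}
  norm_le : ∀ z : ℂ, -β < z.re → ‖G z‖ ≤ M
  norm_deriv_le : ∀ z : ℂ, -β < z.re → ‖deriv G z‖ ≤ L
  re_pos : ∀ z : ℂ, -β < z.re → 0 < (G z).re
  conj_symm : ∀ z : ℂ, -β < z.re → G (starRingEnd ℂ z) = starRingEnd ℂ (G z)

/-- The denominator `z + ρ G(z)` of the Laplace transform of the scalar resolvent. -/
noncomputable def resolventSymbol (G : ℂ → ℂ) (ρ : ℝ) (z : ℂ) : ℂ := z + ρ * G z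

/-- The integrand `e^{zt} D'(z) / D(z)²`, where `D(z) = z + ρ G(z)`. -/
noncomputable def resolventIntegrand (G : ℂ → ℂ) (ρ t : ℝ) (z : ℂ) : ℂ :=
  Complex.exp (z * t) * ((1 + ρ * deriv G z) / resolventSymbol G ρ z ^ 2)

/-- The scalar resolvent `R(ρ, t)`, with Laplace transform `(z + ρ G(z))⁻¹`. -/
noncomputable def resolventKernel (G : ℂ → ℂ) (ρ t : ℝ) : ℂ :=
  (2 * Real.pi * t : ℝ)⁻¹ • ∫ y : ℝ, resolventIntegrand G ρ t ((1 : ℝ) + y * Complex.I)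

namespace IsPassiveSymbol

variable {G : ℂ → ℂ} {β M L : ℝ}

theorem differentiableAt (hG : IsPassiveSymbol G β M L) {z : ℂ} (hz : -β < z.re) :
    DifferentiableAt ℂ G z :=
  hG.differentiableOn.differentiableAt
    ((isOpen_lt continuous_const Complex.continuous_re).mem_nhds hz)

theorem differentiableAt_deriv (hG : IsPassiveSymbol G β M L) {z : ℂ} (hz : -β < z.re) :
    DifferentiableAt ℂ (deriv G) z :=
  (hG.differentiableOn.deriv (isOpen_lt continuous_const Complex.continuous_re)).differentiableAt
    ((isOpen_lt continuous_const Complex.continuous_re).mem_nhds hz)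

theorem M_nonneg (hG : IsPassiveSymbol G β M L) : 0 ≤ M :=
  (norm_nonneg _).trans (hG.norm_le 0 (by simpa using hG.pos))

theorem L_nonneg (hG : IsPassiveSymbol G β M L) : 0 ≤ L :=
  (norm_nonneg _).trans (hG.norm_deriv_le 0 (by simpa using hG.pos))

theorem norm_deriv_mul_le (hG : IsPassiveSymbol G β M L) {z : ℂ} (hz : -β < z.re) :
    ‖deriv G z‖ * (z.re + β) ≤ 2 * (G z).re := by
  have hsub : ∀ w ∈ Metric.ball z (z.re + β), -β < w.re := by
    intro w hw
    have h1 : ‖w - z‖ < z.re + β := by simpa [dist_eq_norm] using hw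
    have h2 := (abs_le.1 (Complex.abs_re_le_norm (w - z))).1
    rw [Complex.sub_re] at h2
    linarith
  exact norm_deriv_mul_le_two_re (by linarith) (hG.differentiableOn.mono hsub)
    fun w hw => (hG.re_pos w (hsub w hw)).le

/-- The sector estimate for the half plane with its boundary moved to `Re z = -β`: `|arg G(z)| ≤
|arg (z + β)|`. It stays useful to the left of the imaginary axis. -/
theorem mul_abs_im_le (hG : IsPassiveSymbol G β M L) {z : ℂ} (hz : -β < z.re) :
    (z.re + β) * |(G z).im| ≤ |z.im| * (G z).re := by
  have := re_mul_abs_im_le_of_conj_symm (f := fun w => G (w - β)) (ζ := z + β)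
    (hG.differentiableOn.comp (by fun_prop) fun w hw => by
      have : 0 < w.re := hw
      simpa using this)
    (fun w hw => (hG.re_pos _ (by simpa using hw)).le)
    (fun w hw => by
      rw [← hG.conj_symm _ (by simpa using hw)]
      simp) (by simp; linarith)
  simpa using this

/-- The mean value inequality between `z` and its conjugate, where `G` takes conjugate values. -/
theorem abs_im_le (hG : IsPassiveSymbol G β M L) {z : ℂ} (hz : -β < z.re) :
    |(G z).im| ≤ L * |z.im| := by
  have hconv : Convex ℝ {w : ℂ | -β < w.re} := convex_halfSpace_re_gt _
  have := hconv.norm_image_sub_le_of_norm_deriv_le (f := G) (C := L)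
    (x := starRingEnd ℂ z) (y := z) (fun w hw => hG.differentiableAt hw)
    (fun w hw => hG.norm_deriv_le w hw) (show -β < (starRingEnd ℂ z).re by simpa using hz) hz
  rw [hG.conj_symm z hz, Complex.sub_conj, Complex.sub_conj] at this
  simp at this
  linarith

theorem resolventSymbol_re (G : ℂ → ℂ) (ρ : ℝ) (z : ℂ) :
    (resolventSymbol G ρ z).re = z.re + ρ * (G z).re := by
  simp [resolventSymbol]

theorem resolventSymbol_im (G : ℂ → ℂ) (ρ : ℝ) (z : ℂ) :
    (resolventSymbol G ρ z).im = z.im + ρ * (G z).im := by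
  simp [resolventSymbol]

theorem re_le_re_resolventSymbol (hG : IsPassiveSymbol G β M L) {ρ : ℝ} (hρ : 0 ≤ ρ) {z : ℂ}
    (hz : -β < z.re) : z.re ≤ (resolventSymbol G ρ z).re := by
  rw [resolventSymbol_re]
  have := mul_nonneg hρ (hG.re_pos z hz).le
  linarith

theorem resolventSymbol_ne_zero (hG : IsPassiveSymbol G β M L) {ρ : ℝ} (hρ : 0 ≤ ρ) {z : ℂ}
    (hz : 0 < z.re) : resolventSymbol G ρ z ≠ 0 := by
  intro h
  have := hG.re_le_re_resolventSymbol hρ (z := z) (by linarith [hG.pos])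
  rw [h, Complex.zero_re] at this
  linarith

theorem norm_resolventSymbol_ge (hG : IsPassiveSymbol G β M L) {ρ : ℝ} (hρ : 0 ≤ ρ) {z : ℂ}
    (hz : -β < z.re) : ‖z‖ - ρ * M ≤ ‖resolventSymbol G ρ z‖ := by
  have h1 : ‖z‖ - ‖(ρ : ℂ) * G z‖ ≤ ‖z + ρ * G z‖ := by
    have := norm_sub_norm_le z (-((ρ : ℂ) * G z))
    rwa [norm_neg, sub_neg_eq_add] at this
  have h2 : ‖(ρ : ℂ) * G z‖ ≤ ρ * M := by
    rw [norm_mul, Complex.norm_real, Real.norm_of_nonneg hρ]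
    gcongr
    exact hG.norm_le z hz
  rw [resolventSymbol]
  linarith

theorem norm_one_add_le (hG : IsPassiveSymbol G β M L) {ρ : ℝ} (hρ : 0 ≤ ρ) {z : ℂ}
    (hz : -β < z.re) : ‖1 + ρ * deriv G z‖ ≤ 1 + ρ * L := by
  refine (norm_add_le _ _).trans ?_
  rw [norm_one, norm_mul, Complex.norm_real, Real.norm_of_nonneg hρ]
  gcongr
  exact hG.norm_deriv_le z hz

theorem norm_resolventIntegrand (G : ℂ → ℂ) (ρ t : ℝ) (z : ℂ) :
    ‖resolventIntegrand G ρ t z‖ = Real.exp (z.re * t) *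
      (‖1 + ρ * deriv G z‖ / ‖resolventSymbol G ρ z‖ ^ 2) := by
  rw [resolventIntegrand, norm_mul, norm_div, norm_pow, Complex.norm_exp]
  simp

theorem differentiableAt_resolventIntegrand (hG : IsPassiveSymbol G β M L) {ρ : ℝ} (t : ℝ) {z : ℂ}
    (hz : -β < z.re) (h0 : resolventSymbol G ρ z ≠ 0) :
    DifferentiableAt ℂ (resolventIntegrand G ρ t) z := by
  have h1 := hG.differentiableAt hz
  have h2 := hG.differentiableAt_deriv hz
  unfold resolventIntegrand
  refine DifferentiableAt.mul (by fun_prop) (DifferentiableAt.div (by fun_prop) ?_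
    (pow_ne_zero 2 h0))
  unfold resolventSymbol
  fun_prop

/-- Beyond the threshold `2ρM + 1` the term `ρ G` has modulus at most `|Im z| / 2`, so `|D| ≥ |Im z|
/ 2`. This quadratic decay is what contour shifts require. -/
theorem norm_resolventIntegrand_le (hG : IsPassiveSymbol G β M L) {ρ t x : ℝ} (hρ : 0 ≤ ρ)
    (ht : 0 ≤ t) {z : ℂ} (hz : -β < z.re) (hx : z.re ≤ x) (hy : 2 * ρ * M + 1 ≤ |z.im|) :
    ‖resolventIntegrand G ρ t z‖ ≤ (4 * Real.exp (x * t) * (1 + ρ * L)) / z.im ^ 2 := by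
  rw [norm_resolventIntegrand]
  have h1 := hG.norm_resolventSymbol_ge hρ hz
  have h2 := Complex.abs_im_le_norm z
  have hM := mul_nonneg hρ hG.M_nonneg
  have h3 : |z.im| / 2 ≤ ‖resolventSymbol G ρ z‖ := by linarith
  have h4 : 0 < |z.im| := by linarith
  have h5 : z.im ^ 2 / 4 ≤ ‖resolventSymbol G ρ z‖ ^ 2 := by
    rw [← sq_abs]; nlinarith
  have h6 : 0 < z.im ^ 2 := by rw [← sq_abs]; positivity
  calc _ ≤ Real.exp (x * t) * ((1 + ρ * L) / (z.im ^ 2 / 4)) := by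
        gcongr
        · exact add_nonneg zero_le_one (mul_nonneg hρ hG.L_nonneg)
        · exact hG.norm_one_add_le hρ hz
    _ = _ := by field_simp

theorem integral_resolventIntegrand_eq (hG : IsPassiveSymbol G β M L) {ρ t x₁ x₂ : ℝ} (hρ : 0 ≤ ρ)
    (ht : 0 ≤ t) (hβ : -β < x₁) (hx : x₁ ≤ x₂)
    (h0 : ∀ z : ℂ, x₁ ≤ z.re → resolventSymbol G ρ z ≠ 0) :
    ∫ y : ℝ, resolventIntegrand G ρ t (x₁ + y * Complex.I)
      = ∫ y : ℝ, resolventIntegrand G ρ t (x₂ + y * Complex.I) :=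
  integral_vertical_eq hx
    (fun z hz _ => hG.differentiableAt_resolventIntegrand t (hβ.trans_le hz) (h0 z hz))
    fun _ hz hz' hy => hG.norm_resolventIntegrand_le hρ ht (hβ.trans_le hz) hz' hy

/-- The line `Re z = 1` in the definition may be replaced by any line in the domain that has no
zeros of `D` on it or to its right. -/
theorem resolventKernel_eq (hG : IsPassiveSymbol G β M L) {ρ t x : ℝ} (hρ : 0 ≤ ρ)
    (ht : 0 ≤ t) (hβ : -β < x) (h0 : ∀ z : ℂ, x ≤ z.re → resolventSymbol G ρ z ≠ 0) :
    resolventKernel G ρ t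
      = (2 * Real.pi * t : ℝ)⁻¹ • ∫ y : ℝ, resolventIntegrand G ρ t (x + y * Complex.I) := by
  rw [resolventKernel]
  congr 1
  rcases le_total x 1 with h | h
  · exact (hG.integral_resolventIntegrand_eq hρ ht hβ h h0).symm
  · refine hG.integral_resolventIntegrand_eq hρ ht (by linarith [hG.pos]) h fun z hz => ?_
    exact hG.resolventSymbol_ne_zero hρ (by linarith)

/-- The real part of `G` may tend to zero at infinity, so a uniform positive lower bound is claimed
only on a compact box. -/
theorem exists_pos_le_re (hG : IsPassiveSymbol G β M L) :
    ∃ g : ℝ, 0 < g ∧ ∀ z : ℂ, -(β / 2) ≤ z.re → z.re ≤ 1 → |z.im| ≤ 1 → g ≤ (G z).re := by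
  have hβ := hG.pos
  have hK : IsCompact (Icc (-(β / 2)) 1 ×ℂ Icc (-1) 1) := isCompact_Icc.reProdIm isCompact_Icc
  have hne : (Icc (-(β / 2)) 1 ×ℂ Icc (-1) 1).Nonempty :=
    ⟨0, by rw [Complex.mem_reProdIm]; simp; linarith⟩
  have hc : ContinuousOn (fun z => (G z).re) (Icc (-(β / 2)) 1 ×ℂ Icc (-1) 1) := by
    intro z hz
    rw [Complex.mem_reProdIm] at hz
    exact (Complex.continuous_re.continuousAt.comp (hG.differentiableAt
      (by linarith [hz.1.1])).continuousAt).continuousWithinAt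
  obtain ⟨w, hw, hmin⟩ := hK.exists_isMinOn hne hc
  rw [Complex.mem_reProdIm] at hw
  refine ⟨(G w).re, hG.re_pos w (by linarith [hw.1.1]), fun z h1 h2 h3 => ?_⟩
  exact hmin (Complex.mem_reProdIm.2 ⟨⟨h1, h2⟩, abs_le.1 h3⟩)

/-- Decay of the resolvent for small frequencies. -/
theorem exists_norm_resolventKernel_le_low (hG : IsPassiveSymbol G β M L) :
    ∃ ρ₀ c C : ℝ, 0 < ρ₀ ∧ 0 < c ∧ 0 < C ∧ ∀ ρ t : ℝ, 0 ≤ ρ → ρ ≤ ρ₀ → 2 ≤ t →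
      ‖resolventKernel G ρ t‖ ≤ C * Real.exp (-(c * (ρ * t))) := by
  obtain ⟨g, hg, hgre⟩ := hG.exists_pos_le_re
  have hβ := hG.pos
  have hL := hG.L_nonneg
  -- The first bound on `ρ` gives `ρL ≤ 1/2`, whence `|Im D| ≥ |Im z| / 2`; the second keeps the
  -- shifted line inside `Re z ≥ -β/2`. The constant `6e` comes from `|D'| ≤ 3/2`, `|D|² ≥ (1 +
  -- (ty)²) / (8t²)` and the factor `e^{xt}`.
  refine ⟨min (1 / (2 * (L + 1))) (β / (2 * g)), g, 6 * Real.exp 1, by positivity, hg,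
    by positivity, fun ρ t hρ hρ' ht => ?_⟩
  have ht0 : 0 < t := by linarith
  have hρL : ρ * L ≤ 1 / 2 := by
    have := hρ'.trans (min_le_left _ _)
    rw [le_div_iff₀ (by positivity)] at this
    nlinarith
  have hρg : g * ρ ≤ β / 2 := by
    have := hρ'.trans (min_le_right _ _)
    rw [le_div_iff₀ (by positivity)] at this
    nlinarith
  -- On this line and to its right `Re D ≥ 1/t` wherever `|Im z| ≤ 1` and `Re z ≤ 1`, because `ρ Re
  -- G ≥ ρg`; and `e^{xt} = e · e^{-gρt}` is the desired decay.
  set x : ℝ := 1 / t - g * ρ with hx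
  have htinv : 0 < 1 / t := by positivity
  have htinv2 : 1 / t ≤ 1 / 2 := one_div_le_one_div_of_le two_pos ht
  have hxβ : -(β / 2) ≤ x := by linarith
  have him : ∀ z : ℂ, -(β / 2) ≤ z.re → |z.im| / 2 ≤ ‖resolventSymbol G ρ z‖ := by
    intro z hz
    refine le_trans ?_ (Complex.abs_im_le_norm _)
    rw [resolventSymbol_im]
    have h1 := hG.abs_im_le (z := z) (by linarith)
    have h2 : |ρ * (G z).im| ≤ |z.im| / 2 := by
      rw [abs_mul, abs_of_nonneg hρ]
      calc ρ * |(G z).im| ≤ ρ * (L * |z.im|) := by gcongr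
        _ = ρ * L * |z.im| := by ring
        _ ≤ 1 / 2 * |z.im| := by gcongr
        _ = _ := by ring
    have h3 := abs_sub_abs_le_abs_sub z.im (-(ρ * (G z).im))
    rw [abs_neg, sub_neg_eq_add] at h3
    linarith
  have hlow : ∀ z : ℂ, x ≤ z.re → z.re ≤ 1 → 1 / t ≤ ‖resolventSymbol G ρ z‖ := by
    intro z hz hz1
    rcases le_total |z.im| 1 with h | h
    · refine le_trans ?_ ((le_abs_self _).trans (Complex.abs_re_le_norm _))
      rw [resolventSymbol_re]
      have := mul_le_mul_of_nonneg_left (hgre z (by linarith) hz1 h) hρ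
      linarith
    · have := him z (by linarith)
      linarith
  rw [hG.resolventKernel_eq hρ ht0.le (x := x) (by linarith) (fun z hz => by
    rcases le_total z.re 1 with h | h
    · exact norm_pos_iff.1 (htinv.trans_le (hlow z hz h))
    · exact hG.resolventSymbol_ne_zero hρ (by linarith))]
  have hb : ∀ y : ℝ, ‖resolventIntegrand G ρ t (x + y * Complex.I)‖
      ≤ Real.exp (x * t) * (12 * t ^ 2) * (1 + (t * y) ^ 2)⁻¹ := by
    intro y
    rw [norm_resolventIntegrand]
    have e1 : ((x : ℂ) + y * Complex.I).re = x := by simp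
    have e2 : ((x : ℂ) + y * Complex.I).im = y := by simp
    have h1 := hlow (x + y * Complex.I) e1.ge (by rw [e1, hx]; nlinarith [mul_nonneg hg.le hρ])
    have h2 := him (x + y * Complex.I) (by rw [e1]; exact hxβ)
    have h3 := hG.norm_one_add_le hρ (z := x + y * Complex.I) (by rw [e1]; linarith)
    rw [e2] at h2
    set D := ‖resolventSymbol G ρ (x + y * Complex.I)‖
    have h4 : (1 + (t * y) ^ 2) / (8 * t ^ 2) ≤ D ^ 2 := by
      have a1 : (1 / t) ^ 2 ≤ D ^ 2 := by gcongr
      have a2 : (|y| / 2) ^ 2 ≤ D ^ 2 := by gcongr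
      rw [div_pow, sq_abs] at a2
      have : (1 + (t * y) ^ 2) / (8 * t ^ 2) = (1 / t) ^ 2 / 8 + y ^ 2 / 8 := by
        field_simp
      rw [this]
      nlinarith
    rw [e1, mul_assoc]
    gcongr
    calc _ ≤ (3 / 2) / ((1 + (t * y) ^ 2) / (8 * t ^ 2)) := by
          gcongr
          linarith
      _ = _ := by field_simp; norm_num
  have hi := norm_integral_le_of_norm_le
    (((integrable_inv_one_add_mul_sq ht0).const_mul (Real.exp (x * t) * (12 * t ^ 2))))
    (.of_forall hb)
  rw [integral_const_mul, integral_inv_one_add_mul_sq ht0] at hi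
  rw [norm_smul, Real.norm_of_nonneg (by positivity)]
  calc _ ≤ (2 * Real.pi * t)⁻¹ * (Real.exp (x * t) * (12 * t ^ 2) * (Real.pi / t)) := by gcongr
    _ = 6 * Real.exp (x * t) := by field_simp; norm_num
    _ = 6 * Real.exp 1 * Real.exp (-(g * (ρ * t))) := by
      rw [mul_assoc, ← Real.exp_add, hx]
      congr 2
      field_simp
      ring

/-- To be read with `z = -δ + iη` and `G(z) = x + iy`, so that `ρx - δ` and `η + ρy` are the real
and imaginary parts of `D`. If `|Im D| ≥ |η|/4`, the quadratic term suffices. Otherwise `ρ|y| ≥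
3|η|/4`, and the sector estimate `hxy` forces `ρx`, hence `Re D`, to be bounded below. -/
theorem one_add_le_of_one_le {β δ ρ η x y C : ℝ} (hδβ : δ ≤ β / 4)
    (hδ1 : δ ≤ 1 / 2) (hβ : 0 < β) (hρ : 0 ≤ ρ) (hx : 0 ≤ x) (hxy : (β - δ) * |y| ≤ |η| * x)
    (hη : 1 ≤ |η|) (hC : 1 + 8 / β ≤ C) :
    1 + ρ * x ≤ C * (ρ * x - δ)
      + 16 * (C + 1) * ((ρ * x - δ) ^ 2 + (η + ρ * y) ^ 2) / η ^ 2 := by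
  have hβ8 : 0 < 8 / β := by positivity
  have hη2 : 0 < η ^ 2 := by rw [← sq_abs]; positivity
  have hρx : 0 ≤ ρ * x := mul_nonneg hρ hx
  rcases le_or_gt (|η| / 4) |η + ρ * y| with h | h
  · have h1 : η ^ 2 / 16 ≤ (ρ * x - δ) ^ 2 + (η + ρ * y) ^ 2 := by
      rw [← sq_abs η, ← sq_abs (η + ρ * y)]
      nlinarith [sq_nonneg (ρ * x - δ), abs_nonneg η]
    have h2 : C + 1 ≤ 16 * (C + 1) * ((ρ * x - δ) ^ 2 + (η + ρ * y) ^ 2) / η ^ 2 := by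
      rw [le_div_iff₀ hη2]
      nlinarith
    nlinarith
  · have h1 : 3 / 4 * |η| ≤ ρ * |y| := by
      have := abs_sub_abs_le_abs_sub η (-(ρ * y))
      rw [abs_neg, sub_neg_eq_add, abs_mul, abs_of_nonneg hρ] at this
      linarith
    have h2 : (β - δ) * (3 / 4 * |η|) ≤ ρ * x * |η| := by
      calc (β - δ) * (3 / 4 * |η|) ≤ (β - δ) * (ρ * |y|) := by
            have : 0 ≤ β - δ := by linarith
            gcongr
        _ = ρ * ((β - δ) * |y|) := by ring
        _ ≤ ρ * (|η| * x) := by gcongr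
        _ = _ := by ring
    have h3 : (β - δ) * (3 / 4) ≤ ρ * x := by
      have : 0 < |η| := by linarith
      nlinarith
    -- From `δ ≤ β/4`: `3(β - δ)/4 - δ ≥ 9β/16 - β/4`.
    have h4 : 5 / 16 * β ≤ ρ * x - δ := by linarith
    have h5 : 0 ≤ 16 * (C + 1) * ((ρ * x - δ) ^ 2 + (η + ρ * y) ^ 2) / η ^ 2 := by
      have : 0 ≤ C + 1 := by linarith
      positivity
    have h6 : (1 + 8 / β) * (ρ * x - δ) ≤ C * (ρ * x - δ) := by
      have : 0 ≤ ρ * x - δ := by linarith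
      gcongr
    have h7 : 8 / β * (5 / 16 * β) ≤ 8 / β * (ρ * x - δ) := by gcongr
    have h8 : 8 / β * (5 / 16 * β) = 5 / 2 := by field_simp; norm_num
    nlinarith

/-- The counterpart for `|Im z| ≤ 1`, where compactness gives `ρ Re G ≥ κ ≥ 2δ`, so that `Re D` is
at least half of `ρ Re G`. -/
theorem one_add_le_of_le_mul {δ ρ x κ C : ℝ} (hκ : 0 < κ) (hδκ : δ ≤ κ / 2)
    (hx : κ ≤ ρ * x) (hC : 2 + 2 / κ ≤ C) : 1 + ρ * x ≤ C * (ρ * x - δ) := by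
  have h1 : ρ * x / 2 ≤ ρ * x - δ := by linarith
  have h2 : (2 + 2 / κ) * (ρ * x / 2) ≤ C * (ρ * x - δ) := by
    have : 0 < 2 / κ := by positivity
    have : 0 ≤ C := by linarith
    have : 0 ≤ ρ * x / 2 := by linarith
    gcongr
  have h3 : 1 ≤ ρ * x / κ := by rwa [one_le_div hκ]
  have h4 : (2 + 2 / κ) * (ρ * x / 2) = ρ * x + ρ * x / κ := by field_simp
  linarith

/-- The difference of `1 / D` and `1 / (z + 1)`, where `D(z) = z + ρ G(z)`, has vanishing integral
along vertical lines to the right of the zeros of `D`. -/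
theorem integral_inv_resolventSymbol_sub (hG : IsPassiveSymbol G β M L) {ρ δ : ℝ} (hρ0 : 0 ≤ ρ)
    (hδ0 : 0 < δ) (hδβ : δ < β) (hδ1 : δ ≤ 1 / 2)
    (hne : ∀ z : ℂ, -δ ≤ z.re → resolventSymbol G ρ z ≠ 0) :
    Integrable (fun y : ℝ => (resolventSymbol G ρ ((-δ : ℝ) + y * Complex.I))⁻¹
        - ((-δ : ℝ) + y * Complex.I + 1)⁻¹) ∧
      ∫ y : ℝ, ((resolventSymbol G ρ ((-δ : ℝ) + y * Complex.I))⁻¹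
        - ((-δ : ℝ) + y * Complex.I + 1)⁻¹) = 0 := by
  -- The difference over a common denominator: the leading terms `1/z` cancel, which leaves
  -- quadratic decay.
  let h : ℂ → ℂ := fun z => (1 - ρ * G z) / (resolventSymbol G ρ z * (z + 1))
  have hz1 : ∀ z : ℂ, -δ ≤ z.re → z + 1 ≠ 0 := by
    intro z hz h0
    have := congrArg Complex.re h0
    simp at this
    linarith
  have hh : ∀ z : ℂ, -δ ≤ z.re → h z = (resolventSymbol G ρ z)⁻¹ - (z + 1)⁻¹ := by
    intro z hz
    have a1 := hne z hz
    have a2 := hz1 z hz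
    simp only [h]
    field_simp
    rw [resolventSymbol]
    ring
  have hhd : ∀ z : ℂ, -δ ≤ z.re → DifferentiableAt ℂ h z := by
    intro z hz
    have a3 := hG.differentiableAt (z := z) (by linarith)
    refine DifferentiableAt.div (by fun_prop) ?_ (mul_ne_zero (hne z hz) (hz1 z hz))
    unfold resolventSymbol
    fun_prop
  have hnum : ∀ z : ℂ, -δ ≤ z.re → ‖1 - ρ * G z‖ ≤ 1 + ρ * M := by
    intro z hz
    refine (norm_sub_le _ _).trans ?_
    rw [norm_one, norm_mul, Complex.norm_real, Real.norm_of_nonneg hρ0]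
    gcongr
    exact hG.norm_le z (by linarith)
  have hρM : 0 ≤ ρ * M := mul_nonneg hρ0 hG.M_nonneg
  have hhb : ∀ z : ℂ, -δ ≤ z.re → 2 * ρ * M + 1 ≤ |z.im| →
      ‖h z‖ ≤ 2 * (1 + ρ * M) / z.im ^ 2 := by
    intro z hz hy
    have a1 := hG.norm_resolventSymbol_ge hρ0 (z := z) (by linarith)
    have a2 := Complex.abs_im_le_norm z
    have a3 : |z.im| / 2 ≤ ‖resolventSymbol G ρ z‖ := by linarith
    have a4 : |z.im| ≤ ‖z + 1‖ := by simpa using Complex.abs_im_le_norm (z + 1)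
    have a5 : 0 < |z.im| := by linarith
    simp only [h, norm_div, norm_mul]
    calc _ ≤ (1 + ρ * M) / (|z.im| / 2 * |z.im|) := by
          gcongr
          exact hnum z hz
      _ = _ := by rw [← sq_abs z.im]; field_simp
  have hint0 : ∫ y : ℝ, h ((-δ : ℝ) + y * Complex.I) = 0 := by
    -- The integral does not depend on the abscissa, and on `Re z = X` it is `O(1/X)`.
    have hX : ∀ X : ℝ, 2 * ρ * M + 1 ≤ X → ‖∫ y : ℝ, h ((-δ : ℝ) + y * Complex.I)‖
        ≤ 2 * (1 + ρ * M) * Real.pi / X := by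
      intro X hX
      have hX0 : 0 < X := by linarith
      rw [integral_vertical_eq (x₂ := X) (by linarith) (fun z hz _ => hhd z hz)
        (fun z hz _ hy => hhb z hz hy)]
      have hb : ∀ y : ℝ, ‖h (X + y * Complex.I)‖
          ≤ 2 * (1 + ρ * M) / X ^ 2 * (1 + (X⁻¹ * y) ^ 2)⁻¹ := by
        intro y
        set z : ℂ := X + y * Complex.I with hz
        have e1 : z.re = X := by simp [hz]
        have e2 : z.im = y := by simp [hz]
        have a1 := hG.norm_resolventSymbol_ge hρ0 (z := z) (by linarith)
        have a2 := Complex.re_le_norm z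
        have a3 : ‖z‖ / 2 ≤ ‖resolventSymbol G ρ z‖ := by linarith
        have a4 : ‖z‖ ≤ ‖z + 1‖ := by
          rw [← sq_le_sq₀ (norm_nonneg _) (norm_nonneg _), ← Complex.normSq_eq_norm_sq,
            ← Complex.normSq_eq_norm_sq, Complex.normSq_apply, Complex.normSq_apply]
          simp [e1, e2]
          nlinarith
        have a5 : 0 < ‖z‖ := by linarith
        have a6 : ‖z‖ ^ 2 = X ^ 2 * (1 + (X⁻¹ * y) ^ 2) := by
          rw [← Complex.normSq_eq_norm_sq, Complex.normSq_apply, e1, e2]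
          field_simp
        simp only [h, norm_div, norm_mul]
        calc _ ≤ (1 + ρ * M) / (‖z‖ / 2 * ‖z‖) := by
              gcongr
              exact hnum z (by linarith)
          _ = 2 * (1 + ρ * M) / ‖z‖ ^ 2 := by field_simp
          _ = _ := by rw [a6]; field_simp
      have hi := norm_integral_le_of_norm_le
        ((integrable_inv_one_add_mul_sq (inv_pos.2 hX0)).const_mul _) (.of_forall hb)
      rw [integral_const_mul, integral_inv_one_add_mul_sq (inv_pos.2 hX0)] at hi
      refine hi.trans_eq ?_
      field_simp
    have hlim : Tendsto (fun X : ℝ => 2 * (1 + ρ * M) * Real.pi / X) atTop (𝓝 0) :=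
      tendsto_const_nhds.div_atTop tendsto_id
    refine norm_le_zero_iff.1 (ge_of_tendsto hlim ?_)
    filter_upwards [eventually_ge_atTop (2 * ρ * M + 1)] with X hX' using hX X hX'
  have hhi : Integrable fun y : ℝ => h ((-δ : ℝ) + y * Complex.I) :=
    integrable_vertical (fun z hz => (hhd z hz.ge).continuousAt)
      fun z hz hy => hhb z hz.ge hy
  have he : ∀ y : ℝ, (resolventSymbol G ρ ((-δ : ℝ) + y * Complex.I))⁻¹
        - ((-δ : ℝ) + y * Complex.I + 1)⁻¹ = h ((-δ : ℝ) + y * Complex.I) := fun y =>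
    (hh _ (by simp)).symm
  simp only [he]
  exact ⟨hhi, hint0⟩

/-- Decay of the resolvent away from the zero frequency. -/
theorem exists_norm_resolventKernel_le_high (hG : IsPassiveSymbol G β M L) {ρ₀ : ℝ}
    (hρ₀ : 0 < ρ₀) :
    ∃ δ C : ℝ, 0 < δ ∧ 0 < C ∧ ∀ ρ t : ℝ, ρ₀ ≤ ρ → 0 < t →
      ‖resolventKernel G ρ t‖ ≤ C * Real.exp (-(δ * t)) / t := by
  obtain ⟨g, hg, hgre⟩ := hG.exists_pos_le_re
  have hβ := hG.pos
  set κ : ℝ := ρ₀ * g with hκ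
  have hκ0 : 0 < κ := by positivity
  set δ : ℝ := min (min (β / 4) (1 / 2)) (κ / 2)
  have hδ0 : 0 < δ := by positivity
  have hδβ : δ ≤ β / 4 := (min_le_left _ _).trans (min_le_left _ _)
  have hδ1 : δ ≤ 1 / 2 := (min_le_left _ _).trans (min_le_right _ _)
  have hδκ : δ ≤ κ / 2 := min_le_right _ _
  set C₁ : ℝ := max (1 + 8 / β) (2 + 2 / κ) with hC₁
  have hC1 : 1 + 8 / β ≤ C₁ := le_max_left _ _
  have hC2 : 2 + 2 / κ ≤ C₁ := le_max_right _ _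
  have hC0 : 0 < C₁ := lt_of_lt_of_le (by positivity) hC1
  set C₃ : ℝ := 1 + 3 / β with hC₃
  have hC₃0 : 0 < C₃ := by positivity
  refine ⟨δ, C₃ * (4 * C₁ + 32 * (C₁ + 1)) / 2, hδ0, by positivity, fun ρ t hρ ht => ?_⟩
  have hρ0 : 0 < ρ := hρ₀.trans_le hρ
  -- After division by `|D|²` this bounds `(1 + ρ Re G) / |D|²`, and through the gradient estimate
  -- `|D'| / |D|²`, by a multiple of `Re (1/D)` plus an integrable function, with constants free of
  -- `ρ`. It also excludes zeros of `D`.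
  have key : ∀ z : ℂ, -δ ≤ z.re → z.re ≤ 0 → 1 + ρ * (G z).re ≤
      C₁ * (resolventSymbol G ρ z).re
        + 32 * (C₁ + 1) * ‖resolventSymbol G ρ z‖ ^ 2 * (1 + z.im ^ 2)⁻¹ := by
    intro z hz hz0
    rw [← Complex.normSq_eq_norm_sq, Complex.normSq_apply, resolventSymbol_re, resolventSymbol_im]
    have hre := (hG.re_pos z (by linarith)).le
    rcases le_total 1 |z.im| with h | h
    · have h1 := one_add_le_of_one_le (δ := -z.re) (η := z.im) (y := (G z).im) (C := C₁)
        (by linarith) (by linarith) hβ hρ0.le hre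
        (by simpa [add_comm] using hG.mul_abs_im_le (z := z) (by linarith)) h hC1
      refine h1.trans ?_
      rw [sub_neg_eq_add, add_comm (ρ * _) z.re]
      gcongr _ + ?_
      have h2 : 1 ≤ z.im ^ 2 := by rw [← sq_abs]; nlinarith
      rw [← div_eq_mul_inv, div_le_div_iff₀ (by positivity) (by positivity)]
      have h3 : 0 ≤ (C₁ + 1) * ((z.re + ρ * (G z).re) ^ 2 + (z.im + ρ * (G z).im) ^ 2) := by
        positivity
      nlinarith
    · have h1 := one_add_le_of_le_mul (δ := -z.re) (ρ := ρ) (x := (G z).re) hκ0 (by linarith)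
        (by
          have := hgre z (by linarith) (by linarith) h
          rw [hκ]; gcongr) hC2
      have h3 : 0 ≤ 32 * (C₁ + 1) * ((z.re + ρ * (G z).re) * (z.re + ρ * (G z).re)
          + (z.im + ρ * (G z).im) * (z.im + ρ * (G z).im)) * (1 + z.im ^ 2)⁻¹ := by
        have a1 := mul_self_nonneg (z.re + ρ * (G z).re)
        have a2 := mul_self_nonneg (z.im + ρ * (G z).im)
        positivity
      rw [sub_neg_eq_add, add_comm (ρ * _) z.re] at h1
      linarith
  have hne : ∀ z : ℂ, -δ ≤ z.re → resolventSymbol G ρ z ≠ 0 := by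
    intro z hz h0
    rcases lt_or_ge 0 z.re with h | h
    · exact hG.resolventSymbol_ne_zero hρ0.le h h0
    · have := key z hz h
      rw [h0] at this
      simp at this
      linarith [mul_nonneg hρ0.le (hG.re_pos z (by linarith)).le]
  let h : ℂ → ℂ := fun z => (resolventSymbol G ρ z)⁻¹ - (z + 1)⁻¹
  obtain ⟨hhi, hint0⟩ : Integrable (fun y : ℝ => h ((-δ : ℝ) + y * Complex.I)) ∧
      ∫ y : ℝ, h ((-δ : ℝ) + y * Complex.I) = 0 :=
    hG.integral_inv_resolventSymbol_sub hρ0.le hδ0 (by linarith) hδ1 hne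
  -- The only term depending on `ρ` integrates to zero, which makes the final bound uniform in `ρ`.
  have hre0 : ∫ y : ℝ, (h ((-δ : ℝ) + y * Complex.I)).re = 0 := by
    have := integral_re hhi
    simp only [RCLike.re_to_complex] at this
    rw [this, hint0, Complex.zero_re]
  rw [hG.resolventKernel_eq hρ0.le ht.le (x := -δ) (by linarith) hne]
  have hb : ∀ y : ℝ, ‖resolventIntegrand G ρ t ((-δ : ℝ) + y * Complex.I)‖
      ≤ Real.exp (-δ * t) * C₃ * (C₁ * (h ((-δ : ℝ) + y * Complex.I)).re
        + (4 * C₁ + 32 * (C₁ + 1)) * (1 + y ^ 2)⁻¹) := by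
    intro y
    set z : ℂ := (-δ : ℝ) + y * Complex.I with hz
    have e1 : z.re = -δ := by simp [hz]
    have e2 : z.im = y := by simp [hz]
    have k := key z e1.ge (by linarith)
    have hx := (hG.re_pos z (by linarith)).le
    have hD : 0 < ‖resolventSymbol G ρ z‖ := norm_pos_iff.2 (hne z e1.ge)
    -- The distance from `z` to the boundary is at least `3β/4`, so the gradient estimate gives
    -- `|G'| ≤ (3/β) Re G`. A bound by the constant `L` would grow with `ρ`.
    have hd : ‖1 + ρ * deriv G z‖ ≤ C₃ * (1 + ρ * (G z).re) := by
      have a1 := hG.norm_deriv_mul_le (z := z) (by linarith)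
      have a2 : ‖deriv G z‖ ≤ 3 / β * (G z).re := by
        rw [div_mul_eq_mul_div, le_div_iff₀ hβ]
        have : ‖deriv G z‖ * (3 / 4 * β) ≤ ‖deriv G z‖ * (z.re + β) := by gcongr; linarith
        linarith
      refine (norm_add_le _ _).trans ?_
      rw [norm_one, norm_mul, Complex.norm_real, Real.norm_of_nonneg hρ0.le]
      have a3 : ρ * ‖deriv G z‖ ≤ ρ * (3 / β * (G z).re) := by gcongr
      have a4 : 0 < 3 / β := by positivity
      rw [hC₃]
      nlinarith [mul_nonneg hρ0.le hx]
    have hinv : (h z).re + 4 * (1 + y ^ 2)⁻¹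
        ≥ (resolventSymbol G ρ z).re / ‖resolventSymbol G ρ z‖ ^ 2 := by
      simp only [h]
      rw [Complex.sub_re, Complex.inv_re, Complex.inv_re, Complex.normSq_eq_norm_sq,
        Complex.normSq_apply]
      have a1 : (z + 1).re = 1 - δ := by simp [e1]; ring
      have a2 : (z + 1).im = y := by simp [e2]
      rw [a1, a2]
      have : (1 - δ) / ((1 - δ) * (1 - δ) + y * y) ≤ 4 * (1 + y ^ 2)⁻¹ := by
        rw [← div_eq_mul_inv, div_le_div_iff₀ (by nlinarith) (by positivity)]
        nlinarith [sq_nonneg y]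
      linarith
    rw [norm_resolventIntegrand, e1, mul_assoc]
    gcongr
    calc _ ≤ C₃ * (1 + ρ * (G z).re) / ‖resolventSymbol G ρ z‖ ^ 2 := by gcongr
      _ ≤ C₃ * (C₁ * (resolventSymbol G ρ z).re
          + 32 * (C₁ + 1) * ‖resolventSymbol G ρ z‖ ^ 2 * (1 + z.im ^ 2)⁻¹)
            / ‖resolventSymbol G ρ z‖ ^ 2 := by gcongr
      _ = C₃ * (C₁ * ((resolventSymbol G ρ z).re / ‖resolventSymbol G ρ z‖ ^ 2)
          + 32 * (C₁ + 1) * (1 + y ^ 2)⁻¹) := by rw [e2]; field_simp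
      _ ≤ C₃ * (C₁ * ((h z).re + 4 * (1 + y ^ 2)⁻¹) + 32 * (C₁ + 1) * (1 + y ^ 2)⁻¹) := by
          gcongr
      _ = _ := by ring
  have hhre : Integrable fun y : ℝ => (h ((-δ : ℝ) + y * Complex.I)).re := hhi.re
  have hi := norm_integral_le_of_norm_le ((((hhre.const_mul C₁).add
    (integrable_inv_one_add_sq.const_mul (4 * C₁ + 32 * (C₁ + 1)))).const_mul
      (Real.exp (-δ * t) * C₃))) (.of_forall hb)
  rw [integral_const_mul] at hi
  simp only [Pi.add_apply] at hi
  rw [integral_add (hhre.const_mul C₁) (integrable_inv_one_add_sq.const_mul _),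
    integral_const_mul, integral_const_mul, hre0, integral_univ_inv_one_add_sq, mul_zero,
    zero_add] at hi
  rw [norm_smul, Real.norm_of_nonneg (by positivity)]
  calc _ ≤ (2 * Real.pi * t)⁻¹ * (Real.exp (-δ * t) * C₃
        * ((4 * C₁ + 32 * (C₁ + 1)) * Real.pi)) := by gcongr
    _ = _ := by rw [neg_mul]; field_simp

end IsPassiveSymbol

/-! ### The diffusive limit of the scalar resolvent. -/

theorem complexLaplace_exp_neg {q : ℝ} (hq : 0 ≤ q) {z : ℂ} (hz : 0 < z.re) :
    complexLaplace (fun t => Complex.exp (-(q * t))) z = (z + q)⁻¹ := by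
  have h := complexLaplace_const 1 (z := z + q) (by simp; linarith)
  rw [one_div] at h
  rw [← h, complexLaplace, complexLaplace]
  refine integral_congr_ae (.of_forall fun t => ?_)
  simp only [mul_one, ← Complex.exp_add]
  ring_nf

theorem complexLaplace_mul_exp_neg {q : ℝ} (hq : 0 ≤ q) {z : ℂ} (hz : 0 < z.re) :
    complexLaplace (fun t => t * Complex.exp (-(q * t))) z = ((z + q) ^ 2)⁻¹ := by
  have hd := hasDerivAt_complexLaplace (f := fun t => Complex.exp (-(q * t))) (C := 1) (K := 0)
    (z := z) (Continuous.aestronglyMeasurable (by fun_prop)) (fun t ht => by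
      rw [norm_exp_neg_mul_ofReal]
      simp
      positivity) hz
  have hz0 : z + q ≠ 0 := by
    intro h
    have := congrArg Complex.re h
    simp at this
    linarith
  have he : HasDerivAt (fun w : ℂ => (w + q)⁻¹) (-1 / (z + q) ^ 2) z :=
    ((hasDerivAt_id z).add_const (q : ℂ)).inv hz0
  have heq : complexLaplace (fun t => Complex.exp (-(q * t))) =ᶠ[𝓝 z] fun w => (w + q)⁻¹ := by
    filter_upwards [(isOpen_lt continuous_const Complex.continuous_re).mem_nhds hz] with w hw
    exact complexLaplace_exp_neg hq hw
  have := hd.unique (he.congr_of_eventuallyEq heq)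
  rw [neg_eq_iff_eq_neg] at this
  rw [this]
  ring

theorem integrable_inv_add_sq {σ q : ℝ} (hσ : 0 < σ) (hq : 0 ≤ q) :
    Integrable fun y : ℝ => (((σ : ℂ) + y * Complex.I + q) ^ 2)⁻¹ := by
  refine integrable_vertical (h := fun z => ((z + q) ^ 2)⁻¹) (x := σ) (C := 1) (Y := 1)
    (fun z hz => ?_) fun z hz hy => ?_
  · refine ContinuousAt.inv₀ (by fun_prop) (pow_ne_zero 2 fun h => ?_)
    have := congrArg Complex.re h
    simp at this
    linarith
  · have h1 : |z.im| ≤ ‖z + q‖ := by simpa using Complex.abs_im_le_norm (z + q)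
    rw [norm_inv, norm_pow, ← sq_abs z.im, one_div]
    gcongr

/-- The inverse Laplace transform of `(z + q)⁻²`. -/
theorem mul_exp_neg_eq_integral {σ q t : ℝ} (hσ : 0 < σ) (hq : 0 ≤ q) (ht : 0 ≤ t) :
    (t : ℂ) * Complex.exp (-(q * t)) = (2 * Real.pi : ℝ)⁻¹ • ∫ y : ℝ,
      Complex.exp ((σ + y * Complex.I) * t) * ((σ + y * Complex.I + q) ^ 2)⁻¹ := by
  let f : ℝ → ℂ := fun t => ((max t 0 : ℝ) : ℂ) * Complex.exp (-(q * t))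
  have hfe : ∀ t, 0 ≤ t → f t = (t : ℂ) * Complex.exp (-(q * t)) := fun t ht => by
    simp [f, max_eq_left ht]
  have hl : ∀ z : ℂ, 0 < z.re → complexLaplace f z = ((z + q) ^ 2)⁻¹ := by
    intro z hz
    rw [← complexLaplace_mul_exp_neg hq hz, complexLaplace, complexLaplace]
    refine setIntegral_congr_fun measurableSet_Ioi fun t ht => ?_
    simp only [hfe t (le_of_lt ht)]
  have hfc : Continuous f := by fun_prop
  have := eq_integral_complexLaplace (f := f) (σ := σ) hfc
    (fun t ht => by simp [f, max_eq_right ht])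
    (.of_exp_bound (C := 2 / σ) (K := σ / 2) (by fun_prop) (fun t ht => by
      rw [hfe t ht.le, norm_mul, norm_exp_neg_mul_ofReal, Complex.norm_real,
        Real.norm_of_nonneg ht.le]
      have h1 : Real.exp (-((q : ℂ).re * t)) ≤ 1 := by
        rw [Real.exp_le_one_iff]
        simp
        positivity
      have h2 := Real.add_one_le_exp (σ / 2 * t)
      calc t * Real.exp (-((q : ℂ).re * t)) ≤ t * 1 := by gcongr
        _ = 2 / σ * (σ / 2 * t) := by field_simp
        _ ≤ 2 / σ * Real.exp (σ / 2 * t) := by gcongr; linarith) (by simp; linarith))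
    (by
      refine (integrable_inv_add_sq hσ hq).congr (.of_forall fun y => ?_)
      simp only
      rw [hl _ (by simpa using hσ)]) t
  rw [hfe t ht] at this
  rw [this]
  congr 1
  refine integral_congr_ae (.of_forall fun y => ?_)
  simp only
  rw [hl _ (by simpa using hσ)]

namespace IsPassiveSymbol

variable {G : ℂ → ℂ} {β M L : ℝ}

theorem apply_zero (hG : IsPassiveSymbol G β M L) : G 0 = ((G 0).re : ℂ) := by
  have := hG.conj_symm 0 (by simpa using hG.pos)
  rw [map_zero] at this
  exact (Complex.conj_eq_iff_re.1 this.symm).symm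

/-- The line `Re z = 1/τ` is parametrised by `z = (1 + iy)/τ`, and the powers of `τ` outside cancel.
As `τ → ∞` the argument of `G` tends to `0` while `ρτ` can stay bounded. -/
theorem resolventKernel_eq_scaled (hG : IsPassiveSymbol G β M L) {ρ τ : ℝ} (hρ : 0 ≤ ρ)
    (hτ : 0 < τ) : resolventKernel G ρ τ = (2 * Real.pi : ℝ)⁻¹ • ∫ y : ℝ,
      Complex.exp (1 + y * Complex.I) * ((1 + ρ * deriv G ((1 + y * Complex.I) / τ))
        / ((1 + y * Complex.I) + ((ρ * τ : ℝ) : ℂ) * G ((1 + y * Complex.I) / τ)) ^ 2) := by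
  have hτi : 0 < τ⁻¹ := inv_pos.2 hτ
  have hτc : (τ : ℂ) ≠ 0 := by exact_mod_cast hτ.ne'
  rw [hG.resolventKernel_eq hρ hτ.le (x := τ⁻¹) (by linarith [hG.pos]) fun z hz =>
    hG.resolventSymbol_ne_zero hρ (by linarith)]
  set Φ : ℝ → ℂ := fun y =>
      Complex.exp (1 + y * Complex.I) * ((1 + ρ * deriv G ((1 + y * Complex.I) / τ))
        / ((1 + y * Complex.I) + ((ρ * τ : ℝ) : ℂ) * G ((1 + y * Complex.I) / τ)) ^ 2) with hΦ
  have h1 := Measure.integral_comp_mul_left Φ τ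
  rw [abs_of_pos hτi] at h1
  have h2 : ∀ y : ℝ, resolventIntegrand G ρ τ ((τ⁻¹ : ℝ) + y * Complex.I)
      = (τ : ℂ) ^ 2 * Φ (τ * y) := by
    intro y
    have e : (1 : ℂ) + ((τ * y : ℝ) : ℂ) * Complex.I
        = (((τ⁻¹ : ℝ) : ℂ) + y * Complex.I) * τ := by
      push_cast
      field_simp
    simp only [hΦ, resolventIntegrand, resolventSymbol]
    rw [e, mul_div_cancel_right₀ _ hτc, show ∀ z w : ℂ, z * τ + ((ρ * τ : ℝ) : ℂ) * w
      = τ * (z + ρ * w) from fun z w => by push_cast; ring, mul_pow]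
    field_simp
  simp only [h2]
  rw [integral_const_mul, h1]
  simp only [Complex.real_smul]
  push_cast
  field_simp

theorem norm_div_sq_sub_inv_sq_le {n u v : ℂ} (hu : 1 ≤ ‖u‖) (hv : 1 ≤ ‖v‖) :
    ‖(1 + n) / u ^ 2 - (v ^ 2)⁻¹‖ ≤ ‖n‖ + 2 * ‖u - v‖ := by
  have hu0 : u ≠ 0 := norm_pos_iff.1 (by linarith)
  have hv0 : v ≠ 0 := norm_pos_iff.1 (by linarith)
  have e : (1 + n) / u ^ 2 - (v ^ 2)⁻¹
      = n / u ^ 2 - (u - v) * ((u ^ 2 * v)⁻¹ + (u * v ^ 2)⁻¹) := by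
    field_simp
    ring
  have h1 : ‖n / u ^ 2‖ ≤ ‖n‖ := by
    rw [norm_div, norm_pow]
    exact div_le_self (norm_nonneg _) (one_le_pow₀ hu)
  have h2 : ‖(u ^ 2 * v)⁻¹‖ ≤ 1 := by
    rw [norm_inv, norm_mul, norm_pow]
    exact inv_le_one_of_one_le₀ (one_le_mul_of_one_le_of_one_le (one_le_pow₀ hu) hv)
  have h3 : ‖(u * v ^ 2)⁻¹‖ ≤ 1 := by
    rw [norm_inv, norm_mul, norm_pow]
    exact inv_le_one_of_one_le₀ (one_le_mul_of_one_le_of_one_le hu (one_le_pow₀ hv))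
  rw [e]
  refine (norm_sub_le _ _).trans ?_
  rw [norm_mul, mul_comm 2]
  gcongr
  exact (norm_add_le _ _).trans (by linarith)

/-- The diffusive limit of the scalar resolvent. -/
theorem tendsto_resolventKernel_sub {ι : Type*} {l : Filter ι} [l.IsCountablyGenerated]
    (hG : IsPassiveSymbol G β M L) {ρ τ q : ι → ℝ} {Q : ℝ} (hρ : ∀ᶠ i in l, 0 ≤ ρ i)
    (hτ : Tendsto τ l atTop) (hq0 : ∀ᶠ i in l, 0 ≤ q i) (hq : ∀ᶠ i in l, q i ≤ Q)
    (hlim : Tendsto (fun i => ρ i * τ i * (G 0).re - q i) l (𝓝 0)) :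
    Tendsto (fun i => resolventKernel G (ρ i) (τ i) - Complex.exp (-(q i : ℂ))) l (𝓝 0) := by
  have hβ := hG.pos
  have hg : 0 < (G 0).re := hG.re_pos 0 (by simpa using hβ)
  have hM := hG.M_nonneg
  have hL := hG.L_nonneg
  -- An eventual bound for `ρτ`, since `ρ τ G(0) ≤ q + 1 ≤ Q + 1` near the limit.
  set P : ℝ := max ((Q + 1) / (G 0).re) 0 with hP
  have hP0 : 0 ≤ P := le_max_right _ _
  have hρτ : ∀ᶠ i in l, ρ i * τ i ≤ P := by
    filter_upwards [hq, hlim.eventually (gt_mem_nhds one_pos)] with i h1 h2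
    refine le_trans ?_ (le_max_left _ _)
    rw [le_div_iff₀ hg]
    linarith
  have hτ1 : ∀ᶠ i in l, 1 ≤ τ i := hτ.eventually_ge_atTop 1
  have hρle : ∀ᶠ i in l, ρ i ≤ P / τ i := by
    filter_upwards [hρτ, hτ1] with i h1 h2
    rwa [le_div_iff₀ (by linarith)]
  have hdivτ : ∀ c : ℂ, Tendsto (fun i => c / (τ i : ℂ)) l (𝓝 0) := by
    intro c
    rw [tendsto_zero_iff_norm_tendsto_zero]
    simp only [norm_div, Complex.norm_real, Real.norm_eq_abs]
    exact tendsto_const_nhds.div_atTop (tendsto_abs_atTop_atTop.comp hτ)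
  have hρ0 : Tendsto ρ l (𝓝 0) :=
    squeeze_zero' hρ hρle (tendsto_const_nhds.div_atTop hτ)
  let u : ι → ℝ → ℂ := fun i y =>
    (1 + y * Complex.I) + ((ρ i * τ i : ℝ) : ℂ) * G ((1 + y * Complex.I) / τ i)
  let v : ι → ℝ → ℂ := fun i y => (1 : ℝ) + y * Complex.I + q i
  let N : ι → ℝ → ℂ := fun i y => ρ i * deriv G ((1 + y * Complex.I) / τ i)
  let Ψ : ι → ℝ → ℂ := fun i y =>
    Complex.exp (1 + y * Complex.I) * ((1 + N i y) / u i y ^ 2 - (v i y ^ 2)⁻¹)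
  have hexp : ∀ y : ℝ, ‖Complex.exp (1 + y * Complex.I)‖ = Real.exp 1 := by
    intro y; rw [Complex.norm_exp]; simp
  have hre : ∀ i, 1 ≤ τ i → ∀ y : ℝ, -β < ((1 + y * Complex.I) / (τ i : ℂ)).re := by
    intro i h1 y
    rw [Complex.div_ofReal_re]
    simp
    have : 0 < (τ i)⁻¹ := by positivity
    linarith
  have hu1 : ∀ i, 1 ≤ τ i → 0 ≤ ρ i → ∀ y, 1 ≤ ‖u i y‖ := by
    intro i h1 h2 y
    refine le_trans ?_ ((le_abs_self _).trans (Complex.abs_re_le_norm _))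
    have := mul_nonneg (mul_nonneg h2 (by linarith : 0 ≤ τ i)) (hG.re_pos _ (hre i h1 y)).le
    simp only [u, Complex.add_re, Complex.re_ofReal_mul]
    simp
    simpa using this
  have hvn : ∀ i, 0 ≤ q i → ∀ y, 1 + y ^ 2 ≤ ‖v i y‖ ^ 2 := by
    intro i h1 y
    rw [← Complex.normSq_eq_norm_sq, Complex.normSq_apply]
    simp [v]
    nlinarith
  have hv1 : ∀ i, 0 ≤ q i → ∀ y, 1 ≤ ‖v i y‖ := by
    intro i h1 y
    have := hvn i h1 y
    nlinarith [sq_nonneg y, norm_nonneg (v i y)]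
  -- Combines `|u| ≥ 1`, from positivity of `Re G`, with `|u| ≥ |y| - PM`. This yields a majorant
  -- independent of `i`.
  have hun : ∀ i, 1 ≤ τ i → 0 ≤ ρ i → ρ i * τ i ≤ P → ∀ y,
      1 + y ^ 2 ≤ (1 + (1 + P * M) ^ 2) * ‖u i y‖ ^ 2 := by
    intro i h1 h2 h3 y
    have a1 := hu1 i h1 h2 y
    have a2 : |y| ≤ ‖u i y‖ + P * M := by
      have b1 : ‖((ρ i * τ i : ℝ) : ℂ) * G ((1 + y * Complex.I) / τ i)‖ ≤ P * M := by
        rw [norm_mul, Complex.norm_real,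
          Real.norm_of_nonneg (mul_nonneg h2 (by linarith))]
        exact mul_le_mul h3 (hG.norm_le _ (hre i h1 y)) (norm_nonneg _) hP0
      have b2 : |y| ≤ ‖1 + y * Complex.I‖ := by
        simpa using Complex.abs_im_le_norm (1 + y * Complex.I)
      have b3 := norm_sub_le (u i y) (((ρ i * τ i : ℝ) : ℂ) * G ((1 + y * Complex.I) / τ i))
      simp only [u, add_sub_cancel_right] at b3
      simp only [u]
      linarith
    have a3 : |y| ≤ (1 + P * M) * ‖u i y‖ := by nlinarith [mul_nonneg hP0 hM]
    have a4 : |y| ^ 2 ≤ ((1 + P * M) * ‖u i y‖) ^ 2 := by gcongr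
    rw [sq_abs, mul_pow] at a4
    nlinarith
  have hNle : ∀ i, 1 ≤ τ i → 0 ≤ ρ i → ∀ y, ‖N i y‖ ≤ ρ i * L := by
    intro i h1 h2 y
    simp only [N, norm_mul, Complex.norm_real, Real.norm_of_nonneg h2]
    gcongr
    exact hG.norm_deriv_le _ (hre i h1 y)
  have hcG : ∀ i, 1 ≤ τ i → Continuous fun y : ℝ => G ((1 + y * Complex.I) / τ i) := by
    intro i h1
    rw [continuous_iff_continuousAt]
    intro y
    exact ContinuousAt.comp (f := fun y : ℝ => (1 + y * Complex.I) / (τ i : ℂ))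
      (hG.differentiableAt (hre i h1 y)).continuousAt (by fun_prop)
  have hcG' : ∀ i, 1 ≤ τ i → Continuous fun y : ℝ => deriv G ((1 + y * Complex.I) / τ i) := by
    intro i h1
    rw [continuous_iff_continuousAt]
    intro y
    exact ContinuousAt.comp (f := fun y : ℝ => (1 + y * Complex.I) / (τ i : ℂ))
      (hG.differentiableAt_deriv (hre i h1 y)).continuousAt (by fun_prop)
  have hc1 : ∀ i, 1 ≤ τ i → 0 ≤ ρ i → Continuous fun y => (1 + N i y) / u i y ^ 2 := by
    intro i h1 h2
    have b1 := hcG i h1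
    have b2 := hcG' i h1
    have b3 : Continuous (u i) :=
      Continuous.add (by fun_prop) (continuous_const.mul b1)
    refine Continuous.div (continuous_const.add (continuous_const.mul b2)) (b3.pow 2)
      fun y => pow_ne_zero 2 ?_
    exact norm_pos_iff.1 (by linarith [hu1 i h1 h2 y])
  have hc2 : ∀ i, 0 ≤ q i → Continuous fun y => (v i y ^ 2)⁻¹ := by
    intro i h1
    refine Continuous.inv₀ (by fun_prop) fun y => pow_ne_zero 2 ?_
    exact norm_pos_iff.1 (by linarith [hv1 i h1 y])
  set C : ℝ := (1 + P * L) * (1 + (1 + P * M) ^ 2) with hC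
  have hb1 : ∀ i, 1 ≤ τ i → 0 ≤ ρ i → ρ i * τ i ≤ P → ∀ y,
      ‖(1 + N i y) / u i y ^ 2‖ ≤ C * (1 + y ^ 2)⁻¹ := by
    intro i h1 h2 h3 y
    have a1 := hun i h1 h2 h3 y
    have a2 := hNle i h1 h2 y
    have a3 : ρ i ≤ P := by nlinarith
    have a4 : ‖1 + N i y‖ ≤ 1 + P * L := by
      refine (norm_add_le _ _).trans ?_
      rw [norm_one]
      have : ρ i * L ≤ P * L := by gcongr
      linarith
    have a5 := hu1 i h1 h2 y
    rw [norm_div, norm_pow, ← div_eq_mul_inv, div_le_div_iff₀ (by positivity) (by positivity), hC]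
    calc ‖1 + N i y‖ * (1 + y ^ 2) ≤ (1 + P * L) * ((1 + (1 + P * M) ^ 2) * ‖u i y‖ ^ 2) := by
          gcongr
      _ = _ := by ring
  have hb2 : ∀ i, 0 ≤ q i → ∀ y, ‖(v i y ^ 2)⁻¹‖ ≤ (1 + y ^ 2)⁻¹ := by
    intro i h1 y
    rw [norm_inv, norm_pow]
    exact inv_anti₀ (by positivity) (hvn i h1 y)
  have hI : Integrable fun y : ℝ => Real.exp 1 * ((C + 1) * (1 + y ^ 2)⁻¹) :=
    (integrable_inv_one_add_sq.const_mul _).const_mul _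
  have hmain : ∀ᶠ i in l, resolventKernel G (ρ i) (τ i) - Complex.exp (-(q i : ℂ))
      = (2 * Real.pi : ℝ)⁻¹ • ∫ y, Ψ i y := by
    filter_upwards [hρ, hτ1, hq0, hρτ] with i h1 h2 h3 h4
    -- At `t = σ = 1` the inverse transform of `(z + q)⁻²` writes `e^{-q}` as an integral over the
    -- same line as the rescaled resolvent.
    have e := mul_exp_neg_eq_integral one_pos h3 zero_le_one
    simp only [Complex.ofReal_one, mul_one, one_mul] at e
    rw [hG.resolventKernel_eq_scaled h1 (by linarith), e, ← smul_sub, ← integral_sub]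
    · congr 1
      refine integral_congr_ae (.of_forall fun y => ?_)
      simp only [Ψ, u, v, N, Complex.ofReal_one]
      ring
    · refine Integrable.mono' (hI) (Continuous.aestronglyMeasurable ?_) (.of_forall fun y => ?_)
      · exact Continuous.mul (by fun_prop) (hc1 i h2 h1)
      · rw [norm_mul, hexp]
        refine mul_le_mul_of_nonneg_left ((hb1 i h2 h1 h4 y).trans ?_) (Real.exp_pos 1).le
        have : 0 ≤ (1 + y ^ 2)⁻¹ := by positivity
        nlinarith
    · refine Integrable.mono' (integrable_inv_one_add_sq.const_mul (Real.exp 1))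
        (Continuous.aestronglyMeasurable ?_) (.of_forall fun y => ?_)
      · have := hc2 i h3
        simp only [v, Complex.ofReal_one] at this
        fun_prop
      · have := hb2 i h3 y
        simp only [v, Complex.ofReal_one] at this
        rw [norm_mul, hexp]
        gcongr
  rw [tendsto_congr' hmain]
  have hto : Tendsto (fun i => ∫ y, Ψ i y) l (𝓝 (∫ _ : ℝ, (0 : ℂ))) := by
    refine tendsto_integral_filter_of_dominated_convergence
      (fun y : ℝ => Real.exp 1 * ((C + 1) * (1 + y ^ 2)⁻¹)) ?_ ?_ hI (.of_forall fun y => ?_)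
    · filter_upwards [hρ, hτ1, hq0] with i h1 h2 h3
      have b1 := hc1 i h2 h1
      have b2 := hc2 i h3
      exact Continuous.aestronglyMeasurable (by fun_prop)
    · filter_upwards [hρ, hτ1, hq0, hρτ] with i h1 h2 h3 h4
      refine .of_forall fun y => ?_
      simp only [Ψ, norm_mul, hexp]
      gcongr
      refine (norm_sub_le _ _).trans ?_
      rw [add_mul, one_mul]
      exact add_le_add (hb1 i h2 h1 h4 y) (hb2 i h3 y)
    · have hGl : Tendsto (fun i => ‖G ((1 + y * Complex.I) / τ i) - G 0‖) l (𝓝 0) := by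
        have := ((hG.differentiableAt (z := 0) (by simpa using hβ)).continuousAt.tendsto.comp
          (hdivτ (1 + y * Complex.I)))
        rw [← tendsto_sub_nhds_zero_iff] at this
        exact tendsto_zero_iff_norm_tendsto_zero.1 this
      have hbd : Tendsto (fun i => Real.exp 1 * (ρ i * L + 2 *
          (P * ‖G ((1 + y * Complex.I) / τ i) - G 0‖ + |ρ i * τ i * (G 0).re - q i|)))
          l (𝓝 0) := by
        have := ((hρ0.mul_const L).add (((hGl.const_mul P).add
          (hlim.abs)).const_mul 2)).const_mul (Real.exp 1)
        simpa using this
      refine squeeze_zero_norm' ?_ hbd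
      filter_upwards [hρ, hτ1, hq0, hρτ] with i h1 h2 h3 h4
      simp only [Ψ, norm_mul, hexp]
      gcongr
      refine (norm_div_sq_sub_inv_sq_le (hu1 i h2 h1 y) (hv1 i h3 y)).trans ?_
      gcongr
      · exact hNle i h2 h1 y
      · have e : u i y - v i y = ((ρ i * τ i : ℝ) : ℂ) * (G ((1 + y * Complex.I) / τ i) - G 0)
            + ((ρ i * τ i * (G 0).re - q i : ℝ) : ℂ) := by
          simp only [u, v]
          push_cast
          rw [← hG.apply_zero]
          ring
        rw [e]
        refine (norm_add_le _ _).trans ?_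
        rw [norm_mul, Complex.norm_real, Complex.norm_real, Real.norm_eq_abs, Real.norm_eq_abs,
          abs_of_nonneg (mul_nonneg h1 (by linarith))]
        gcongr
  have := hto.const_smul (2 * Real.pi : ℝ)⁻¹
  simpa using this

end IsPassiveSymbol

/-! ### Passivity of the symbol `a₀ + ã`. -/

/-- The Riemann–Lebesgue lemma for the Laplace transform. -/
theorem tendsto_complexLaplace_cocompact {f : ℝ → ℂ} {σ : ℝ} :
    Tendsto (fun y : ℝ => complexLaplace f (σ + y * Complex.I)) (cocompact ℝ) (𝓝 0) := by
  have h := Real.tendsto_integral_exp_smul_cocompact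
    (fun t => (Ioi (0 : ℝ)).indicator (fun t => Complex.exp (-(σ * (t : ℂ))) * f t) t)
  have h2 : Tendsto (fun y : ℝ => y * (2 * Real.pi)⁻¹) (cocompact ℝ) (cocompact ℝ) :=
    (Homeomorph.mulRight₀ (2 * Real.pi)⁻¹ (by positivity)).isClosedEmbedding.tendsto_cocompact
  refine (h.comp h2).congr fun y => ?_
  simp only [Function.comp]
  rw [complexLaplace, ← integral_indicator measurableSet_Ioi]
  refine integral_congr_ae (.of_forall fun t => ?_)
  by_cases ht : t ∈ Ioi (0 : ℝ)
  · simp only [indicator_of_mem ht, Circle.smul_def, Real.fourierChar_apply, smul_eq_mul,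
      ← mul_assoc, ← Complex.exp_add]
    congr 2
    push_cast
    have : (Real.pi : ℂ) ≠ 0 := by exact_mod_cast Real.pi_ne_zero
    field_simp
    ring
  · simp [indicator_of_notMem ht]

section Symbol

variable {a : ℝ → ℝ} {a₀ α : ℝ} {F : ℂ → ℂ}

theorem IsLaplaceExtension.tendsto_cocompact (hF : IsLaplaceExtension a α F) :
    Tendsto (fun y : ℝ => F (1 + y * Complex.I)) (cocompact ℝ) (𝓝 0) := by
  have := tendsto_complexLaplace_cocompact (f := fun t => (a t : ℂ)) (σ := 1)
  refine this.congr fun y => ?_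
  rw [← laplaceTransform_eq_complexLaplace, ← hF.eq_laplaceTransform _ (by simp)]
  simp

theorem laplaceTransform_conj (a : ℝ → ℝ) (z : ℂ) :
    laplaceTransform a (starRingEnd ℂ z) = starRingEnd ℂ (laplaceTransform a z) := by
  rw [laplaceTransform, laplaceTransform, ← integral_conj]
  refine integral_congr_ae (.of_forall fun t => ?_)
  simp [← Complex.exp_conj]

theorem isPreconnected_re_gt (r : ℝ) : IsPreconnected {z : ℂ | r < z.re} :=
  (convex_halfSpace_re_gt r).isPreconnected

theorem isOpen_re_gt (r : ℝ) : IsOpen {z : ℂ | r < z.re} :=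
  isOpen_lt continuous_const Complex.continuous_re

/-- The kernel is real, so the symmetry holds for the Laplace integral; the identity theorem carries
it to the extension. -/
theorem IsLaplaceExtension.conj_symm (hF : IsLaplaceExtension a α F) (hα : 0 < α) {z : ℂ}
    (hz : -α < z.re) : F (starRingEnd ℂ z) = starRingEnd ℂ (F z) := by
  have h1 : AnalyticOnNhd ℂ F {z | -α < z.re} :=
    hF.differentiableOn.analyticOnNhd (isOpen_re_gt _)
  have h2 : DifferentiableOn ℂ (fun z => starRingEnd ℂ (F (starRingEnd ℂ z))) {z | -α < z.re} := by
    intro z hz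
    have hz' : -α < (starRingEnd ℂ z).re := by simpa using (show -α < z.re from hz)
    have := (hF.differentiableOn.differentiableAt ((isOpen_re_gt _).mem_nhds hz')).conj_conj
    rw [Complex.conj_conj] at this
    exact this.differentiableWithinAt
  have h3 := h1.eqOn_of_preconnected_of_eventuallyEq (h2.analyticOnNhd (isOpen_re_gt _))
    (isPreconnected_re_gt _) (z₀ := 1) (show -α < (1 : ℂ).re by simp; linarith) (by
      filter_upwards [(isOpen_re_gt 0).mem_nhds (show (0 : ℝ) < (1 : ℂ).re by simp)] with w hw
      have hw' : 0 < w.re := hw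
      rw [hF.eq_laplaceTransform w hw, hF.eq_laplaceTransform _ (by simpa using hw'),
        laplaceTransform_conj, Complex.conj_conj])
  have := h3 hz
  simp only at this
  rw [this, Complex.conj_conj]

/-- Positivity of the symbol on a slightly larger half plane than the right one. -/
theorem IsLaplaceExtension.exists_re_nonneg (hF : IsLaplaceExtension a α F) (hα : 0 < α)
    (ha₀ : 0 ≤ a₀) (hpos : (0 < a₀ ∧ ∀ η : ℝ, 0 < a₀ + (F (Complex.I * (η : ℂ))).re) ∨
      ∀ η : ℝ, 0 ≤ (F (-(α : ℂ) + Complex.I * (η : ℂ))).re) :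
    ∃ γ : ℝ, 0 < γ ∧ γ ≤ α ∧ ∀ z : ℂ, -γ ≤ z.re → 0 ≤ a₀ + (F z).re := by
  obtain ⟨M, hM⟩ := hF.bounded
  rcases hpos with ⟨h0, hpos⟩ | hpos
  -- High in the strip `|F| ≤ a₀/2`, so only a bounded piece of the line `Re z = -γ` remains. There
  -- uniform continuity on a compact box transfers positivity from the imaginary axis, and
  -- Phragmén–Lindelöf fills the half plane.
  · obtain ⟨Y, hY⟩ := norm_le_of_tendsto_zero_vertical (x₀ := -(α / 2)) (by linarith)
      (by linarith) hF.differentiableOn hF.continuousOn hM hF.tendsto_cocompact (half_pos h0)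
    set K : Set ℂ := Icc (-(α / 2)) 0 ×ℂ Icc (-|Y|) |Y| with hK
    have hKc : IsCompact K := isCompact_Icc.reProdIm isCompact_Icc
    have hFc : ContinuousOn (fun z => a₀ + (F z).re) K := by
      refine continuousOn_const.add (Complex.continuous_re.comp_continuousOn
        (hF.continuousOn.mono fun z hz => ?_))
      rw [hK, Complex.mem_reProdIm] at hz
      have := hz.1.1
      show -α ≤ z.re
      linarith
    obtain ⟨m, hm, hmle⟩ :
        ∃ m : ℝ, 0 < m ∧ ∀ η : ℝ, |η| ≤ |Y| → m ≤ a₀ + (F (η * Complex.I)).re := by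
      have hc : ContinuousOn (fun η : ℝ => a₀ + (F (η * Complex.I)).re) (Icc (-|Y|) |Y|) := by
        refine hFc.comp (by fun_prop) fun η hη => ?_
        rw [hK, Complex.mem_reProdIm]
        simpa using ⟨(half_pos hα).le, hη⟩
      obtain ⟨η, _, hη⟩ := isCompact_Icc.exists_isMinOn ⟨0, by simp⟩ hc
      refine ⟨_, ?_, fun η' h' => hη (abs_le.1 h')⟩
      have := hpos η
      rwa [mul_comm] at this
    obtain ⟨d, hd, hdist⟩ := Metric.uniformContinuousOn_iff.1
      (hKc.uniformContinuousOn_of_continuous hFc) m hm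
    set γ : ℝ := min (d / 2) (α / 2)
    have hγ0 : 0 < γ := by positivity
    have hγα : γ ≤ α / 2 := min_le_right _ _
    have hγd : γ ≤ d / 2 := min_le_left _ _
    refine ⟨γ, hγ0, by linarith, fun z hz => ?_⟩
    have := le_re_of_le_re_boundary (f := F) (x₀ := -γ) (c := -a₀) (M := M)
      (hF.differentiableOn.mono fun z hz => by
        have : -γ < z.re := hz
        show -α < z.re
        linarith)
      (hF.continuousOn.mono fun z hz => by
        have : -γ ≤ z.re := hz
        show -α ≤ z.re
        linarith)
      (fun z hz => hM z (by linarith)) (fun η => ?_) hz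
    · linarith
    · rw [mul_comm]
      rcases le_total |Y| |η| with h | h
      · have h1 := hY ((-γ : ℝ) + η * Complex.I) (by simpa using hγα) (by simp; linarith)
          (by simpa using (le_abs_self Y).trans h)
        have h2 := (abs_le.1 ((Complex.abs_re_le_norm (F ((-γ : ℝ) + η * Complex.I))))).1
        linarith
      · have h1 := hdist ((-γ : ℝ) + η * Complex.I) (by
            rw [hK, Complex.mem_reProdIm]
            exact ⟨by simpa using ⟨hγα, hγ0.le⟩, by simpa using abs_le.1 h⟩) (η * Complex.I) (by
            rw [hK, Complex.mem_reProdIm]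
            exact ⟨by simpa using (half_pos hα).le, by simpa using abs_le.1 h⟩) (by
            rw [dist_eq_norm]
            simp only [add_sub_cancel_right, Complex.norm_real, Real.norm_eq_abs, abs_neg,
              abs_of_pos hγ0]
            linarith)
        have h2 := hmle η h
        rw [Real.dist_eq] at h1
        have := (abs_lt.1 h1).1
        linarith
  · refine ⟨α, hα, le_rfl, fun z hz => ?_⟩
    have := le_re_of_le_re_boundary (f := F) (x₀ := -α) (c := 0) (M := M) hF.differentiableOn
      hF.continuousOn hM (fun η => by simpa using hpos η) hz
    linarith

/-- The symbol `a₀ + ã` of the equation is passive. -/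
theorem IsLaplaceExtension.exists_isPassiveSymbol (hF : IsLaplaceExtension a α F) (hα : 0 < α)
    (ha : IsMemoryKernel a) (ha₀ : 0 ≤ a₀)
    (hne : ¬ (a₀ = 0 ∧ a =ᵐ[volume.restrict (Ioi (0 : ℝ))] 0))
    (hpos : (0 < a₀ ∧ ∀ η : ℝ, 0 < a₀ + (F (Complex.I * (η : ℂ))).re) ∨
      ∀ η : ℝ, 0 ≤ (F (-(α : ℂ) + Complex.I * (η : ℂ))).re) :
    ∃ β M L : ℝ, IsPassiveSymbol (fun z => a₀ + F z) β M L := by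
  obtain ⟨γ, hγ, hγα, hre⟩ := hF.exists_re_nonneg hα ha₀ hpos
  obtain ⟨M, hM⟩ := hF.bounded
  have hd : DifferentiableOn ℂ (fun z => a₀ + F z) {z | -γ < z.re} :=
    (differentiableOn_const _).add (hF.differentiableOn.mono fun z hz => by
      have : -γ < z.re := hz
      show -α < z.re
      linarith)
  have hMG : ∀ z : ℂ, -γ < z.re → ‖a₀ + F z‖ ≤ a₀ + M := fun z hz => by
    refine (norm_add_le _ _).trans ?_
    rw [Complex.norm_real, Real.norm_of_nonneg ha₀]
    have := hM z (by linarith)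
    linarith
  have hconj : ∀ z : ℂ, -γ < z.re →
      (a₀ + F (starRingEnd ℂ z)) = starRingEnd ℂ (a₀ + F z) := fun z hz => by
    rw [map_add, Complex.conj_ofReal, hF.conj_symm hα (by linarith)]
  -- If the real part vanished somewhere, `e^{-(a₀ + F)}` would attain its maximum modulus, so the
  -- real part would vanish identically and `F` would be constant. By Riemann–Lebesgue the constant
  -- is zero, hence `a₀ = 0` and `a = 0` almost everywhere, contrary to `hne`.
  have hstrict : ∀ z : ℂ, -γ < z.re → 0 < (a₀ + F z).re := by
    by_contra! hcon
    obtain ⟨z₀, hz₀, hle⟩ := hcon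
    have hz₀re : ((a₀ : ℂ) + F z₀).re = 0 := by
      refine le_antisymm hle ?_
      simpa using hre z₀ hz₀.le
    have hmax : IsMaxOn (norm ∘ fun z => Complex.exp (-(a₀ + F z))) {z : ℂ | -γ < z.re} z₀ := by
      intro z hz
      simp only [mem_ofPred_eq, Function.comp, Complex.norm_exp, Real.exp_le_exp, Complex.neg_re,
        hz₀re, Complex.add_re, Complex.ofReal_re]
      linarith [hre z (le_of_lt hz)]
    have heq := Complex.eqOn_of_isPreconnected_of_isMaxOn_norm (isPreconnected_re_gt _)
      (isOpen_re_gt _) hd.neg.cexp hz₀ hmax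
    have hzero : ∀ z : ℂ, -γ < z.re → ((a₀ : ℂ) + F z).re = 0 := by
      intro z hz
      have := congrArg norm (heq hz)
      simp only [Function.const, Complex.norm_exp, Real.exp_eq_exp, Pi.neg_apply, Complex.neg_re,
        hz₀re] at this
      linarith
    have hderiv : ∀ z : ℂ, -γ < z.re → deriv (fun z => (a₀ : ℂ) + F z) z = 0 := by
      intro z hz
      have hsub : ∀ w ∈ Metric.ball z (z.re + γ), -γ < w.re := by
        intro w hw
        have h1 : ‖w - z‖ < z.re + γ := by simpa [dist_eq_norm] using hw
        have h2 := (abs_le.1 (Complex.abs_re_le_norm (w - z))).1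
        rw [Complex.sub_re] at h2
        linarith
      have := norm_deriv_mul_le_two_re (f := fun z => (a₀ : ℂ) + F z) (z := z) (r := z.re + γ)
        (by linarith) (hd.mono hsub) fun w hw => (hzero w (hsub w hw)).ge
      simp only [hzero z hz, mul_zero] at this
      have h3 : 0 < z.re + γ := by linarith
      exact norm_le_zero_iff.1 (by nlinarith [norm_nonneg (deriv (fun z => (a₀ : ℂ) + F z) z)])
    have hconst : ∀ z : ℂ, -γ < z.re → (a₀ : ℂ) + F z = a₀ + F 1 := by
      intro z hz
      have h1 : -γ < (1 : ℂ).re := by simp; linarith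
      have := (convex_halfSpace_re_gt (-γ)).norm_image_sub_le_of_norm_deriv_le
        (f := fun z => (a₀ : ℂ) + F z) (C := 0)
        (fun w hw => hd.differentiableAt ((isOpen_re_gt _).mem_nhds hw))
        (fun w hw => by rw [hderiv w hw, norm_zero]) h1 hz
      rw [zero_mul] at this
      exact sub_eq_zero.1 (norm_le_zero_iff.1 this)
    have hF0 : F 1 = 0 := by
      have h1 := hF.tendsto_cocompact
      have h2 : ∀ y : ℝ, F (1 + y * Complex.I) = F 1 := fun y =>
        add_left_cancel (hconst _ (by simp; linarith))
      simp only [h2] at h1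
      exact tendsto_nhds_unique tendsto_const_nhds h1
    have h1 : -γ < (1 : ℂ).re := by simp; linarith
    have ha0 : a₀ = 0 := by
      have := hzero 1 h1
      rw [hF0] at this
      simpa using this
    refine hne ⟨ha0, ha.ae_eq_zero fun z hz => ?_⟩
    rw [← hF.eq_laplaceTransform z hz, ← hF0]
    exact add_left_cancel (hconst z (by linarith))
  -- Half of the half plane's width is given up so that Cauchy's estimate with radius `γ/2` bounds
  -- the derivative.
  refine ⟨γ / 2, a₀ + M, (a₀ + M) / (γ / 2), by positivity, hd.mono fun z hz => ?_,
    fun z hz => hMG z (by linarith), fun z hz => ?_, fun z hz => hstrict z (by linarith),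
    fun z hz => hconj z (by linarith)⟩
  · have : -(γ / 2) < z.re := hz
    show -γ < z.re
    linarith
  · have hball : ∀ w ∈ Metric.closedBall z (γ / 2), -γ < w.re := by
      intro w hw
      have h1 : ‖w - z‖ ≤ γ / 2 := by simpa [dist_eq_norm] using hw
      have h2 := (abs_le.1 (Complex.abs_re_le_norm (w - z))).1
      rw [Complex.sub_re] at h2
      linarith
    refine Complex.norm_deriv_le_of_forall_mem_sphere_norm_le (by positivity) ?_ fun w hw =>
      hMG w (hball w (Metric.sphere_subset_closedBall hw))
    exact (hd.mono hball).diffContOnCl_ball (subset_refl _)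

end Symbol

/-! ### Convergence of the integrated kernel. -/

/-- Both `e^{zh} - 1` and `G - G(0)` vanish at the origin and cancel the double pole, so the line
may be moved to `Re z = -δ`, where `e^{zt}` decays. There `|e^{zh}| ≤ 1`, which makes the bound
uniform in `h`. The removable singularity is handled by `dslope`. -/
theorem integral_inv_sq_mul_sub_eq {G : ℂ → ℂ} {M δ t h : ℝ} (hδ : 0 < δ)
    (hd : ∀ z : ℂ, -δ ≤ z.re → DifferentiableAt ℂ G z) (hM : ∀ z : ℂ, -δ ≤ z.re → ‖G z‖ ≤ M)
    (ht : 0 ≤ t) (hh : 0 ≤ h) :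
    ‖∫ y : ℝ, Complex.exp (((1 : ℝ) + y * Complex.I) * t)
      * (Complex.exp (((1 : ℝ) + y * Complex.I) * h) - 1)
      * (G ((1 : ℝ) + y * Complex.I) - G 0) / ((1 : ℝ) + y * Complex.I) ^ 2‖
      ≤ 4 * M * Real.pi / δ * Real.exp (-(δ * t)) := by
  have hM0 : 0 ≤ M := (norm_nonneg _).trans (hM 0 (by simpa using hδ.le))
  have hsub : ∀ z : ℂ, -δ ≤ z.re → ‖G z - G 0‖ ≤ 2 * M := fun z hz => by
    refine (norm_sub_le _ _).trans ?_
    linarith [hM z hz, hM 0 (by simpa using hδ.le)]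
  let K : ℂ → ℂ := fun z => Complex.exp (z * t) *
    dslope (fun z => Complex.exp (z * h)) 0 z * dslope G 0 z
  have hK : ∀ z : ℂ, z ≠ 0 → K z
      = Complex.exp (z * t) * (Complex.exp (z * h) - 1) * (G z - G 0) / z ^ 2 := by
    intro z hz
    simp only [K, dslope_of_ne _ hz, slope_def_field, zero_mul, Complex.exp_zero, sub_zero]
    field_simp
  have hslope : ∀ {f : ℂ → ℂ} {z : ℂ}, DifferentiableAt ℂ f z →
      (∀ᶠ w in 𝓝 (0 : ℂ), DifferentiableAt ℂ f w) → DifferentiableAt ℂ (dslope f 0) z := by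
    intro f z hf h0
    rcases eq_or_ne z 0 with rfl | hz
    · obtain ⟨s, hs, hso, h0s⟩ := eventually_nhds_iff.1 h0
      have := (Complex.differentiableOn_dslope (hso.mem_nhds h0s)).2
        fun w hw => (hs w hw).differentiableWithinAt
      exact this.differentiableAt (hso.mem_nhds h0s)
    · exact (differentiableAt_dslope_of_ne hz).2 hf
  have hKd : ∀ z : ℂ, -δ ≤ z.re → DifferentiableAt ℂ K z := by
    intro z hz
    refine DifferentiableAt.mul (DifferentiableAt.mul (by fun_prop) ?_) ?_
    · exact hslope (by fun_prop) (.of_forall fun w => by fun_prop)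
    · refine hslope (hd z hz) ?_
      filter_upwards [(isOpen_re_gt (-δ)).mem_nhds
        (show -δ < (0 : ℂ).re by simpa using hδ)] with w hw using hd w (le_of_lt hw)
  have hKn : ∀ z : ℂ, z ≠ 0 → -δ ≤ z.re → ‖K z‖
      ≤ Real.exp (z.re * t) * (Real.exp (z.re * h) + 1) * (2 * M) / ‖z‖ ^ 2 := by
    intro z hz hz'
    rw [hK z hz, norm_div, norm_mul, norm_mul, norm_pow, Complex.norm_exp]
    have h1 : ‖Complex.exp (z * h) - 1‖ ≤ Real.exp (z.re * h) + 1 := by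
      refine (norm_sub_le _ _).trans ?_
      rw [Complex.norm_exp, norm_one]
      simp
    have := hsub z hz'
    simp only [Complex.re_mul_ofReal]
    gcongr
  have hne : ∀ {x : ℝ}, x ≠ 0 → ∀ y : ℝ, (x : ℂ) + y * Complex.I ≠ 0 := by
    intro x hx y h0
    have := congrArg Complex.re h0
    simp at this
    exact hx this
  have hshift := integral_vertical_eq (h := K) (x₁ := -δ) (x₂ := 1) (Y := 1)
    (C := Real.exp t * (Real.exp h + 1) * (2 * M)) (by linarith) (fun z hz _ => hKd z hz)
    (fun z hz hz1 hy => by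
      have hz0 : z ≠ 0 := by
        rintro rfl
        simp at hy
        linarith
      refine (hKn z hz0 hz).trans ?_
      have h1 : 0 < z.im ^ 2 := by rw [← sq_abs]; positivity
      have h2 : z.im ^ 2 ≤ ‖z‖ ^ 2 := by
        rw [← sq_abs]
        gcongr
        exact Complex.abs_im_le_norm z
      gcongr
      · nlinarith
      · nlinarith)
  have e1 : ∀ y : ℝ, K ((1 : ℝ) + y * Complex.I) = Complex.exp (((1 : ℝ) + y * Complex.I) * t)
      * (Complex.exp (((1 : ℝ) + y * Complex.I) * h) - 1)
      * (G ((1 : ℝ) + y * Complex.I) - G 0) / ((1 : ℝ) + y * Complex.I) ^ 2 :=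
    fun y => hK _ (hne one_ne_zero y)
  simp only [← e1]
  rw [← hshift]
  have hb : ∀ y : ℝ, ‖K ((-δ : ℝ) + y * Complex.I)‖
      ≤ 4 * M / δ ^ 2 * Real.exp (-(δ * t)) * (1 + (δ⁻¹ * y) ^ 2)⁻¹ := by
    intro y
    have hz0 := hne (neg_ne_zero.2 hδ.ne') y
    have er : (((-δ : ℝ) : ℂ) + y * Complex.I).re = -δ := by simp
    refine (hKn _ hz0 er.ge).trans ?_
    have en : ‖((-δ : ℝ) : ℂ) + y * Complex.I‖ ^ 2 = δ ^ 2 * (1 + (δ⁻¹ * y) ^ 2) := by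
      rw [← Complex.normSq_eq_norm_sq, Complex.normSq_apply]
      simp
      field_simp
    have hle : Real.exp (-δ * h) ≤ 1 := Real.exp_le_one_iff.2 (by nlinarith)
    rw [er, en, neg_mul]
    calc _ ≤ Real.exp (-(δ * t)) * (1 + 1) * (2 * M) / (δ ^ 2 * (1 + (δ⁻¹ * y) ^ 2)) := by
          gcongr
      _ = _ := by field_simp; ring
  have hi := norm_integral_le_of_norm_le
    ((integrable_inv_one_add_mul_sq (inv_pos.2 hδ)).const_mul _) (.of_forall hb)
  rw [integral_const_mul, integral_inv_one_add_mul_sq (inv_pos.2 hδ)] at hi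
  refine hi.trans_eq ?_
  field_simp

theorem IsMemoryKernel.abs_integratedKernel_sub_le {a : ℝ → ℝ} (ha : IsMemoryKernel a) (a₀ : ℝ) :
    ∃ M : ℝ, 0 ≤ M ∧ ∀ s t : ℝ, 1 ≤ t → t ≤ s →
      |integratedKernel a₀ a s - integratedKernel a₀ a t| ≤ M * (s - t) := by
  obtain ⟨M, hM⟩ := ha.bounded 1 one_pos
  refine ⟨M, (abs_nonneg _).trans (hM 1 le_rfl), fun s t ht hs => ?_⟩
  have e : integratedKernel a₀ a s - integratedKernel a₀ a t = ∫ r in t..s, a r := by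
    rw [integratedKernel, integratedKernel, add_sub_add_left_eq_sub,
      intervalIntegral.integral_interval_sub_left]
    · exact ha.intervalIntegrable le_rfl (by linarith)
    · exact ha.intervalIntegrable le_rfl (by linarith)
  have := intervalIntegral.norm_integral_le_of_norm_le_const (a := t) (b := s) (f := a) (C := M)
    fun r hr => by
      rw [uIoc_of_le hs] at hr
      exact hM r (by linarith [hr.1])
  rwa [abs_of_nonneg (by linarith), Real.norm_eq_abs, ← e] at this

/-- The integrated kernel converges to the value of the symbol at the origin. -/
theorem IsPassiveSymbol.tendsto_integratedKernel {G : ℂ → ℂ} {β M L a₀ : ℝ} {a : ℝ → ℝ}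
    (hG : IsPassiveSymbol G β M L) (ha : IsMemoryKernel a)
    (hGa : ∀ z : ℂ, 0 < z.re → G z = a₀ + laplaceTransform a z) :
    Tendsto (integratedKernel a₀ a) atTop (𝓝 (G 0).re) := by
  have hβ := hG.pos
  have hM0 := hG.M_nonneg
  let A : ℝ → ℝ := fun t => integratedKernel a₀ a (max t 0)
  have hAe : ∀ t, 0 ≤ t → A t = integratedKernel a₀ a t := fun t ht => by
    simp only [A, max_eq_left ht]
  have hAc : Continuous A :=
    (ha.continuousOn_integratedKernel a₀).comp_continuous (by fun_prop) fun t => le_max_right t 0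
  -- The transform `G/z` of `A` need not be integrable on vertical lines; that of its primitive,
  -- `G/z²`, is.
  let B : ℝ → ℂ := fun t => ((∫ s in (0 : ℝ)..max t 0, A s : ℝ) : ℂ)
  have hBc : Continuous B := by
    refine Complex.continuous_ofReal.comp ?_
    exact (intervalIntegral.continuous_primitive (fun _ _ => hAc.intervalIntegrable _ _) 0).comp
      (by fun_prop)
  have hAl : ∀ z : ℂ, 0 < z.re → LaplaceConverges (fun t => (A t : ℂ)) z := fun z hz =>
    IntegrableOn.congr_fun (ha.laplaceConverges_integratedKernel a₀ hz)
      (fun t ht => by simp only [hAe t (le_of_lt ht)]) measurableSet_Ioi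
  have hAL : ∀ z : ℂ, 0 < z.re → complexLaplace (fun t => (A t : ℂ)) z = G z / z := by
    intro z hz
    rw [hGa z hz, ← ha.complexLaplace_integratedKernel a₀ hz]
    exact setIntegral_congr_fun measurableSet_Ioi fun t ht => by simp only [hAe t (le_of_lt ht)]
  have hBe : ∀ t, 0 ≤ t → B t = ∫ s in (0 : ℝ)..t, (A s : ℂ) := fun t ht => by
    simp only [B, max_eq_left ht, intervalIntegral.integral_ofReal]
  have hBl : ∀ z : ℂ, 0 < z.re → LaplaceConverges B z := fun z hz =>
    IntegrableOn.congr_fun (laplaceConverges_primitive hz (hAl z hz))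
      (fun t ht => by simp only [hBe t (le_of_lt ht)]) measurableSet_Ioi
  have hBL : ∀ z : ℂ, 0 < z.re → complexLaplace B z = G z / z ^ 2 := by
    intro z hz
    have h1 : complexLaplace B z = complexLaplace (fun t => ∫ s in (0 : ℝ)..t, (A s : ℂ)) z :=
      setIntegral_congr_fun measurableSet_Ioi fun t ht => by simp only [hBe t (le_of_lt ht)]
    rw [h1, complexLaplace_primitive hz (hAl z hz), hAL z hz, div_div, sq]
  have hz0 : ∀ y : ℝ, ((1 : ℝ) : ℂ) + y * Complex.I ≠ 0 := by
    intro y h0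
    have := congrArg Complex.re h0
    simp at this
  have hi1 : ∀ t : ℝ, Integrable fun y : ℝ => Complex.exp (((1 : ℝ) + y * Complex.I) * t)
      * (((1 : ℝ) + y * Complex.I + (0 : ℝ)) ^ 2)⁻¹ := by
    intro t
    refine ((integrable_inv_add_sq one_pos le_rfl).norm.const_mul (Real.exp t)).mono'
      (Continuous.aestronglyMeasurable ?_) (.of_forall fun y => ?_)
    · refine Continuous.mul (by fun_prop) (Continuous.inv₀ (by fun_prop) fun y => pow_ne_zero 2 ?_)
      simpa using hz0 y
    · rw [norm_mul, Complex.norm_exp]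
      simp
  have hcG : Continuous fun y : ℝ => G ((1 : ℝ) + y * Complex.I) :=
    continuous_vertical fun z hz => (hG.differentiableAt (by linarith)).continuousAt
  have hi2 : ∀ t : ℝ, Integrable fun y : ℝ => Complex.exp (((1 : ℝ) + y * Complex.I) * t)
      * (G ((1 : ℝ) + y * Complex.I) / ((1 : ℝ) + y * Complex.I) ^ 2) := by
    intro t
    refine ((hi1 t).norm.const_mul M).mono' (Continuous.aestronglyMeasurable ?_)
      (.of_forall fun y => ?_)
    · exact Continuous.mul (by fun_prop) (hcG.div (by fun_prop) fun y => pow_ne_zero 2 (hz0 y))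
    · rw [Complex.ofReal_zero, add_zero, norm_mul, norm_div, norm_mul, norm_inv, mul_left_comm,
        div_eq_mul_inv]
      gcongr
      exact hG.norm_le _ (by simp; linarith)
  have hBt : ∀ t, B t = (2 * Real.pi : ℝ)⁻¹ • ∫ y : ℝ,
      Complex.exp (((1 : ℝ) + y * Complex.I) * t)
        * (G ((1 : ℝ) + y * Complex.I) / ((1 : ℝ) + y * Complex.I) ^ 2) := by
    intro t
    have e : ∀ y : ℝ, complexLaplace B ((1 : ℝ) + y * Complex.I)
        = G ((1 : ℝ) + y * Complex.I) / ((1 : ℝ) + y * Complex.I) ^ 2 := fun y =>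
      hBL _ (by simp)
    rw [eq_integral_complexLaplace hBc (fun t ht => by simp [B, max_eq_right ht])
      (hBl ((1 : ℝ) : ℂ) (by simp)) (by
        simp only [e]
        simpa using hi2 0) t]
    simp only [e]
  have hid : ∀ t : ℝ, 0 ≤ t → (t : ℂ) = (2 * Real.pi : ℝ)⁻¹ • ∫ y : ℝ,
      Complex.exp (((1 : ℝ) + y * Complex.I) * t)
        * (((1 : ℝ) + y * Complex.I + (0 : ℝ)) ^ 2)⁻¹ := fun t ht => by
    rw [← mul_exp_neg_eq_integral one_pos le_rfl ht]
    simp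
  -- Increments of `B` are exponentially close to those of the linear function `G(0) t`, uniformly
  -- in the step `h`.
  have hE : ∀ t h : ℝ, 0 ≤ t → 0 ≤ h → ‖B (t + h) - B t - G 0 * h‖
      ≤ 4 * M / β * Real.exp (-(β / 2 * t)) := by
    intro t h ht hh
    have e1 : B (t + h) - B t - G 0 * h = (2 * Real.pi : ℝ)⁻¹ • ∫ y : ℝ,
        Complex.exp (((1 : ℝ) + y * Complex.I) * t)
        * (Complex.exp (((1 : ℝ) + y * Complex.I) * h) - 1)
        * (G ((1 : ℝ) + y * Complex.I) - G 0) / ((1 : ℝ) + y * Complex.I) ^ 2 := by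
      have e2 : G 0 * (h : ℂ) = G 0 * ((2 * Real.pi : ℝ)⁻¹ • ∫ y : ℝ,
            Complex.exp (((1 : ℝ) + y * Complex.I) * (t + h : ℝ))
              * (((1 : ℝ) + y * Complex.I + (0 : ℝ)) ^ 2)⁻¹)
          - G 0 * ((2 * Real.pi : ℝ)⁻¹ • ∫ y : ℝ, Complex.exp (((1 : ℝ) + y * Complex.I) * t)
              * (((1 : ℝ) + y * Complex.I + (0 : ℝ)) ^ 2)⁻¹) := by
        rw [← hid (t + h) (by linarith), ← hid t ht]
        push_cast
        ring
      rw [e2, hBt (t + h), hBt t, mul_smul_comm,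
        mul_smul_comm, ← smul_sub, ← smul_sub, ← smul_sub, ← integral_const_mul,
        ← integral_const_mul, ← integral_sub (hi2 _) (hi2 _),
        ← integral_sub ((hi1 _).const_mul _) ((hi1 _).const_mul _), ← integral_sub]
      rotate_left
      · exact (hi2 _).sub (hi2 _)
      · exact ((hi1 _).const_mul _).sub ((hi1 _).const_mul _)
      congr 1
      refine integral_congr_ae (.of_forall fun y => ?_)
      simp only [Complex.ofReal_zero, add_zero, Complex.ofReal_add t h, mul_add, Complex.exp_add]
      have := hz0 y
      field_simp
    rw [e1, norm_smul, Real.norm_of_nonneg (by positivity)]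
    have := integral_inv_sq_mul_sub_eq (G := G) (M := M) (δ := β / 2) (by positivity)
      (fun z hz => hG.differentiableAt (by linarith)) (fun z hz => hG.norm_le z (by linarith)) ht hh
    calc _ ≤ (2 * Real.pi)⁻¹ * (4 * M * Real.pi / (β / 2) * Real.exp (-(β / 2 * t))) := by gcongr
      _ = _ := by field_simp
  obtain ⟨Ma, hMa0, hMa⟩ := ha.abs_integratedKernel_sub_le a₀
  have hBd : ∀ t h : ℝ, 1 ≤ t → 0 ≤ h → ‖B (t + h) - B t - (A t : ℂ) * h‖ ≤ Ma * h * h := by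
    intro t h ht hh
    have hAi : ∀ r s : ℝ, IntervalIntegrable (fun s => (A s : ℂ)) volume r s := fun r s =>
      (Complex.continuous_ofReal.comp hAc).intervalIntegrable _ _
    rw [hBe t (by linarith), hBe (t + h) (by linarith),
      intervalIntegral.integral_interval_sub_left (hAi _ _) (hAi _ _)]
    have e : (A t : ℂ) * h = ∫ _ in t..(t + h), (A t : ℂ) := by
      simp [mul_comm]
    rw [e, ← intervalIntegral.integral_sub (hAi _ _) (by simp)]
    have := intervalIntegral.norm_integral_le_of_norm_le_const (a := t) (b := t + h)
      (f := fun s => (A s : ℂ) - (A t : ℂ)) (C := Ma * h) fun s hs => by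
        rw [uIoc_of_le (by linarith)] at hs
        rw [← Complex.ofReal_sub, Complex.norm_real, Real.norm_eq_abs, hAe s (by linarith [hs.1]),
          hAe t (by linarith)]
        refine (hMa s t ht hs.1.le).trans ?_
        gcongr
        linarith [hs.2]
    rwa [add_sub_cancel_left, abs_of_nonneg hh] at this
  have hfin : ∀ t : ℝ, 1 ≤ t → ‖integratedKernel a₀ a t - (G 0).re‖
      ≤ (Ma + 4 * M / β) * Real.exp (-(β / 4 * t)) := by
    intro t ht
    -- A Tauberian choice of step: `h² = e^{-βt/2}` balances the error of `hE` against the Lipschitz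
    -- error `Ma h²` of `hBd`, and division by `h` leaves `e^{-βt/4}`.
    set h : ℝ := Real.exp (-(β / 4 * t)) with hh
    have hh0 : 0 < h := Real.exp_pos _
    have h1 := hE t h (by linarith) hh0.le
    have h2 := hBd t h ht hh0.le
    have e : Real.exp (-(β / 2 * t)) = h * h := by rw [hh, ← Real.exp_add]; ring_nf
    have h3 : ‖(((integratedKernel a₀ a t - (G 0).re) * h : ℝ) : ℂ)‖
        ≤ Ma * h * h + 4 * M / β * (h * h) := by
      have e3 : (((integratedKernel a₀ a t - (G 0).re) * h : ℝ) : ℂ)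
          = (B (t + h) - B t - G 0 * h) - (B (t + h) - B t - (A t : ℂ) * h) := by
        rw [hAe t (by linarith), hG.apply_zero]
        push_cast
        rw [Complex.ofReal_re]
        ring
      rw [e3]
      refine (norm_sub_le _ _).trans ?_
      rw [e] at h1
      linarith
    rw [Complex.norm_real, norm_mul, Real.norm_of_nonneg hh0.le] at h3
    nlinarith
  rw [← tendsto_sub_nhds_zero_iff]
  have hlim : Tendsto (fun t : ℝ => (Ma + 4 * M / β) * Real.exp (-(β / 4 * t))) atTop (𝓝 0) := by
    have : Tendsto (fun t : ℝ => Real.exp (-(β / 4 * t))) atTop (𝓝 0) :=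
      Real.tendsto_exp_neg_atTop_nhds_zero.comp
        (tendsto_id.const_mul_atTop (by positivity : 0 < β / 4))
    simpa using this.const_mul (Ma + 4 * M / β)
  refine squeeze_zero_norm' ?_ hlim
  filter_upwards [eventually_ge_atTop 1] with t ht using hfin t ht

/-! ### From the weak to the integrated equation in the time variable. -/

theorem integral_mul_convolution_swap {w K g : ℝ → ℂ} {C : ℝ} (hw : Integrable w)
    (hK : Integrable K) (hg : Continuous g) (hgC : ∀ t, ‖g t‖ ≤ C) :
    Integrable (fun s => w s * ∫ t, K (t - s) * g t) ∧
      ∫ s, w s * ∫ t, K (t - s) * g t = ∫ t, g t * ∫ s, w s * K (t - s) := by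
  have hH : Integrable (Function.uncurry fun t s => g t * (w s * K (t - s)))
      ((volume : Measure ℝ).prod volume) := by
    have h1 := Integrable.convolution_integrand (ContinuousLinearMap.mul ℝ ℂ) hw hK
      (μ := volume) (ν := volume)
    have h2 := h1.bdd_mul (f := fun p : ℝ × ℝ => g p.1) (c := C)
      (Continuous.aestronglyMeasurable (by fun_prop)) (.of_forall fun p => hgC p.1)
    exact h2
  have e : ∀ s, w s * ∫ t, K (t - s) * g t = ∫ t, g t * (w s * K (t - s)) := fun s => by
    rw [← integral_const_mul]
    refine integral_congr_ae (.of_forall fun t => ?_)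
    simp only
    ring
  simp only [e, ← integral_const_mul]
  exact ⟨hH.integral_prod_right, (integral_integral_swap hH).symm⟩

/-- The primitive of a compactly supported smooth function, normalised to vanish to the right of
the support and cut off to the left of the origin, is a test function. -/
theorem exists_testFunction_deriv_eq {g : ℝ → ℝ} {R : ℝ} (hg : ContDiff ℝ ∞ g)
    (hgR : ∀ t, R ≤ t → g t = 0) :
    ∃ φ : ℝ → ℝ, ContDiff ℝ ∞ φ ∧ HasCompactSupport φ ∧ (∀ t, 0 ≤ t → deriv φ t = g t) ∧
      (∀ t, 0 ≤ t → φ t = -∫ s in t..R, g s) := by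
  let φ₀ : ℝ → ℝ := fun t => ∫ s in R..t, g s
  have hd : ∀ t, HasDerivAt φ₀ (g t) t := fun t =>
    (hg.continuous.integral_hasStrictDerivAt R t).hasDerivAt
  have hφ₀ : ContDiff ℝ ∞ φ₀ := by
    rw [contDiff_infty_iff_deriv]
    refine ⟨fun t => (hd t).differentiableAt, ?_⟩
    rwa [show deriv φ₀ = g from funext fun t => (hd t).deriv]
  have h0 : ∀ t, R ≤ t → φ₀ t = 0 := fun t ht => by
    refine intervalIntegral.integral_zero_ae (.of_forall fun s hs => ?_)
    rw [uIoc_of_le ht] at hs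
    exact hgR s hs.1.le
  have hone : ∀ t : ℝ, -1 ≤ t → Real.smoothTransition (t + 2) * φ₀ t = φ₀ t := fun t ht => by
    rw [Real.smoothTransition.one_of_one_le (by linarith), one_mul]
  refine ⟨fun t => Real.smoothTransition (t + 2) * φ₀ t, ?_, ?_, fun t ht => ?_, fun t ht => ?_⟩
  · exact (Real.smoothTransition.contDiff.comp (contDiff_id.add contDiff_const)).mul hφ₀
  · refine HasCompactSupport.intro (isCompact_Icc (a := -2) (b := R)) fun t ht => ?_
    rw [mem_Icc, not_and_or, not_le, not_le] at ht
    rcases ht with ht | ht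
    · rw [Real.smoothTransition.zero_of_nonpos (by linarith), zero_mul]
    · rw [h0 t ht.le, mul_zero]
  · have : (fun t => Real.smoothTransition (t + 2) * φ₀ t) =ᶠ[𝓝 t] φ₀ := by
      filter_upwards [Ici_mem_nhds (show (-1 : ℝ) < t by linarith)] with s hs using hone s hs
    rw [this.deriv_eq, (hd t).deriv]
  · simp only
    rw [hone t (by linarith), ← intervalIntegral.integral_symm]

/-- Cutting both factors to `(0, R]` makes the causal convolution one of functions on the whole line
without changing it at times up to `R`; Fubini is then available. -/
theorem integral_indicator_mul_eq {k : ℝ → ℂ} {f : ℝ → ℂ} {R t : ℝ} (ht : 0 < t) (htR : t ≤ R) :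
    ∫ s, (Ioc 0 R).indicator f s * (Ioc 0 R).indicator k (t - s)
      = ∫ s in (0 : ℝ)..t, f s * k (t - s) := by
  rw [intervalIntegral.integral_of_le ht.le, integral_Ioc_eq_integral_Ioo,
    ← integral_indicator measurableSet_Ioo]
  refine integral_congr_ae (.of_forall fun s => ?_)
  simp only
  by_cases hs : s ∈ Ioo 0 t
  · rw [indicator_of_mem hs, indicator_of_mem (show s ∈ Ioc 0 R from ⟨hs.1, by linarith [hs.2]⟩),
      indicator_of_mem (show t - s ∈ Ioc 0 R from ⟨by linarith [hs.2], by linarith [hs.1]⟩)]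
  · rw [indicator_of_notMem hs]
    by_cases h1 : s ∈ Ioc 0 R
    · rw [indicator_of_notMem (s := Ioc 0 R) (a := t - s), mul_zero]
      exact fun h2 => hs ⟨h1.1, by linarith [h2.1]⟩
    · rw [indicator_of_notMem h1, zero_mul]

/-- A weak solution of `y' = a₀ w + a * w` satisfies the integrated equation. -/
theorem eq_add_integral_of_weak {a : ℝ → ℝ} (ha : IsMemoryKernel a) {a₀ : ℝ} {y w : ℝ → ℂ}
    (hy : Continuous y) (hw : Continuous w)
    (h : ∀ φ : ℝ → ℝ, ContDiff ℝ ∞ φ → HasCompactSupport φ →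
      (∫ s in Ioi (0 : ℝ), ((deriv φ s : ℝ) * y s
        + ((a₀ : ℂ) * φ s + ∫ t in Ioi s, ((a (t - s) : ℝ) : ℂ) * φ t) * w s))
        + φ 0 * y 0 = 0) {t : ℝ} (ht : 0 ≤ t) :
    y t = y 0 + ∫ s in (0 : ℝ)..t, w s * (integratedKernel a₀ a (t - s) : ℂ) := by
  let A : ℝ → ℂ := fun t => (integratedKernel a₀ a (max t 0) : ℂ)
  have hAe : ∀ t, 0 ≤ t → A t = integratedKernel a₀ a t := fun t ht => by
    simp only [A, max_eq_left ht]
  have hAc : Continuous A := Complex.continuous_ofReal.comp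
    ((ha.continuousOn_integratedKernel a₀).comp_continuous (by fun_prop) fun t => le_max_right t 0)
  -- The defect of the integrated equation. It is continuous, so it suffices that it annihilates all
  -- test functions supported in `(0, ∞)`.
  let D : ℝ → ℂ := fun t => y t - y 0 - ∫ s in (0 : ℝ)..t, w s * A (t - s)
  have hDc : Continuous D := by
    have h1 := intervalIntegral.continuous_parametric_primitive_of_continuous (a₀ := 0)
      (μ := volume) (f := fun t s => w s * A (t - s)) (by
        simp only [Function.uncurry_def]
        fun_prop)
    have h2 : Continuous fun t : ℝ => ∫ s in (0 : ℝ)..t, w s * A (t - s) :=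
      h1.comp (continuous_id.prodMk continuous_id)
    exact (hy.sub continuous_const).sub h2
  have hD0 : D 0 = 0 := by simp [D]
  suffices hD : ∀ t, 0 < t → D t = 0 by
    have h1 : D t = 0 := by
      rcases ht.eq_or_lt with rfl | h
      · exact hD0
      · exact hD t h
    have h2 : ∫ s in (0 : ℝ)..t, w s * (integratedKernel a₀ a (t - s) : ℂ)
        = ∫ s in (0 : ℝ)..t, w s * A (t - s) := by
      refine intervalIntegral.integral_congr fun s hs => ?_
      rw [uIcc_of_le ht] at hs
      simp only [hAe (t - s) (by linarith [hs.2])]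
    rw [h2]
    linear_combination h1
  have key := isOpen_Ioi.ae_eq_zero_of_integral_contDiff_smul_eq_zero (U := Ioi (0 : ℝ))
    (μ := volume) ((hDc.locallyIntegrable (μ := volume)).locallyIntegrableOn _) ?_
  · have h1 : D =ᵐ[volume.restrict (Ioi (0 : ℝ))] fun _ => 0 :=
      (ae_restrict_iff' measurableSet_Ioi).2 key
    exact fun t ht => Measure.eqOn_open_of_ae_eq h1 isOpen_Ioi hDc.continuousOn
      continuousOn_const ht
  intro g hg hgc hgs
  have hg0 : ∀ t, t ≤ 0 → g t = 0 := fun t ht => by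
    by_contra hne
    exact absurd (hgs (subset_tsupport g hne)) (not_lt.2 ht)
  obtain ⟨R, hR0, hgR⟩ : ∃ R : ℝ, 0 < R ∧ ∀ t, R ≤ t → g t = 0 := by
    obtain ⟨R, hR⟩ := hgc.isCompact.isBounded.subset_closedBall 0
    refine ⟨|R| + 1, by positivity, fun t ht => ?_⟩
    by_contra hne
    have := hR (subset_tsupport g hne)
    rw [mem_closedBall_zero_iff, Real.norm_eq_abs] at this
    linarith [le_abs_self t, le_abs_self R]
  obtain ⟨C, hC⟩ := hgc.exists_bound_of_continuous hg.continuous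
  have hcg : Continuous fun t => (g t : ℂ) := Complex.continuous_ofReal.comp hg.continuous
  have hgi : Integrable fun t => (g t : ℂ) :=
    (hg.continuous.integrable_of_hasCompactSupport hgc).ofReal
  have hgC : ∀ t, ‖(g t : ℂ)‖ ≤ C := fun t => by simpa using hC t
  -- The given test function `g` becomes the derivative, on `t ≥ 0`, of an admissible test function,
  -- so the weak equation can be integrated once in time.
  obtain ⟨φ, hφ, hφc, hφd, hφe⟩ := exists_testFunction_deriv_eq hg hgR
  let I : ℝ → ℂ := (Ioc 0 R).indicator fun _ => 1
  let KA : ℝ → ℂ := (Ioc 0 R).indicator A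
  let ka : ℝ → ℂ := (Ioc 0 R).indicator fun t => (a t : ℂ)
  have hIi : Integrable I :=
    (integrable_indicator_iff measurableSet_Ioc).2 (integrableOn_const (by simp))
  have hKAi : Integrable KA :=
    (integrable_indicator_iff measurableSet_Ioc).2 (hAc.integrableOn_Ioc)
  have hkai : Integrable ka :=
    (integrable_indicator_iff measurableSet_Ioc).2 (ha.integrableOn_Ioc R).ofReal
  have hφI : ∀ t, 0 ≤ t → (φ t : ℂ) = -∫ r, I (r - t) * g r := by
    intro t ht
    have h1 : ∫ r, I (r - t) * (g r : ℂ) = ∫ r in t..R, (g r : ℂ) := by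
      rcases le_total t R with h | h
      · rw [intervalIntegral.integral_of_le h, ← integral_indicator measurableSet_Ioc]
        refine integral_congr_ae (.of_forall fun r => ?_)
        simp only [I]
        by_cases hr : r ∈ Ioc t R
        · rw [indicator_of_mem hr, indicator_of_mem
            (show r - t ∈ Ioc 0 R from ⟨by linarith [hr.1], by linarith [hr.2]⟩), one_mul]
        · rw [indicator_of_notMem hr]
          rcases le_or_gt r t with h1 | h1
          · rw [indicator_of_notMem (fun h2 => by linarith [h2.1]), zero_mul]
          · rw [hgR r (le_of_lt (not_le.1 fun h2 => hr ⟨h1, h2⟩))]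
            simp
      · rw [intervalIntegral.integral_zero_ae (.of_forall fun s hs => ?_)]
        · refine integral_eq_zero_of_ae (.of_forall fun r => ?_)
          simp only [I, Pi.zero_apply]
          rcases le_or_gt r t with h1 | h1
          · rw [indicator_of_notMem (fun h2 => by linarith [h2.1]), zero_mul]
          · rw [hgR r (by linarith)]
            simp
        · rw [uIoc_of_ge h] at hs
          rw [hgR s hs.1.le, Complex.ofReal_zero]
    rw [h1, hφe t ht, intervalIntegral.integral_ofReal]
    push_cast
    rfl
  -- On `[0, ∞)`, `-φ` is the tail integral of `g`. Fubini moves this integration onto the kernel,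
  -- and `a₀` plus the primitive of `a` is `A`.
  have hclaim : ∀ s, 0 ≤ s → (a₀ : ℂ) * φ s + ∫ t in Ioi s, ((a (t - s) : ℝ) : ℂ) * φ t
      = -∫ t, KA (t - s) * g t := by
    intro s hs
    have e1 : ∫ t in Ioi s, ((a (t - s) : ℝ) : ℂ) * φ t
        = -∫ t, ka (t - s) * ∫ r, I (r - t) * g r := by
      rw [← integral_indicator measurableSet_Ioi, ← integral_neg]
      refine integral_congr_ae (.of_forall fun t => ?_)
      simp only [ka]
      by_cases ht : t ∈ Ioi s
      · have ht' : s < t := ht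
        rw [indicator_of_mem ht, ← mul_neg, ← hφI t (by linarith)]
        rcases le_or_gt t R with h1 | h1
        · rw [indicator_of_mem (show t - s ∈ Ioc 0 R from ⟨by linarith, by linarith⟩)]
        · have : φ t = 0 := by
            rw [hφe t (by linarith), intervalIntegral.integral_zero_ae, neg_zero]
            refine .of_forall fun r hr => ?_
            rw [uIoc_of_ge h1.le] at hr
            exact hgR r hr.1.le
          simp [this]
      · rw [indicator_of_notMem ht, indicator_of_notMem (fun h2 => ht (by
          have := h2.1
          exact (by linarith : s < t)))]
        simp
    have e2 := (integral_mul_convolution_swap (w := fun t => ka (t - s)) (K := I)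
      (hkai.comp_sub_right s) hIi hcg hgC).2
    have e3 : ∀ r, (g r : ℂ) * ∫ t, ka (t - s) * I (r - t)
        = KA (r - s) * g r - a₀ * (I (r - s) * g r) := by
      intro r
      rcases le_or_gt R r with h1 | h1
      · simp [hgR r h1]
      · have e4 : ∫ t, ka (t - s) * I (r - t) = ∫ t, ka t * I ((r - s) - t) := by
          rw [← integral_sub_right_eq_self (fun t => ka t * I ((r - s) - t)) s]
          simp only [sub_sub_sub_cancel_right]
        rw [e4]
        rcases le_or_gt r s with h2 | h2
        · have e5 : ∫ t, ka t * I ((r - s) - t) = 0 := by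
            refine integral_eq_zero_of_ae (.of_forall fun t => ?_)
            simp only [ka, I, Pi.zero_apply]
            by_cases h3 : t ∈ Ioc 0 R
            · rw [indicator_of_notMem (s := Ioc 0 R) (a := r - s - t), mul_zero]
              exact fun h4 => by linarith [h4.1, h3.1]
            · rw [indicator_of_notMem h3, zero_mul]
          rw [e5]
          simp only [KA, I]
          rw [indicator_of_notMem (fun h4 => by linarith [h4.1]),
            indicator_of_notMem (fun h4 => by linarith [h4.1])]
          ring
        · simp only [ka, I]
          rw [integral_indicator_mul_eq (by linarith) (by linarith)]
          have hm : r - s ∈ Ioc 0 R := ⟨by linarith, by linarith⟩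
          simp only [KA, indicator_of_mem hm, mul_one]
          rw [hAe _ hm.1.le, integratedKernel, intervalIntegral.integral_ofReal]
          push_cast
          ring
    rw [e1, e2]
    simp only [e3]
    have hb : ∀ {k : ℝ → ℂ}, Integrable k → Integrable fun r => k (r - s) * g r := by
      intro k hk
      have := (hk.comp_sub_right s).bdd_mul (f := fun r => (g r : ℂ)) (c := C)
        hcg.aestronglyMeasurable (.of_forall hgC)
      simpa only [mul_comm] using this
    rw [integral_sub (hb hKAi) ((hb hIi).const_mul _), integral_const_mul, hφI s hs]
    ring
  let W : ℝ → ℂ := (Ioc 0 R).indicator w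
  have hWi : Integrable W :=
    (integrable_indicator_iff measurableSet_Ioc).2 (hw.integrableOn_Ioc)
  obtain ⟨hSi, hS⟩ := integral_mul_convolution_swap hWi hKAi hcg hgC
  have hgy : Integrable fun t => (g t : ℂ) * y t :=
    (hcg.mul hy).integrable_of_hasCompactSupport
      ((hgc.comp_left (g := fun x : ℝ => (x : ℂ)) (by simp)).mul_right)
  have hH := h φ hφ hφc
  have e1 : ∫ s in Ioi (0 : ℝ), ((deriv φ s : ℝ) * y s
        + ((a₀ : ℂ) * φ s + ∫ t in Ioi s, ((a (t - s) : ℝ) : ℂ) * φ t) * w s)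
      = ∫ s, ((g s : ℂ) * y s - W s * ∫ t, KA (t - s) * g t) := by
    rw [← integral_indicator measurableSet_Ioi]
    refine integral_congr_ae (.of_forall fun s => ?_)
    simp only
    by_cases hs : s ∈ Ioi (0 : ℝ)
    · have hs' : 0 < s := hs
      rw [indicator_of_mem hs, hclaim s hs'.le, hφd s hs'.le]
      rcases le_or_gt s R with h1 | h1
      · simp only [W]
        rw [indicator_of_mem (show s ∈ Ioc 0 R from ⟨hs', h1⟩)]
        ring
      · have e2 : ∫ t, KA (t - s) * g t = 0 := by
          refine integral_eq_zero_of_ae (.of_forall fun t => ?_)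
          simp only [KA, Pi.zero_apply]
          rcases le_or_gt t s with h2 | h2
          · rw [indicator_of_notMem (fun h4 => by linarith [h4.1]), zero_mul]
          · rw [hgR t (by linarith)]
            simp
        rw [e2]
        ring
    · simp only [W]
      rw [indicator_of_notMem hs, indicator_of_notMem (fun h4 => hs h4.1), hg0 s (not_lt.1 hs)]
      simp
  rw [e1, integral_sub hgy hSi, hS, hφI 0 le_rfl] at hH
  have e2 : ∫ r, I (r - 0) * (g r : ℂ) = ∫ r, (g r : ℂ) := by
    refine integral_congr_ae (.of_forall fun r => ?_)
    simp only [I, sub_zero]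
    by_cases hr : r ∈ Ioc 0 R
    · rw [indicator_of_mem hr, one_mul]
    · rw [indicator_of_notMem hr]
      rcases le_or_gt r 0 with h1 | h1
      · simp [hg0 r h1]
      · simp [hgR r (le_of_lt (not_le.1 fun h2 => hr ⟨h1, h2⟩))]
  have e3 : ∀ t, (g t : ℂ) * ∫ s, W s * KA (t - s)
      = (g t : ℂ) * ∫ s in (0 : ℝ)..t, w s * A (t - s) := by
    intro t
    rcases le_or_gt t 0 with h1 | h1
    · simp [hg0 t h1]
    rcases le_or_gt R t with h2 | h2
    · simp [hgR t h2]
    · simp only [W, KA]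
      rw [integral_indicator_mul_eq h1 h2.le]
  simp only [e3] at hH
  rw [e2] at hH
  have hDi : ∀ {k : ℝ → ℂ}, Continuous k → Integrable fun t => (g t : ℂ) * k t := fun hk =>
    (hcg.mul hk).integrable_of_hasCompactSupport
      ((hgc.comp_left (g := fun x : ℝ => (x : ℂ)) (by simp)).mul_right)
  have hcc : Continuous fun t : ℝ => ∫ s in (0 : ℝ)..t, w s * A (t - s) := by
    have : (fun t : ℝ => ∫ s in (0 : ℝ)..t, w s * A (t - s)) = fun t => y t - y 0 - D t := by
      funext t
      simp [D]
    rw [this]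
    fun_prop
  have e4 : ∫ t, g t • D t = (∫ t, (g t : ℂ) * y t)
      - (∫ t, (g t : ℂ) * ∫ s in (0 : ℝ)..t, w s * A (t - s)) - (∫ r, (g r : ℂ)) * y 0 := by
    have h1 : Integrable fun t => (g t : ℂ) * y t - g t * ∫ s in (0 : ℝ)..t, w s * A (t - s) :=
      hgy.sub (hDi hcc)
    rw [← integral_mul_const, ← integral_sub hgy (hDi hcc), ← integral_sub h1 (hgi.mul_const _)]
    refine integral_congr_ae (.of_forall fun t => ?_)
    simp only [D, Complex.real_smul]
    ring
  rw [e4]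
  linear_combination hH

/-! ### The Laplacian on square integrable tempered distributions. -/

section CutOff

open scoped SchwartzMap Laplacian

variable {E : Type*} [NormedAddCommGroup E] [InnerProductSpace ℝ E] [FiniteDimensional ℝ E]

theorem norm_laplacian_le (f : E → ℂ) (x : E) :
    ‖Laplacian.laplacian f x‖ ≤ Module.finrank ℝ E * ‖iteratedFDeriv ℝ 2 f x‖ := by
  rw [InnerProductSpace.laplacian_eq_iteratedFDeriv_stdOrthonormalBasis]
  refine (norm_sum_le _ _).trans ?_
  have : ∀ i ∈ Finset.univ, ‖iteratedFDeriv ℝ 2 f x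
      ![(stdOrthonormalBasis ℝ E) i, (stdOrthonormalBasis ℝ E) i]‖
      ≤ ‖iteratedFDeriv ℝ 2 f x‖ := fun i _ => by
    refine (ContinuousMultilinearMap.le_opNorm _ _).trans ?_
    simp [Fin.prod_univ_two]
  refine (Finset.sum_le_card_nsmul _ _ _ this).trans ?_
  simp

variable [MeasurableSpace E] [BorelSpace E]

/-- Cutting off a Schwartz function changes its Laplacian by a controlled amount. -/
theorem exists_memLp_bound_laplacian_cutoff (Θ ψ : 𝓢(E, ℂ)) :
    ∃ h : E → ℝ, MemLp h 2 ∧ ∀ c : ℝ, 0 ≤ c → c ≤ 1 → ∀ x,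
      ‖Θ (c • x) * ψ x‖ ≤ h x ∧
        ‖Laplacian.laplacian (fun y => Θ (c • y) * ψ y) x‖ ≤ h x := by
  have hΘ : ∀ i, ∃ B, 0 ≤ B ∧ ∀ x, ‖iteratedFDeriv ℝ i Θ x‖ ≤ B := fun i => by
    obtain ⟨B, hB, h⟩ := Θ.decay 0 i
    exact ⟨B, hB.le, fun x => by simpa using h x⟩
  choose B hB0 hB using hΘ
  let ψ₁ := SchwartzMap.fderivCLM ℝ E ℂ ψ
  let ψ₂ := SchwartzMap.fderivCLM ℝ E (E →L[ℝ] ℂ) ψ₁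
  let d : ℝ := Module.finrank ℝ E
  have h1 : ∀ x, ‖iteratedFDeriv ℝ 1 ψ x‖ = ‖ψ₁ x‖ := fun x => by
    rw [← norm_iteratedFDeriv_fderiv, norm_iteratedFDeriv_zero]
    rfl
  have h2 : ∀ x, ‖iteratedFDeriv ℝ 2 ψ x‖ = ‖ψ₂ x‖ := fun x => by
    rw [← norm_iteratedFDeriv_fderiv, ← norm_iteratedFDeriv_fderiv, norm_iteratedFDeriv_zero]
    rfl
  refine ⟨fun x => (B 0 + d * B 2) * ‖ψ x‖ + d * (2 * B 1) * ‖ψ₁ x‖ + d * B 0 * ‖ψ₂ x‖,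
    ?_, fun c hc0 hc1 x => ?_⟩
  · exact (((ψ.memLp 2 volume).norm.const_mul _).add ((ψ₁.memLp 2 volume).norm.const_mul _)).add
      ((ψ₂.memLp 2 volume).norm.const_mul _)
  have hd0 : 0 ≤ d := Nat.cast_nonneg _
  have hB00 := hB0 0
  have hB10 := hB0 1
  have hB20 := hB0 2
  constructor
  · rw [norm_mul]
    have := hB 0 (c • x)
    rw [norm_iteratedFDeriv_zero] at this
    calc ‖Θ (c • x)‖ * ‖ψ x‖ ≤ B 0 * ‖ψ x‖ := by gcongr
      _ ≤ _ := by
        have : 0 ≤ d * B 2 * ‖ψ x‖ + d * (2 * B 1) * ‖ψ₁ x‖ + d * B 0 * ‖ψ₂ x‖ := by positivity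
        linarith
  · have hc : ∀ i, ‖iteratedFDeriv ℝ i (fun y => Θ (c • y)) x‖ ≤ B i := fun i => by
      rw [iteratedFDeriv_comp_const_smul c (Θ.smooth i), norm_smul, norm_pow,
        Real.norm_of_nonneg hc0]
      exact (mul_le_of_le_one_left (norm_nonneg _) (pow_le_one₀ hc0 hc1)).trans (hB i _)
    have h3 := norm_iteratedFDeriv_mul_le (𝕜 := ℝ) (f := fun y => Θ (c • y)) (g := ψ) (N := 2)
      ((Θ.smooth 2).comp (contDiff_id.const_smul c)) (ψ.smooth 2) x (n := 2) le_rfl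
    simp only [Finset.sum_range_succ, Finset.range_zero, Finset.sum_empty, zero_add] at h3
    norm_num [h1, h2] at h3
    have e0 := hc 0
    rw [norm_iteratedFDeriv_zero] at e0
    have h4 : ‖iteratedFDeriv ℝ 2 (fun y => Θ (c • y) * ψ y) x‖
        ≤ B 0 * ‖ψ₂ x‖ + 2 * B 1 * ‖ψ₁ x‖ + B 2 * ‖ψ x‖ := by
      refine h3.trans ?_
      gcongr
      · rw [← norm_iteratedFDeriv_one]
        exact hc 1
      · exact hc 2
      · rw [norm_iteratedFDeriv_zero]
    calc _ ≤ d * ‖iteratedFDeriv ℝ 2 (fun y => Θ (c • y) * ψ y) x‖ := norm_laplacian_le _ _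
      _ ≤ d * (B 0 * ‖ψ₂ x‖ + 2 * B 1 * ‖ψ₁ x‖ + B 2 * ‖ψ x‖) := by gcongr
      _ ≤ _ := by
        have : 0 ≤ B 0 * ‖ψ x‖ := by positivity
        linarith

/-- An equation `f = Δ g` between square integrable functions that holds against compactly
supported smooth functions holds for tempered distributions. -/
theorem toTemperedDistribution_eq_laplacian {f g : Lp ℂ 2 (volume : Measure E)}
    (h : ∀ ψ : E → ℂ, ContDiff ℝ ∞ ψ → HasCompactSupport ψ →
      ∫ x, ψ x * f x = ∫ x, Laplacian.laplacian ψ x * g x) :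
    (f : 𝓢'(E, ℂ)) = Laplacian.laplacian (g : 𝓢'(E, ℂ)) := by
  ext ψ
  rw [TemperedDistribution.laplacian_apply_apply, Lp.toTemperedDistribution_apply,
    Lp.toTemperedDistribution_apply]
  simp only [smul_eq_mul, SchwartzMap.laplacian_apply]
  let b : ContDiffBump (0 : E) := ⟨1, 2, one_pos, one_lt_two⟩
  have hbc : HasCompactSupport fun x => (b x : ℂ) :=
    b.hasCompactSupport.comp_left (g := fun x : ℝ => (x : ℂ)) (by simp)
  have hbs : ContDiff ℝ ∞ fun x => (b x : ℂ) := Complex.ofRealCLM.contDiff.comp b.contDiff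
  let Θ : 𝓢(E, ℂ) := hbc.toSchwartzMap hbs
  have hΘ : ∀ x, ‖x‖ ≤ 1 → Θ x = 1 := fun x hx => by
    change ((b x : ℝ) : ℂ) = 1
    rw [b.one_of_mem_closedBall (by simpa using hx), Complex.ofReal_one]
  obtain ⟨H, hH, hHb⟩ := exists_memLp_bound_laplacian_cutoff Θ ψ
  let c : ℕ → ℝ := fun m => 1 / ((m : ℝ) + 1)
  have hc0 : ∀ m, 0 < c m := fun m => by positivity
  have hc1 : ∀ m, c m ≤ 1 := fun m => by
    simp only [c]
    rw [div_le_one (by positivity)]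
    linarith [(Nat.cast_nonneg m : (0 : ℝ) ≤ m)]
  let P : ℕ → E → ℂ := fun m x => Θ (c m • x) * ψ x
  have hPs : ∀ m, ContDiff ℝ ∞ (P m) := fun m =>
    ((Θ.smooth ⊤).comp (contDiff_id.const_smul (c m))).mul (ψ.smooth ⊤)
  have hPc : ∀ m, HasCompactSupport (P m) := fun m =>
    (hbc.comp_smul (hc0 m).ne').mul_right
  -- Equality on a neighbourhood, not merely at `x`, so that the Laplacians at `x` agree as well.
  have hev : ∀ x, ∀ᶠ m in atTop, P m =ᶠ[𝓝 x] ψ := fun x => by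
    have : Tendsto (fun m => c m * (‖x‖ + 1)) atTop (𝓝 0) := by
      have := (tendsto_one_div_add_atTop_nhds_zero_nat (𝕜 := ℝ)).mul_const (‖x‖ + 1)
      rwa [zero_mul] at this
    filter_upwards [this.eventually_le_const one_pos] with m hm
    filter_upwards [Metric.ball_mem_nhds x one_pos] with y hy
    have hy' : ‖y‖ ≤ ‖x‖ + 1 := by
      rw [mem_ball_iff_norm] at hy
      linarith [norm_le_norm_add_norm_sub' y x]
    simp only [P]
    rw [hΘ, one_mul]
    rw [norm_smul, Real.norm_of_nonneg (hc0 m).le]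
    exact (mul_le_mul_of_nonneg_left hy' (hc0 m).le).trans hm
  have hL : Tendsto (fun m => ∫ x, P m x * f x) atTop (𝓝 (∫ x, ψ x * f x)) := by
    refine tendsto_integral_of_dominated_convergence (fun x => H x * ‖f x‖) (fun m => ?_) ?_
      (fun m => ?_) ?_
    · exact (hPs m).continuous.aestronglyMeasurable.mul (Lp.aestronglyMeasurable f)
    · exact hH.integrable_mul (Lp.memLp f).norm
    · refine .of_forall fun x => ?_
      rw [norm_mul]
      gcongr
      exact (hHb _ (hc0 m).le (hc1 m) x).1
    · refine .of_forall fun x => tendsto_const_nhds.congr' ?_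
      filter_upwards [hev x] with m hm
      rw [hm.eq_of_nhds]
  have hR : Tendsto (fun m => ∫ x, Laplacian.laplacian (P m) x * g x) atTop
      (𝓝 (∫ x, Laplacian.laplacian (ψ : E → ℂ) x * g x)) := by
    refine tendsto_integral_of_dominated_convergence (fun x => H x * ‖g x‖) (fun m => ?_) ?_
      (fun m => ?_) ?_
    · refine Continuous.aestronglyMeasurable ?_ |>.mul (Lp.aestronglyMeasurable g)
      have := (Laplacian.laplacian ((hPc m).toSchwartzMap (hPs m))).continuous
      rwa [funext (SchwartzMap.laplacian_apply _)] at this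
    · exact hH.integrable_mul (Lp.memLp g).norm
    · refine .of_forall fun x => ?_
      rw [norm_mul]
      gcongr
      exact (hHb _ (hc0 m).le (hc1 m) x).2
    · refine .of_forall fun x => tendsto_const_nhds.congr' ?_
      filter_upwards [hev x] with m hm
      rw [(InnerProductSpace.laplacian_congr_nhds hm).eq_of_nhds]
  simp only [h _ (hPs _) (hPc _)] at hL
  exact tendsto_nhds_unique hL hR

/-- Evaluated at `𝓕 χ` for smooth compactly supported `χ`, the Laplacian acts as multiplication by
`-|2πξ|²`; the two locally integrable functions then agree as distributions. -/
theorem fourier_ae_eq_of_laplacian {f g : Lp ℂ 2 (volume : Measure E)}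
    (h : (f : 𝓢'(E, ℂ)) = Laplacian.laplacian (g : 𝓢'(E, ℂ))) :
    ∀ᵐ ξ, (𝓕 f : Lp ℂ 2 (volume : Measure E)) ξ
      = -((‖(2 * Real.pi) • ξ‖ ^ 2 : ℝ) : ℂ) * (𝓕 g : Lp ℂ 2 (volume : Measure E)) ξ := by
  have hloc : ∀ f : Lp ℂ 2 (volume : Measure E), LocallyIntegrable f :=
    fun f => (Lp.memLp f).locallyIntegrable one_le_two
  refine ae_eq_of_integral_contDiff_smul_eq (hloc _) ?_ fun χ hχ hχc => ?_
  · rw [← locallyIntegrableOn_univ]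
    refine (locallyIntegrableOn_univ.2 (hloc _)).continuousOn_mul (Continuous.continuousOn ?_)
      isOpen_univ.isLocallyClosed
    fun_prop
  have hχc' : HasCompactSupport fun x => (χ x : ℂ) := hχc.comp_left (g := fun x : ℝ => (x : ℂ)) rfl
  have hχs' : ContDiff ℝ ∞ fun x => (χ x : ℂ) := Complex.ofRealCLM.contDiff.comp hχ
  have h1 := congrArg (fun T : 𝓢'(E, ℂ) => T (𝓕 (hχc'.toSchwartzMap hχs'))) h
  simp only [TemperedDistribution.laplacian_eq_fourierMultiplierCLM,
    TemperedDistribution.fourierMultiplierCLM_apply] at h1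
  rw [← TemperedDistribution.fourier_apply, Lp.fourier_toTemperedDistribution_eq,
    Lp.fourier_toTemperedDistribution_eq] at h1
  change _ = -(2 * Real.pi) ^ 2 • Lp.toTemperedDistribution (𝓕 g : Lp ℂ 2 (volume : Measure E))
    (SchwartzMap.smulLeftCLM ℂ (fun x : E => Complex.ofReal (‖x‖ ^ 2))
      (𝓕⁻ (𝓕 (hχc'.toSchwartzMap hχs')))) at h1
  rw [FourierTransform.fourierInv_fourier_eq, Lp.toTemperedDistribution_apply,
    Lp.toTemperedDistribution_apply, ← integral_smul] at h1
  refine Eq.trans ?_ (h1.trans ?_)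
  · refine integral_congr_ae (.of_forall fun x => ?_)
    simp
  · refine integral_congr_ae (.of_forall fun x => ?_)
    simp only
    rw [SchwartzMap.smulLeftCLM_apply_apply (by fun_prop)]
    simp only [HasCompactSupport.toSchwartzMap_toFun, smul_eq_mul, norm_smul,
      Complex.real_smul, Real.norm_of_nonneg Real.two_pi_pos.le]
    push_cast
    ring

end CutOff

/-! ### From distributional solutions to a Volterra equation on the Fourier side. -/

section Pairing

variable {X : Type*} [MeasurableSpace X] {μ : Measure X}

/-- Integration against a square integrable function, as a functional on `L²`. -/
noncomputable def integralMulCLM (g : X → ℂ) (hg : MemLp g 2 μ) : Lp ℂ 2 μ →L[ℂ] ℂ :=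
  (ContinuousLinearMap.mul ℂ ℂ).lpPairing μ 2 2 (hg.toLp g)

theorem integralMulCLM_apply {g : X → ℂ} (hg : MemLp g 2 μ) (f : Lp ℂ 2 μ) :
    integralMulCLM g hg f = ∫ x, g x * f x ∂μ := by
  rw [integralMulCLM, ContinuousLinearMap.lpPairing_eq_integral]
  refine integral_congr_ae ?_
  filter_upwards [hg.coeFn_toLp] with x hx
  rw [hx, ContinuousLinearMap.mul_apply']

end Pairing

section Sobolev

variable {n : ℕ} {s : ℝ} {f : EuclideanSpace ℝ (Fin n) → ℂ}

theorem MemHs.memLp (hf : MemHs s f) : MemLp f 2 := by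
  by_contra h
  rw [MemHs, sobolevENorm, dif_neg h] at hf
  exact lt_irrefl _ hf

theorem sobolevENorm_eq (hf : MemLp f 2) : sobolevENorm s f
    = eLpNorm (fun ξ : EuclideanSpace ℝ (Fin n) =>
      (((1 + ‖(2 * Real.pi) • ξ‖ ^ 2) ^ (s / 2) : ℝ) : ℂ) *
        (𝓕 (hf.toLp f) : Lp ℂ 2 (volume : Measure (EuclideanSpace ℝ (Fin n)))) ξ) 2 volume := by
  rw [sobolevENorm, dif_pos hf]

theorem eLpNorm_le_sobolevENorm (hs : 0 ≤ s) : eLpNorm f 2 ≤ sobolevENorm s f := by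
  by_cases hf : MemLp f 2
  swap
  · rw [sobolevENorm, dif_neg hf]
    exact le_top
  rw [sobolevENorm_eq hf]
  have h1 : eLpNorm f 2 = eLpNorm
      (𝓕 (hf.toLp f) : Lp ℂ 2 (volume : Measure (EuclideanSpace ℝ (Fin n)))) 2 volume := by
    rw [← Lp.enorm_def, ← ofReal_norm, Lp.norm_fourier_eq, ofReal_norm, Lp.enorm_toLp]
  rw [h1]
  refine eLpNorm_mono fun ξ => ?_
  rw [norm_mul, Complex.norm_real, Real.norm_of_nonneg (by positivity)]
  refine le_mul_of_one_le_left (norm_nonneg _) (Real.one_le_rpow ?_ (by positivity))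
  linarith [sq_nonneg ‖(2 * Real.pi) • ξ‖]

theorem IsContinuousInHs.exists_continuous_toLp {u : ℝ → EuclideanSpace ℝ (Fin n) → ℂ}
    (hs : 0 ≤ s) (hu : IsContinuousInHs s u) :
    ∃ U : ℝ → Lp ℂ 2 (volume : Measure (EuclideanSpace ℝ (Fin n))), Continuous U ∧
      ∀ t, 0 ≤ t → ∃ h : MemLp (u t) 2, U t = h.toLp (u t) := by
  have hm : ∀ t : ℝ, MemLp (u (max t 0)) 2 := fun t => (hu.1 _ (le_max_right t 0)).memLp
  -- Replacing `t` by `max t 0` extends the curve constantly to negative times, which gives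
  -- continuity on all of `ℝ`.
  refine ⟨fun t => (hm t).toLp _, ?_, fun t ht => ?_⟩
  · refine continuous_iff_continuousAt.2 fun t => tendsto_iff_edist_tendsto_0.2 ?_
    have h1 : Tendsto (fun r : ℝ => max r 0) (𝓝 t) (𝓝[Ici 0] (max t 0)) :=
      tendsto_nhdsWithin_iff.2 ⟨(continuous_id.max continuous_const).tendsto t,
        .of_forall fun r => le_max_right r 0⟩
    refine tendsto_of_tendsto_of_tendsto_of_le_of_le tendsto_const_nhds
      ((hu.2 _ (le_max_right t 0)).comp h1) (fun _ => zero_le) fun r => ?_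
    simp only [Function.comp]
    rw [Lp.edist_toLp_toLp]
    exact eLpNorm_le_sobolevENorm hs
  · have h := max_eq_left ht
    refine ⟨(hu.1 t ht).memLp, ?_⟩
    simp only [h]

end Sobolev

section Weak

variable {n : ℕ} {s a₀ : ℝ} {a : ℝ → ℝ} {u : ℝ → EuclideanSpace ℝ (Fin n) → ℂ}

/-- Test functions of product form `φ(t) ψ(x)` reduce the equation to the scalar weak equation for
the pairings of `u` with `ψ` and with its Laplacian. -/
theorem SolvesInDistributions.integral_eq_add (hu : SolvesInDistributions a₀ a u)
    (ha : IsMemoryKernel a)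
    {U : ℝ → Lp ℂ 2 (volume : Measure (EuclideanSpace ℝ (Fin n)))} (hU : Continuous U)
    (hUu : ∀ t, 0 ≤ t → U t =ᵐ[volume] u t)
    {ψ ψ' : EuclideanSpace ℝ (Fin n) → ℂ} (hψs : ContDiff ℝ ∞ ψ) (hψc : HasCompactSupport ψ)
    (hψ' : ψ' = Laplacian.laplacian ψ) (hψ : MemLp ψ 2) (hψ'2 : MemLp ψ' 2) {t : ℝ} (ht : 0 ≤ t) :
    integralMulCLM ψ hψ (U t) = integralMulCLM ψ hψ (U 0)
      + ∫ r in (0 : ℝ)..t, integralMulCLM ψ' hψ'2 (U r) * (integratedKernel a₀ a (t - r) : ℂ) := by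
  refine eq_add_integral_of_weak ha (y := fun t => integralMulCLM ψ hψ (U t))
    (w := fun t => integralMulCLM ψ' hψ'2 (U t)) (by fun_prop) (by fun_prop)
    (fun φ hφs hφc => ?_) ht
  have hy : ∀ t, 0 ≤ t → integralMulCLM ψ hψ (U t) = ∫ x, u t x * ψ x := fun t ht => by
    rw [integralMulCLM_apply]
    refine integral_congr_ae ?_
    filter_upwards [hUu t ht] with x hx
    rw [hx, mul_comm]
  have hw : ∀ t, 0 ≤ t → integralMulCLM ψ' hψ'2 (U t) = ∫ x, u t x * ψ' x := fun t ht => by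
    rw [integralMulCLM_apply]
    refine integral_congr_ae ?_
    filter_upwards [hUu t ht] with x hx
    rw [hx, mul_comm]
  have hΦs : ContDiff ℝ ∞ fun p : ℝ × EuclideanSpace ℝ (Fin n) => (φ p.1 : ℂ) * ψ p.2 :=
    (Complex.ofRealCLM.contDiff.comp (hφs.comp contDiff_fst)).mul (hψs.comp contDiff_snd)
  have hΦc : HasCompactSupport fun p : ℝ × EuclideanSpace ℝ (Fin n) => (φ p.1 : ℂ) * ψ p.2 := by
    refine HasCompactSupport.intro (hφc.isCompact.prod hψc.isCompact) fun p hp => ?_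
    rw [mem_prod, not_and_or] at hp
    rcases hp with hp | hp
    · rw [image_eq_zero_of_notMem_tsupport hp]
      simp
    · rw [image_eq_zero_of_notMem_tsupport hp, mul_zero]
  have key := hu _ hΦs hΦc
  simp only at key
  have hd : ∀ r x,
      deriv (fun τ : ℝ => (φ τ : ℂ) * ψ x) r = ((deriv φ r : ℝ) : ℂ) * ψ x := fun r x =>
    (((hφs.differentiable (by simp) r).hasDerivAt.ofReal_comp).mul_const (ψ x)).deriv
  have hl : ∀ r x, Laplacian.laplacian (fun y => (φ r : ℂ) * ψ y) x = (φ r : ℂ) * ψ' x :=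
    fun r x => by
      have := InnerProductSpace.laplacian_smul (𝕜 := ℝ) (f := ψ) (x := x) (φ r)
        (hψs.contDiffAt.of_le (by norm_cast))
      rw [hψ']
      simpa [Pi.smul_def] using this
  simp only [hd, hl] at key
  rw [hy 0 le_rfl, ← integral_const_mul]
  refine Eq.trans (congrArg₂ (· + ·) ?_ ?_) key
  · refine setIntegral_congr_fun measurableSet_Ioi fun r hr => ?_
    have hr0 : 0 ≤ r := le_of_lt hr
    simp only
    rw [hy r hr0, hw r hr0]
    have hu2 : MemLp (u r) 2 := (memLp_congr_ae (hUu r hr0)).1 (Lp.memLp _)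
    rw [← integral_const_mul, ← integral_const_mul, ← integral_add]
    · refine integral_congr_ae (.of_forall fun x => ?_)
      have e : ∫ τ in Ioi r, ((a (τ - r) : ℝ) : ℂ) * ((φ τ : ℂ) * ψ' x)
          = (∫ τ in Ioi r, ((a (τ - r) : ℝ) : ℂ) * φ τ) * ψ' x := by
        rw [← integral_mul_const]
        simp only [mul_assoc]
      simp only [e]
      ring
    · exact (hu2.integrable_mul hψ).const_mul _
    · exact (hu2.integrable_mul hψ'2).const_mul _
  · refine integral_congr_ae (.of_forall fun x => ?_)
    simp only
    ring

/-- The Fourier transform of a distributional solution solves a Volterra equation. -/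
theorem IsHsSolution.exists_fourier_volterra {u₀ : EuclideanSpace ℝ (Fin n) → ℂ} (hs : 0 ≤ s)
    (ha : IsMemoryKernel a) (hu : IsHsSolution s a₀ a u₀ u) :
    ∃ W : ℝ → Lp ℂ 2 (volume : Measure (EuclideanSpace ℝ (Fin n))), Continuous W ∧
      (∀ t, 0 ≤ t → ∃ h : MemLp (u t) 2, W t = 𝓕 (h.toLp (u t))) ∧
      ∀ t, 0 ≤ t → ∀ᵐ ξ, W t ξ = W 0 ξ - ((‖(2 * Real.pi) • ξ‖ ^ 2 : ℝ) : ℂ)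
        * (∫ r in (0 : ℝ)..t, (integratedKernel a₀ a (t - r) : ℂ) • W r :
          Lp ℂ 2 (volume : Measure (EuclideanSpace ℝ (Fin n)))) ξ := by
  obtain ⟨U, hU, hUu⟩ := hu.continuousInHs.exists_continuous_toLp hs
  let Φ := (Lp.fourierTransformₗᵢ (EuclideanSpace ℝ (Fin n)) ℂ).toContinuousLinearEquiv
    |>.toContinuousLinearMap
  have hΦ : ∀ f, Φ f = 𝓕 f := fun f => rfl
  refine ⟨fun t => Φ (U t), by fun_prop, fun t ht => ?_, fun t ht => ?_⟩
  · obtain ⟨h, e⟩ := hUu t ht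
    exact ⟨h, (hΦ _).trans (by rw [e])⟩
  have hAi : IntervalIntegrable (fun r => (integratedKernel a₀ a (t - r) : ℂ) • U r)
      volume 0 t := by
    refine (ContinuousOn.fun_smul ?_ hU.continuousOn).intervalIntegrable
    refine Complex.continuous_ofReal.comp_continuousOn
      ((ha.continuousOn_integratedKernel a₀).comp (by fun_prop) fun r hr => ?_)
    rw [uIcc_of_le ht] at hr
    exact sub_nonneg.2 hr.2
  set V := ∫ r in (0 : ℝ)..t, (integratedKernel a₀ a (t - r) : ℂ) • U r with hV
  have e1 : ∫ r in (0 : ℝ)..t, (integratedKernel a₀ a (t - r) : ℂ) • Φ (U r) = Φ V := by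
    rw [hV, ← Φ.intervalIntegral_comp_comm hAi]
    simp only [map_smul]
  have key := fourier_ae_eq_of_laplacian (f := U t - U 0) (g := V)
    (toTemperedDistribution_eq_laplacian fun ψ hψs hψc => ?_)
  · rw [e1]
    have e2 : Φ (U t) = (𝓕 (U t - U 0) : Lp ℂ 2 (volume : Measure (EuclideanSpace ℝ (Fin n))))
        + Φ (U 0) := by
      rw [← hΦ, map_sub, sub_add_cancel]
    simp only [e2]
    filter_upwards [key, Lp.coeFn_add
      (𝓕 (U t - U 0) : Lp ℂ 2 (volume : Measure (EuclideanSpace ℝ (Fin n)))) (Φ (U 0))]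
      with ξ h1 h2
    rw [h2, Pi.add_apply, h1, hΦ V]
    ring
  · have hψ : MemLp ψ 2 volume := (hψc.toSchwartzMap hψs).memLp 2 volume
    have hψ' : MemLp (Laplacian.laplacian ψ) 2 volume := by
      have := (Laplacian.laplacian (hψc.toSchwartzMap hψs)).memLp 2 volume
      rwa [funext (SchwartzMap.laplacian_apply _)] at this
    have h1 := hu.solves.integral_eq_add ha hU (fun t ht => ?_) hψs hψc rfl hψ hψ' ht
    · have e3 := integralMulCLM_apply hψ (U t - U 0)
      have e4 := integralMulCLM_apply hψ' V
      refine e3.symm.trans (Eq.trans ?_ e4)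
      rw [map_sub, h1, add_sub_cancel_left, hV,
        ← ContinuousLinearMap.intervalIntegral_comp_comm _ hAi]
      simp only [map_smul, smul_eq_mul, mul_comm]
    · obtain ⟨h, e⟩ := hUu t ht
      rw [e]
      exact h.coeFn_toLp

end Weak

/-! ### Volterra equations in `L²` with a bounded multiplier. -/

/-- The integral form of Grönwall's inequality. -/
theorem le_mul_exp_of_le_add_integral {f : ℝ → ℝ} {δ K : ℝ} (hf : Continuous f)
    (hf0 : ∀ t, 0 ≤ f t) (hK : 0 ≤ K)
    (h : ∀ t, 0 ≤ t → f t ≤ δ + K * ∫ r in (0 : ℝ)..t, f r) {t : ℝ} (ht : 0 ≤ t) :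
    f t ≤ δ * Real.exp (K * t) := by
  let g : ℝ → ℝ := fun t => δ + K * ∫ r in (0 : ℝ)..t, f r
  have hg : ∀ t, HasDerivAt g (K * f t) t := fun t =>
    ((hf.integral_hasStrictDerivAt 0 t).hasDerivAt.const_mul K).const_add δ
  have hg0 : g 0 = δ := by simp [g]
  have := norm_le_gronwallBound_of_norm_deriv_right_le (f := g) (f' := fun t => K * f t) (δ := δ)
    (K := K) (ε := 0) (a := 0) (b := t) (fun t _ => (hg t).continuousAt.continuousWithinAt)
    (fun t _ => (hg t).hasDerivWithinAt)
    (by rw [hg0, Real.norm_of_nonneg ((hf0 0).trans (by simpa using h 0 le_rfl))])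
    (fun r hr => by
      have h1 := h r hr.1
      rw [Real.norm_of_nonneg (mul_nonneg hK (hf0 r)), add_zero]
      exact mul_le_mul_of_nonneg_left (h1.trans (le_abs_self _)) hK) t ⟨ht, le_rfl⟩
  rw [gronwallBound_ε0, sub_zero] at this
  exact (h t ht).trans ((le_abs_self _).trans this)

section Volterra

variable {X : Type*} [MeasurableSpace X] {μ : Measure X} {a : ℝ → ℝ} {a₀ N : ℝ} {ρ : X → ℝ}
  {W : ℝ → Lp ℂ 2 μ}

theorem IsMemoryKernel.intervalIntegrable_smul (ha : IsMemoryKernel a) (a₀ : ℝ)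
    {H : Type*} [NormedAddCommGroup H] [NormedSpace ℂ H] {W : ℝ → H}
    (hW : Continuous W) {t : ℝ} (ht : 0 ≤ t) :
    IntervalIntegrable (fun r => (integratedKernel a₀ a (t - r) : ℂ) • W r) volume 0 t := by
  refine (ContinuousOn.fun_smul ?_ hW.continuousOn).intervalIntegrable
  refine Complex.continuous_ofReal.comp_continuousOn
    ((ha.continuousOn_integratedKernel a₀).comp (by fun_prop) fun r hr => ?_)
  rw [uIcc_of_le ht] at hr
  exact sub_nonneg.2 hr.2

/-- Grönwall is applied to `e^{-t} ‖W t‖`, the weight absorbing the growth `C e^t` of `A`.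
Boundedness of the multiplier is essential, which is why frequencies are truncated later. -/
theorem exists_norm_le_exp_of_volterra (ha : IsMemoryKernel a) (hρ0 : ∀ x, 0 ≤ ρ x)
    (hρN : ∀ x, ρ x ≤ N) (hN : 0 ≤ N) (hW : Continuous W)
    (h : ∀ t, 0 ≤ t → ∀ᵐ x ∂μ, W t x = W 0 x
      - (ρ x : ℂ) * (∫ r in (0 : ℝ)..t, (integratedKernel a₀ a (t - r) : ℂ) • W r : Lp ℂ 2 μ) x) :
    ∃ K : ℝ, 1 ≤ K ∧ ∀ t, 0 ≤ t → ‖W t‖ ≤ ‖W 0‖ * Real.exp (K * t) := by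
  obtain ⟨C, hC0, hC⟩ := ha.exists_abs_integratedKernel_le a₀
  refine ⟨N * C + 1, by nlinarith [mul_nonneg hN hC0], fun t ht => ?_⟩
  have key := le_mul_exp_of_le_add_integral (f := fun t => Real.exp (-t) * ‖W t‖) (δ := ‖W 0‖)
    (K := N * C) (by fun_prop) (fun t => by positivity) (by positivity) (fun t ht => ?_) ht
  · calc ‖W t‖ = Real.exp t * (Real.exp (-t) * ‖W t‖) := by
          rw [← mul_assoc, ← Real.exp_add, add_neg_cancel, Real.exp_zero, one_mul]
      _ ≤ Real.exp t * (‖W 0‖ * Real.exp (N * C * t)) := by gcongr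
      _ = ‖W 0‖ * Real.exp ((N * C + 1) * t) := by
          rw [add_mul, Real.exp_add, one_mul]
          ring
  · set V : Lp ℂ 2 μ := ∫ r in (0 : ℝ)..t, (integratedKernel a₀ a (t - r) : ℂ) • W r with hV
    have h1 : ‖W t - W 0‖ ≤ N * ‖V‖ := by
      refine Lp.norm_le_mul_norm_of_ae_le_mul ?_
      filter_upwards [h t ht, Lp.coeFn_sub (W t) (W 0)] with x h1 h2
      rw [h2, Pi.sub_apply, h1, sub_sub_cancel_left, norm_neg, norm_mul, Complex.norm_real,
        Real.norm_of_nonneg (hρ0 x)]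
      exact mul_le_mul_of_nonneg_right (hρN x) (norm_nonneg _)
    have h2 : ‖V‖ ≤ ∫ r in (0 : ℝ)..t, C * Real.exp t * (Real.exp (-r) * ‖W r‖) := by
      refine intervalIntegral.norm_integral_le_of_norm_le ht (.of_forall fun r hr => ?_)
        (Continuous.intervalIntegrable (by fun_prop) _ _)
      rw [norm_smul, Complex.norm_real, Real.norm_eq_abs]
      refine (mul_le_mul_of_nonneg_right (hC _ (sub_nonneg.2 hr.2)) (norm_nonneg _)).trans_eq ?_
      rw [sub_eq_add_neg, Real.exp_add]
      ring
    rw [intervalIntegral.integral_const_mul] at h2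
    have h3 : ‖W t‖ ≤ ‖W 0‖ + ‖W t - W 0‖ := by
      simpa using norm_add_le (W 0) (W t - W 0)
    calc Real.exp (-t) * ‖W t‖
        ≤ Real.exp (-t) * (‖W 0‖ + N * (C * Real.exp t
          * ∫ r in (0 : ℝ)..t, Real.exp (-r) * ‖W r‖)) := by
          gcongr
          exact h3.trans (by gcongr; exact h1.trans (by gcongr))
      _ = Real.exp (-t) * ‖W 0‖ + (Real.exp (-t) * Real.exp t) * (N * C
          * ∫ r in (0 : ℝ)..t, Real.exp (-r) * ‖W r‖) := by ring
      _ ≤ _ := by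
          rw [← Real.exp_add, neg_add_cancel, Real.exp_zero, one_mul]
          gcongr
          exact mul_le_of_le_one_left (norm_nonneg _) (Real.exp_le_one_iff.2 (by linarith))

theorem integrable_mul_lp {g : X → ℂ} (hg : MemLp g 2 μ) (f : Lp ℂ 2 μ) :
    Integrable (fun x => g x * f x) μ :=
  hg.integrable_mul (Lp.memLp f)

theorem memLp_ofReal_mul (hρm : Measurable ρ) (hρ0 : ∀ x, 0 ≤ ρ x)
    (hρN : ∀ x, ρ x ≤ N) {χ : X → ℂ} (hχ : MemLp χ 2 μ) :
    MemLp (fun x => (ρ x : ℂ) * χ x) 2 μ := by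
  refine hχ.of_le_mul (c := N)
    ((Complex.measurable_ofReal.comp hρm).aestronglyMeasurable.mul hχ.1) (.of_forall fun x => ?_)
  rw [norm_mul, Complex.norm_real, Real.norm_of_nonneg (hρ0 x)]
  exact mul_le_mul_of_nonneg_right (hρN x) (norm_nonneg _)

theorem integralMulCLM_volterra (ha : IsMemoryKernel a) (hρm : Measurable ρ) (hρ0 : ∀ x, 0 ≤ ρ x)
    (hρN : ∀ x, ρ x ≤ N) (hW : Continuous W)
    (h : ∀ t, 0 ≤ t → ∀ᵐ x ∂μ, W t x = W 0 x
      - (ρ x : ℂ) * (∫ r in (0 : ℝ)..t, (integratedKernel a₀ a (t - r) : ℂ) • W r : Lp ℂ 2 μ) x)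
    {χ : X → ℂ} (hχ : MemLp χ 2 μ) {t : ℝ} (ht : 0 ≤ t) :
    integralMulCLM χ hχ (W t) + ∫ r in (0 : ℝ)..t,
        integralMulCLM _ (memLp_ofReal_mul hρm hρ0 hρN hχ) (W r)
          * (integratedKernel a₀ a (t - r) : ℂ) = integralMulCLM χ hχ (W 0) := by
  set V : Lp ℂ 2 μ := ∫ r in (0 : ℝ)..t, (integratedKernel a₀ a (t - r) : ℂ) • W r with hV
  have hρχ := memLp_ofReal_mul hρm hρ0 hρN hχ
  have e1 : ∫ r in (0 : ℝ)..t, integralMulCLM _ hρχ (W r) * (integratedKernel a₀ a (t - r) : ℂ)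
      = integralMulCLM _ hρχ V := by
    rw [hV, ← ContinuousLinearMap.intervalIntegral_comp_comm _
      (ha.intervalIntegrable_smul a₀ hW ht)]
    simp only [map_smul, smul_eq_mul, mul_comm]
  rw [e1, integralMulCLM_apply, integralMulCLM_apply, integralMulCLM_apply,
    ← integral_add (integrable_mul_lp hχ _) (integrable_mul_lp hρχ _)]
  refine integral_congr_ae ?_
  filter_upwards [h t ht] with x hx
  rw [hx]
  ring

theorem complexLaplace_const_mul (c : ℂ) (f : ℝ → ℂ) (z : ℂ) :
    complexLaplace (fun t => c * f t) z = c * complexLaplace f z := by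
  simp only [complexLaplace, ← integral_const_mul]
  refine integral_congr_ae (.of_forall fun t => ?_)
  simp only
  ring

theorem LaplaceConverges.const_mul (c : ℂ) {f : ℝ → ℂ} {z : ℂ} (hf : LaplaceConverges f z) :
    LaplaceConverges (fun t => c * f t) z :=
  (Integrable.const_mul hf c).congr (.of_forall fun _ => mul_left_comm _ _ _)

theorem complexLaplace_congr {f g : ℝ → ℂ} (h : ∀ t, 0 < t → f t = g t) (z : ℂ) :
    complexLaplace f z = complexLaplace g z :=
  setIntegral_congr_fun measurableSet_Ioi fun t ht => by simp only [h t ht]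

theorem norm_clm_le_exp (ℓ : Lp ℂ 2 μ →L[ℂ] ℂ) {C K : ℝ}
    (hWb : ∀ t, 0 ≤ t → ‖W t‖ ≤ C * Real.exp (K * t)) (t : ℝ) (ht : 0 < t) :
    ‖ℓ (W t)‖ ≤ (‖ℓ‖ * C) * Real.exp (K * t) := by
  refine (ℓ.le_opNorm _).trans ?_
  rw [mul_assoc]
  exact mul_le_mul_of_nonneg_left (hWb t ht.le) (norm_nonneg _)

variable {G : ℂ → ℂ} {β M L C K : ℝ}

theorem IsPassiveSymbol.one_le_norm_resolventSymbol (hG : IsPassiveSymbol G β M L) {r : ℝ}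
    (hr : 0 ≤ r) {z : ℂ} (hz : 1 ≤ z.re) : 1 ≤ ‖resolventSymbol G r z‖ :=
  hz.trans ((hG.re_le_re_resolventSymbol hr (by linarith [hG.pos])).trans (Complex.re_le_norm _))

theorem IsPassiveSymbol.measurable_resolventSymbol (hρm : Measurable ρ) (z : ℂ) :
    Measurable fun x => resolventSymbol G (ρ x) z := by
  unfold resolventSymbol
  fun_prop

/-- The Volterra equation holds for almost every `x` separately at each `t`, so it is not
transformed pointwise. Instead it is paired with `χ / D(·, z)`: writing `χ = z χ/D + G ρ χ/D` makes
the transformed equation yield the pairing with `χ` directly. -/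
theorem complexLaplace_integralMulCLM (ha : IsMemoryKernel a) (hG : IsPassiveSymbol G β M L)
    (hGa : ∀ z : ℂ, 0 < z.re → G z = a₀ + laplaceTransform a z)
    (hρm : Measurable ρ) (hρ0 : ∀ x, 0 ≤ ρ x) (hρN : ∀ x, ρ x ≤ N) (hW : Continuous W)
    (h : ∀ t, 0 ≤ t → ∀ᵐ x ∂μ, W t x = W 0 x
      - (ρ x : ℂ) * (∫ r in (0 : ℝ)..t, (integratedKernel a₀ a (t - r) : ℂ) • W r : Lp ℂ 2 μ) x)
    (hK : 1 ≤ K) (hWb : ∀ t, 0 ≤ t → ‖W t‖ ≤ C * Real.exp (K * t))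
    {χ : X → ℂ} (hχ : MemLp χ 2 μ) {z : ℂ} (hz : K < z.re) :
    complexLaplace (fun t => integralMulCLM χ hχ (W t)) z
      = ∫ x, χ x * W 0 x / resolventSymbol G (ρ x) z ∂μ := by
  have hz0 : 0 < z.re := by linarith
  have hzn : z ≠ 0 := fun h => by simp [h] at hz0
  have hD := fun x => hG.one_le_norm_resolventSymbol (hρ0 x) (hK.trans hz.le)
  have hχ' : MemLp (fun x => χ x / resolventSymbol G (ρ x) z) 2 μ := by
    refine hχ.mono (hχ.1.mul
      (IsPassiveSymbol.measurable_resolventSymbol hρm z).inv.aestronglyMeasurable)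
      (.of_forall fun x => ?_)
    rw [norm_div]
    exact div_le_self (norm_nonneg _) (hD x)
  have hρχ' := memLp_ofReal_mul hρm hρ0 hρN hχ'
  have e1 : ∀ f : Lp ℂ 2 μ, integralMulCLM χ hχ f
      = z * integralMulCLM _ hχ' f + G z * integralMulCLM _ hρχ' f := fun f => by
    rw [integralMulCLM_apply, integralMulCLM_apply, integralMulCLM_apply, ← integral_const_mul,
      ← integral_const_mul, ← integral_add ((integrable_mul_lp hχ' f).const_mul _)
      ((integrable_mul_lp hρχ' f).const_mul _)]
    refine integral_congr_ae (.of_forall fun x => ?_)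
    have h0 : resolventSymbol G (ρ x) z ≠ 0 := norm_pos_iff.1 (one_pos.trans_le (hD x))
    have h1 : χ x = (z + ρ x * G z) * (χ x / resolventSymbol G (ρ x) z) := by
      rw [mul_div_assoc']
      exact (mul_div_cancel_left₀ _ h0).symm
    simp only
    nth_rewrite 1 [h1]
    ring
  have hc : ∀ ℓ : Lp ℂ 2 μ →L[ℂ] ℂ, LaplaceConverges (fun t => ℓ (W t)) z := fun ℓ =>
    .of_exp_bound (Continuous.aestronglyMeasurable (by fun_prop)) (norm_clm_le_exp ℓ hWb) hz
  have hA := ha.laplaceConverges_integratedKernel a₀ hz0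
  have e2 := complexLaplace_congr (fun t ht => integralMulCLM_volterra ha hρm hρ0 hρN hW h hχ'
    (le_of_lt ht)) z
  rw [complexLaplace_add (hc _) (laplaceConverges_convolution (hc _) hA),
    complexLaplace_convolution (hc _) hA, complexLaplace_const _ hz0,
    ha.complexLaplace_integratedKernel a₀ hz0, ← hGa z hz0] at e2
  simp only [e1]
  rw [complexLaplace_add ((hc _).const_mul _) ((hc _).const_mul _), complexLaplace_const_mul,
    complexLaplace_const_mul]
  have alg : ∀ p q g c : ℂ, p + q * (g / z) = c / z → z * p + g * q = c := by
    intro p q g c h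
    field_simp at h
    linear_combination h
  have e3 := integralMulCLM_apply hχ' (W 0)
  have e4 : ∫ x, χ x * W 0 x / resolventSymbol G (ρ x) z ∂μ
      = integralMulCLM _ hχ' (W 0) := by
    rw [e3]
    refine integral_congr_ae (.of_forall fun x => ?_)
    simp only
    ring
  rw [e4]
  exact alg _ _ _ _ e2

end Volterra

/-! ### Identification of the Volterra solution with the scalar resolvent. -/

section Resolvent

variable {X : Type*} [MeasurableSpace X] {μ : Measure X} {a : ℝ → ℝ} {a₀ N : ℝ} {ρ : X → ℝ}
  {W : ℝ → Lp ℂ 2 μ} {G : ℂ → ℂ} {β M L C K : ℝ}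

/-- Differentiation in `z` turns `1/D` into `-D'/D²`, the integrable expression that defines the
resolvent. -/
theorem IsPassiveSymbol.hasDerivAt_integral_div_resolventSymbol (hG : IsPassiveSymbol G β M L)
    (hρm : Measurable ρ) (hρ0 : ∀ x, 0 ≤ ρ x) (hρN : ∀ x, ρ x ≤ N) {g : X → ℂ}
    (hg : Integrable g μ) {z : ℂ} (hz : 1 < z.re) :
    HasDerivAt (fun z => ∫ x, g x / resolventSymbol G (ρ x) z ∂μ)
      (∫ x, -(g x * ((1 + ρ x * deriv G z) / resolventSymbol G (ρ x) z ^ 2)) ∂μ) z := by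
  have hD : ∀ x, ∀ w : ℂ, 1 < w.re → 1 ≤ ‖resolventSymbol G (ρ x) w‖ := fun x w hw =>
    hG.one_le_norm_resolventSymbol (hρ0 x) hw.le
  have hL := hG.L_nonneg
  have hbd : ∀ x, ∀ w : ℂ, 1 < w.re →
      ‖(1 + ρ x * deriv G w) / resolventSymbol G (ρ x) w ^ 2‖ ≤ 1 + N * L := fun x w hw => by
    rw [norm_div, norm_pow]
    refine (div_le_self (norm_nonneg _) (one_le_pow₀ (hD x w hw))).trans ?_
    refine (hG.norm_one_add_le (hρ0 x) (by linarith [hG.pos])).trans ?_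
    have := hρN x
    gcongr
  have hs : {w : ℂ | 1 < w.re} ∈ 𝓝 z :=
    (isOpen_lt continuous_const Complex.continuous_re).mem_nhds hz
  have hm := fun w : ℂ => IsPassiveSymbol.measurable_resolventSymbol (G := G) hρm w
  refine (hasDerivAt_integral_of_dominated_loc_of_deriv_le (bound := fun x => ‖g x‖ * (1 + N * L))
    (F' := fun w x => -(g x * ((1 + ρ x * deriv G w) / resolventSymbol G (ρ x) w ^ 2)))
    hs (.of_forall fun w => ?_) ?_ ?_ (.of_forall fun x w hw => ?_) (hg.norm.mul_const _)
    (.of_forall fun x w hw => ?_)).2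
  · exact (hg.1.mul (hm w).inv.aestronglyMeasurable)
  · refine hg.mono (hg.1.mul (hm z).inv.aestronglyMeasurable) (.of_forall fun x => ?_)
    rw [norm_div]
    exact div_le_self (norm_nonneg _) (hD x z hz)
  · refine (hg.1.mul (Measurable.aestronglyMeasurable ?_)).neg
    exact Measurable.div (by fun_prop) ((hm z).pow_const 2)
  · rw [norm_neg, norm_mul]
    exact mul_le_mul_of_nonneg_left (hbd x w hw) (norm_nonneg _)
  · have hw' : 1 < w.re := hw
    have h1 : HasDerivAt (resolventSymbol G (ρ x)) (1 + ρ x * deriv G w) w :=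
      (hasDerivAt_id w).add ((hG.differentiableAt (by linarith [hG.pos])).hasDerivAt.const_mul _)
    have h0 : resolventSymbol G (ρ x) w ≠ 0 := norm_pos_iff.1 (one_pos.trans_le (hD x w hw'))
    refine ((h1.inv h0).const_mul (g x)).congr_deriv ?_
    ring

theorem IsPassiveSymbol.norm_resolventIntegrand_le_of_le (hG : IsPassiveSymbol G β M L)
    {r σ t : ℝ} (hr0 : 0 ≤ r) (hrN : r ≤ N) (hσ : 1 ≤ σ) (y : ℝ) :
    ‖resolventIntegrand G r t (σ + y * Complex.I)‖
      ≤ Real.exp (σ * t) * ((1 + N * L) * (1 + (1 + N * M) ^ 2)) * (1 + y ^ 2)⁻¹ := by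
  set z : ℂ := σ + y * Complex.I with hz
  have hre : z.re = σ := by simp [hz]
  have him : z.im = y := by simp [hz]
  have hβ : -β < z.re := by linarith [hG.pos]
  have hL := hG.L_nonneg
  have hM := hG.M_nonneg
  have hN : 0 ≤ N := hr0.trans hrN
  have h1 := hG.one_le_norm_resolventSymbol hr0 (z := z) (by linarith)
  have h2 := hG.norm_resolventSymbol_ge hr0 hβ
  have h3 := Complex.abs_im_le_norm z
  have h4 := hG.norm_one_add_le hr0 hβ
  set D := ‖resolventSymbol G r z‖
  have h5 : |y| ≤ D * (1 + N * M) := by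
    rw [him] at h3
    have : r * M ≤ N * M := by gcongr
    nlinarith [mul_nonneg hN hM]
  have h6 : 1 + y ^ 2 ≤ D ^ 2 * (1 + (1 + N * M) ^ 2) := by
    have : y ^ 2 ≤ (D * (1 + N * M)) ^ 2 := by
      rw [← sq_abs]
      gcongr
    have : 1 ≤ D ^ 2 := one_le_pow₀ h1
    nlinarith
  rw [norm_resolventIntegrand, hre, mul_assoc]
  gcongr
  rw [div_le_iff₀ (by positivity)]
  refine h4.trans ?_
  have h7 : 1 ≤ (1 + (1 + N * M) ^ 2) / (1 + y ^ 2) * D ^ 2 := by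
    rw [div_mul_eq_mul_div, one_le_div (by positivity)]
    linarith
  have h8 : 1 + r * L ≤ 1 + N * L := by gcongr
  calc 1 + r * L ≤ (1 + N * L) * 1 := by linarith
    _ ≤ (1 + N * L) * ((1 + (1 + N * M) ^ 2) / (1 + y ^ 2) * D ^ 2) := by gcongr
    _ = _ := by ring

theorem IsPassiveSymbol.measurable_resolventIntegrand (hG : IsPassiveSymbol G β M L)
    (hρm : Measurable ρ) {σ t : ℝ} (hσ : 0 ≤ σ) :
    Measurable fun p : X × ℝ => resolventIntegrand G (ρ p.1) t (σ + p.2 * Complex.I) := by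
  have h1 : Measurable fun y : ℝ => G (σ + y * Complex.I) :=
    (continuous_vertical fun z hz =>
      (hG.differentiableAt (by rw [hz]; linarith [hG.pos])).continuousAt).measurable
  have h2 : Measurable fun y : ℝ => deriv G (σ + y * Complex.I) :=
    (continuous_vertical fun z hz =>
      (hG.differentiableAt_deriv (by rw [hz]; linarith [hG.pos])).continuousAt).measurable
  have h3 : Measurable fun p : X × ℝ => G (σ + p.2 * Complex.I) := h1.comp measurable_snd
  have h4 : Measurable fun p : X × ℝ => deriv G (σ + p.2 * Complex.I) := h2.comp measurable_snd
  have h5 : Measurable fun p : X × ℝ => (ρ p.1 : ℂ) :=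
    Complex.measurable_ofReal.comp (hρm.comp measurable_fst)
  unfold resolventIntegrand resolventSymbol
  have h6 : Measurable fun p : X × ℝ => (σ : ℂ) + p.2 * Complex.I := by fun_prop
  exact Measurable.mul (by fun_prop) (Measurable.div ((h5.mul h4).const_add 1)
    ((h6.add (h5.mul h3)).pow_const 2))

theorem IsPassiveSymbol.measurable_resolventKernel (hG : IsPassiveSymbol G β M L)
    (hρm : Measurable ρ) (t : ℝ) : Measurable fun x => resolventKernel G (ρ x) t := by
  have h1 : Measurable fun x => ∫ y : ℝ, resolventIntegrand G (ρ x) t ((1 : ℝ) + y * Complex.I) :=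
    (hG.measurable_resolventIntegrand hρm zero_le_one).stronglyMeasurable.integral_prod_right
      |>.measurable
  exact h1.const_smul (2 * Real.pi * t : ℝ)⁻¹

theorem IsPassiveSymbol.exists_norm_resolventKernel_le (hG : IsPassiveSymbol G β M L) (N t : ℝ) :
    ∃ B, ∀ r, 0 ≤ r → r ≤ N → ‖resolventKernel G r t‖ ≤ B :=
  ⟨_, fun r hr0 hrN => by
    rw [resolventKernel, norm_smul]
    exact mul_le_mul_of_nonneg_left (norm_integral_le_of_norm_le
      (integrable_inv_one_add_sq.const_mul _) (.of_forall fun y =>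
        hG.norm_resolventIntegrand_le_of_le hr0 hrN le_rfl y)) (norm_nonneg _)⟩

/-- `t R(ρ, t)` is the inverse Laplace transform of `D' / D²` along any vertical line to the
right. -/
theorem IsPassiveSymbol.integral_exp_mul_eq (hG : IsPassiveSymbol G β M L) {r σ t : ℝ}
    (hr : 0 ≤ r) (hσ : 0 < σ) (ht : 0 < t) :
    (2 * Real.pi : ℝ)⁻¹ • ∫ y : ℝ, resolventIntegrand G r t (σ + y * Complex.I)
      = t * resolventKernel G r t := by
  rw [hG.resolventKernel_eq hr ht.le (x := σ) (by linarith [hG.pos])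
    fun z hz => hG.resolventSymbol_ne_zero hr (by linarith), Complex.real_smul, Complex.real_smul]
  have : (t : ℂ) ≠ 0 := by exact_mod_cast ht.ne'
  generalize ∫ y : ℝ, resolventIntegrand G r t (σ + y * Complex.I) = J
  push_cast
  field_simp

/-- Multiplication by `t` corresponds to minus the derivative of the transform, so `t` times the
pairing has transform `∫ g D'/D²`. Inversion and Fubini then exhibit `t R(ρ, t)` under the integral
over `x`. -/
theorem integral_mul_eq_integral_resolventKernel [SFinite μ] (ha : IsMemoryKernel a)
    (hG : IsPassiveSymbol G β M L)
    (hGa : ∀ z : ℂ, 0 < z.re → G z = a₀ + laplaceTransform a z)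
    (hρm : Measurable ρ) (hρ0 : ∀ x, 0 ≤ ρ x) (hρN : ∀ x, ρ x ≤ N) (hW : Continuous W)
    (h : ∀ t, 0 ≤ t → ∀ᵐ x ∂μ, W t x = W 0 x
      - (ρ x : ℂ) * (∫ r in (0 : ℝ)..t, (integratedKernel a₀ a (t - r) : ℂ) • W r : Lp ℂ 2 μ) x)
    (hK : 1 ≤ K) (hWb : ∀ t, 0 ≤ t → ‖W t‖ ≤ C * Real.exp (K * t))
    {χ : X → ℂ} (hχ : MemLp χ 2 μ) {t : ℝ} (ht : 0 < t) :
    ∫ x, χ x * W t x ∂μ = ∫ x, χ x * (W 0 x * resolventKernel G (ρ x) t) ∂μ := by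
  set ℓ := integralMulCLM χ hχ with hℓ
  set g : X → ℂ := fun x => χ x * W 0 x with hg
  have hgi : Integrable g μ := integrable_mul_lp hχ _
  have hlap : ∀ z : ℂ, K < z.re → complexLaplace (fun t => t * ℓ (W t)) z
      = ∫ x, g x * ((1 + ρ x * deriv G z) / resolventSymbol G (ρ x) z ^ 2) ∂μ := by
    intro z hz
    have h1 := hasDerivAt_complexLaplace (f := fun t => ℓ (W t)) (z := z)
      (Continuous.aestronglyMeasurable (by fun_prop)) (norm_clm_le_exp ℓ hWb) hz
    have h2 := hG.hasDerivAt_integral_div_resolventSymbol hρm hρ0 hρN hgi (z := z) (by linarith)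
    have h3 : (fun z => ∫ x, g x / resolventSymbol G (ρ x) z ∂μ)
        =ᶠ[𝓝 z] complexLaplace fun t => ℓ (W t) := by
      filter_upwards [(isOpen_re_gt K).mem_nhds hz] with w hw
      exact (complexLaplace_integralMulCLM ha hG hGa hρm hρ0 hρN hW h hK hWb hχ hw).symm
    have h4 := h1.unique (h2.congr_of_eventuallyEq h3.symm)
    rw [integral_neg] at h4
    exact neg_injective h4
  -- The extra factor `t` raises the exponential rate from `K` to `K + 1`, and the line must lie
  -- strictly to its right.
  set σ : ℝ := K + 2 with hσ
  have hline : ∀ y : ℝ, K < ((σ : ℂ) + y * Complex.I).re := fun y => by simp [hσ]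
  let f : ℝ → ℂ := fun t => (max t 0 : ℝ) * ℓ (W t)
  have hf : Continuous f := by fun_prop
  have hft : ∀ t, 0 < t → f t = t * ℓ (W t) := fun t ht => by
    simp only [f, max_eq_left ht.le]
  have hint : ∀ t : ℝ, Integrable (fun p : X × ℝ =>
      g p.1 * resolventIntegrand G (ρ p.1) t (σ + p.2 * Complex.I)) (μ.prod volume) := by
    intro t
    refine (hgi.norm.mul_prod (integrable_inv_one_add_sq.const_mul
      (Real.exp (σ * t) * ((1 + N * L) * (1 + (1 + N * M) ^ 2))))).mono
      (hgi.1.comp_fst.mul (hG.measurable_resolventIntegrand hρm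
        (by linarith)).aestronglyMeasurable) (.of_forall fun p => ?_)
    rw [norm_mul]
    refine (mul_le_mul_of_nonneg_left (hG.norm_resolventIntegrand_le_of_le (hρ0 p.1) (hρN p.1)
      (by linarith) p.2) (norm_nonneg _)).trans (le_abs_self _)
  have hR0 : ∀ (r : ℝ) (z : ℂ), resolventIntegrand G r 0 z
      = (1 + r * deriv G z) / resolventSymbol G r z ^ 2 := fun r z => by
    simp [resolventIntegrand]
  have hfl : ∀ y : ℝ, complexLaplace f (σ + y * Complex.I)
      = ∫ x, g x * resolventIntegrand G (ρ x) 0 (σ + y * Complex.I) ∂μ := fun y => by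
    rw [complexLaplace_congr hft, hlap _ (hline y)]
    simp only [hR0]
  have hinv := eq_integral_complexLaplace (σ := σ) hf (fun t ht => by simp [f, max_eq_right ht])
    (.of_exp_bound (C := ‖ℓ‖ * C) (K := K + 1) hf.aestronglyMeasurable (fun t ht => ?_)
      (by simp [hσ])) ?_ t
  · rw [hft t ht] at hinv
    have e1 : ∀ y : ℝ, Complex.exp ((σ + y * Complex.I) * t)
        * complexLaplace f (σ + y * Complex.I)
        = ∫ x, g x * resolventIntegrand G (ρ x) t (σ + y * Complex.I) ∂μ := fun y => by
      rw [hfl, ← integral_const_mul]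
      refine integral_congr_ae (.of_forall fun x => ?_)
      simp only [hR0]
      rw [resolventIntegrand]
      ring
    simp only [e1] at hinv
    rw [← integral_integral_swap (hint t), ← integral_smul] at hinv
    have e2 : ∀ x, (2 * Real.pi : ℝ)⁻¹ • ∫ y : ℝ, g x * resolventIntegrand G (ρ x) t
        (σ + y * Complex.I) = t * (χ x * (W 0 x * resolventKernel G (ρ x) t)) := fun x => by
      rw [integral_const_mul, ← mul_smul_comm, hG.integral_exp_mul_eq (hρ0 x) (by linarith) ht]
      simp only [hg]
      ring
    simp only [e2] at hinv
    rw [integral_const_mul, hℓ, integralMulCLM_apply] at hinv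
    exact mul_left_cancel₀ (by exact_mod_cast ht.ne') hinv
  · rw [hft t ht, norm_mul, Complex.norm_real, Real.norm_of_nonneg ht.le, add_mul, one_mul,
      Real.exp_add]
    have h1 := norm_clm_le_exp ℓ hWb t ht
    have h2 : t ≤ Real.exp t := by linarith [Real.add_one_le_exp t]
    calc t * ‖ℓ (W t)‖ ≤ Real.exp t * (‖ℓ‖ * C * Real.exp (K * t)) := by gcongr
      _ = _ := by ring
  · simp only [hfl]
    exact (hint 0).integral_prod_right

/-- The solution of the Volterra equation with multiplier `ρ`. -/
theorem ae_eq_mul_resolventKernel_of_volterra [SFinite μ] (ha : IsMemoryKernel a)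
    (hG : IsPassiveSymbol G β M L)
    (hGa : ∀ z : ℂ, 0 < z.re → G z = a₀ + laplaceTransform a z)
    (hρm : Measurable ρ) (hρ0 : ∀ x, 0 ≤ ρ x) (hρN : ∀ x, ρ x ≤ N) (hN : 0 ≤ N)
    (hW : Continuous W)
    (h : ∀ t, 0 ≤ t → ∀ᵐ x ∂μ, W t x = W 0 x
      - (ρ x : ℂ) * (∫ r in (0 : ℝ)..t, (integratedKernel a₀ a (t - r) : ℂ) • W r : Lp ℂ 2 μ) x)
    {t : ℝ} (ht : 0 < t) :
    ∀ᵐ x ∂μ, W t x = W 0 x * resolventKernel G (ρ x) t := by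
  obtain ⟨K, hK, hWb⟩ := exists_norm_le_exp_of_volterra ha hρ0 hρN hN hW h
  have hRm := hG.measurable_resolventKernel hρm t
  obtain ⟨B, hB⟩ := hG.exists_norm_resolventKernel_le N t
  have hWR : MemLp (fun x => W 0 x * resolventKernel G (ρ x) t) 2 μ := by
    refine (Lp.memLp (W 0)).of_le_mul (c := B) ((Lp.aestronglyMeasurable _).mul
      hRm.aestronglyMeasurable) (.of_forall fun x => ?_)
    rw [norm_mul, mul_comm]
    exact mul_le_mul_of_nonneg_right (hB _ (hρ0 x) (hρN x)) (norm_nonneg _)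
  set d : X → ℂ := fun x => W t x - W 0 x * resolventKernel G (ρ x) t with hd
  have hdm : MemLp d 2 μ := (Lp.memLp (W t)).sub hWR
  -- Testing with the conjugate of the difference itself turns the weak identity into `∫ |d|² = 0`.
  have hχ : MemLp (fun x => starRingEnd ℂ (d x)) 2 μ := hdm.star
  have key := integral_mul_eq_integral_resolventKernel ha hG hGa hρm hρ0 hρN hW h hK
    hWb hχ ht
  have h1 : ∫ x, ((‖d x‖ ^ 2 : ℝ) : ℂ) ∂μ = 0 := by
    have hi : Integrable (fun x => starRingEnd ℂ (d x) * (W 0 x * resolventKernel G (ρ x) t)) μ :=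
      hχ.integrable_mul hWR
    rw [← sub_eq_zero, ← integral_sub (integrable_mul_lp hχ _) hi] at key
    refine (integral_congr_ae (.of_forall fun x => ?_)).trans key
    rw [← mul_sub, Complex.ofReal_pow, ← Complex.conj_mul']
  rw [integral_complex_ofReal, Complex.ofReal_eq_zero,
    integral_eq_zero_iff_of_nonneg (fun x => by positivity)
      ((memLp_two_iff_integrable_sq_norm hdm.1).1 hdm)] at h1
  filter_upwards [h1] with x hx
  have : ‖d x‖ = 0 := by simpa using hx
  exact sub_eq_zero.1 (norm_eq_zero.1 this)

end Resolvent

/-! ### The Fourier transform on `L¹ ∩ L²` and under dilations. -/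

section Fourier

open scoped SchwartzMap

variable {E : Type*} [NormedAddCommGroup E] [InnerProductSpace ℝ E] [FiniteDimensional ℝ E]
  [MeasurableSpace E] [BorelSpace E]

theorem integral_mul_fourier_lp (χ : 𝓢(E, ℂ)) (f : Lp ℂ 2 (volume : Measure E)) :
    ∫ x, χ x * (𝓕 f : Lp ℂ 2 (volume : Measure E)) x = ∫ x, (𝓕 χ) x * f x := by
  have h := congrArg (fun T : 𝓢'(E, ℂ) => T χ) (Lp.fourier_toTemperedDistribution_eq f)
  simp only [TemperedDistribution.fourier_apply, Lp.toTemperedDistribution_apply,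
    smul_eq_mul] at h
  exact h.symm

/-- The Fourier transform of a square integrable function is determined by pairing with test
functions. -/
theorem fourier_lp_ae_eq {f : Lp ℂ 2 (volume : Measure E)} {g : E → ℂ} (hg : LocallyIntegrable g)
    (h : ∀ χ : 𝓢(E, ℂ), HasCompactSupport χ → ∫ x, (𝓕 χ) x * f x = ∫ x, χ x * g x) :
    (𝓕 f : Lp ℂ 2 (volume : Measure E)) =ᵐ[volume] g := by
  refine ae_eq_of_integral_contDiff_smul_eq ((Lp.memLp _).locallyIntegrable one_le_two) hg
    fun χ hχ hχc => ?_
  have hχc' : HasCompactSupport fun x => (χ x : ℂ) := hχc.comp_left (g := fun x : ℝ => (x : ℂ)) rfl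
  have hχs' : ContDiff ℝ ∞ fun x => (χ x : ℂ) := Complex.ofRealCLM.contDiff.comp hχ
  have h1 := h (hχc'.toSchwartzMap hχs') hχc'
  rw [← integral_mul_fourier_lp] at h1
  simp only [Complex.real_smul]
  exact h1

/-- On `L¹ ∩ L²` the `L²`-Fourier transform is given by the Fourier integral. -/
theorem fourier_toLp_ae_eq {f : E → ℂ} (hf : Integrable f) (hf2 : MemLp f 2) :
    (𝓕 (hf2.toLp f) : Lp ℂ 2 (volume : Measure E)) =ᵐ[volume] 𝓕 f := by
  have hc : Continuous (𝓕 f) :=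
    VectorFourier.fourierIntegral_continuous Real.continuous_fourierChar continuous_inner hf
  refine fourier_lp_ae_eq hc.locallyIntegrable fun χ _ => ?_
  have h1 : ∫ x, (𝓕 χ) x * hf2.toLp f x = ∫ x, (𝓕 χ) x * f x := by
    refine integral_congr_ae ?_
    filter_upwards [hf2.coeFn_toLp] with x hx
    rw [hx]
  rw [h1]
  simpa [SchwartzMap.fourier_coe] using!
    (VectorFourier.integral_fourierIntegral_smul_eq_flip (L := innerₗ E)
      Real.continuous_fourierChar continuous_inner χ.integrable hf)

theorem MeasureTheory.MemLp.comp_smul {f : E → ℂ} {p : ℝ≥0∞} (hf : MemLp f p) {r : ℝ} (hr : r ≠ 0) :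
    MemLp (fun x => f (r • x)) p := by
  refine MemLp.comp_of_map (f := fun x : E => r • x) ?_ (measurable_const_smul r).aemeasurable
  rw [Measure.map_addHaar_smul _ hr]
  exact hf.smul_measure ENNReal.ofReal_ne_top

theorem eLpNorm_two_comp_smul (f : E → ℂ) {r : ℝ} (hr : r ≠ 0) :
    eLpNorm (fun x => f (r • x)) 2
      = ENNReal.ofReal |(r ^ Module.finrank ℝ E)⁻¹| ^ (1 / 2 : ℝ) * eLpNorm f 2 := by
  have h := (Homeomorph.smulOfNeZero r hr : E ≃ₜ E).measurableEmbedding.eLpNorm_map_measure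
    (g := f) (p := 2) (μ := volume)
  refine h.symm.trans ?_
  have h2 : Measure.map (Homeomorph.smulOfNeZero r hr : E ≃ₜ E) volume
      = ENNReal.ofReal |(r ^ Module.finrank ℝ E)⁻¹| • (volume : Measure E) :=
    Measure.map_addHaar_smul _ hr
  rw [h2, eLpNorm_smul_measure_of_ne_top (by simp), smul_eq_mul]
  norm_num

theorem integral_dilation {k : ℝ} (hk : 0 < k) (f : E → ℂ) :
    ∫ x, ((k ^ Module.finrank ℝ E : ℝ) : ℂ) * f (k • x) = ∫ x, f x := by
  have hk0 : (0 : ℝ) < k ^ Module.finrank ℝ E := by positivity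
  rw [integral_const_mul, Measure.integral_comp_smul, abs_of_pos (inv_pos.2 hk0),
    Complex.real_smul, ← mul_assoc, ← Complex.ofReal_mul, mul_inv_cancel₀ hk0.ne',
    Complex.ofReal_one, one_mul]

theorem fourier_dilation {χ : E → ℂ} {k : ℝ} (hk : 0 < k) (ξ : E) :
    𝓕 (fun x => ((k ^ Module.finrank ℝ E : ℝ) : ℂ) * χ (k • x)) ξ = 𝓕 χ (k⁻¹ • ξ) := by
  have hk0 : (0 : ℝ) < k ^ Module.finrank ℝ E := by positivity
  rw [Real.fourier_eq, Real.fourier_eq]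
  have h := Measure.integral_comp_smul (volume : Measure E)
    (fun v => Real.fourierChar (-inner ℝ v (k⁻¹ • ξ)) • χ v) k
  rw [abs_of_pos (inv_pos.2 hk0)] at h
  rw [← one_smul ℝ (∫ v, _ • χ v), ← mul_inv_cancel₀ hk0.ne', mul_smul, ← h, ← integral_smul]
  refine integral_congr_ae (.of_forall fun x => ?_)
  simp only
  rw [inner_smul_left, inner_smul_right, Circle.smul_def, Circle.smul_def, smul_eq_mul,
    smul_eq_mul, Complex.real_smul]
  simp only [conj_trivial, ← mul_assoc, mul_inv_cancel₀ hk.ne', one_mul]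
  ring

/-- The Fourier transform turns the `L¹`-normalised dilation into a dilation. -/
theorem fourier_toLp_dilation {f g : E → ℂ} {k : ℝ} (hk : 0 < k)
    (hfg : g = fun x => ((k ^ Module.finrank ℝ E : ℝ) : ℂ) * f (k • x))
    (hf : MemLp f 2) (hg : MemLp g 2) :
    ∀ᵐ ξ, (𝓕 (hg.toLp g) : Lp ℂ 2 (volume : Measure E)) ξ
      = (𝓕 (hf.toLp f) : Lp ℂ 2 (volume : Measure E)) (k⁻¹ • ξ) := by
  set F : Lp ℂ 2 (volume : Measure E) := 𝓕 (hf.toLp f) with hF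
  refine fourier_lp_ae_eq (((Lp.memLp F).comp_smul (inv_ne_zero hk.ne')).locallyIntegrable
    one_le_two) fun χ hχ => ?_
  have hχc : HasCompactSupport fun x => ((k ^ Module.finrank ℝ E : ℝ) : ℂ) * χ (k • x) :=
    (hχ.comp_smul hk.ne').mul_left
  have hχs : ContDiff ℝ ∞ fun x => ((k ^ Module.finrank ℝ E : ℝ) : ℂ) * χ (k • x) :=
    contDiff_const.mul ((χ.smooth ⊤).comp (contDiff_id.const_smul k))
  have h1 := integral_mul_fourier_lp (hχc.toSchwartzMap hχs) (hf.toLp f)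
  have e1 : ∀ x, (𝓕 (hχc.toSchwartzMap hχs)) x = 𝓕 χ (k⁻¹ • x) := fun x => by
    rw [SchwartzMap.fourier_coe, SchwartzMap.fourier_coe]
    exact fourier_dilation hk x
  calc ∫ x, (𝓕 χ) x * hg.toLp g x
      = ∫ x, ((k ^ Module.finrank ℝ E : ℝ) : ℂ) * ((𝓕 χ) (k⁻¹ • (k • x)) * f (k • x)) := by
        refine integral_congr_ae ?_
        filter_upwards [hg.coeFn_toLp] with x hx
        rw [hx, hfg, inv_smul_smul₀ hk.ne']
        ring
    _ = ∫ x, (𝓕 χ) (k⁻¹ • x) * f x := integral_dilation hk fun x => (𝓕 χ) (k⁻¹ • x) * f x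
    _ = ∫ x, ((k ^ Module.finrank ℝ E : ℝ) : ℂ) * χ (k • x) * F x := by
        refine Eq.trans (integral_congr_ae ?_) h1.symm
        filter_upwards [hf.coeFn_toLp] with x hx
        rw [hx, e1]
    _ = ∫ x, ((k ^ Module.finrank ℝ E : ℝ) : ℂ) * (χ (k • x) * F (k⁻¹ • (k • x))) := by
        refine integral_congr_ae (.of_forall fun x => ?_)
        simp only [inv_smul_smul₀ hk.ne', mul_assoc]
    _ = ∫ x, χ x * F (k⁻¹ • x) := integral_dilation hk fun x => χ x * F (k⁻¹ • x)

end Fourier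

/-! ### The Fourier representation of the solution. -/

section Solution

variable {n : ℕ} {s a₀ : ℝ} {a : ℝ → ℝ} {u₀ : EuclideanSpace ℝ (Fin n) → ℂ}
  {u : ℝ → EuclideanSpace ℝ (Fin n) → ℂ} {G : ℂ → ℂ} {β M L : ℝ}

/-- The Fourier transform of the solution is the scalar resolvent times that of the initial
value. -/
theorem IsHsSolution.fourier_eq (hs : 0 ≤ s) (ha : IsMemoryKernel a)
    (hG : IsPassiveSymbol G β M L)
    (hGa : ∀ z : ℂ, 0 < z.re → G z = a₀ + laplaceTransform a z)
    (hu : IsHsSolution s a₀ a u₀ u) (h0 : MemLp u₀ 2) {t : ℝ} (ht : 0 < t) (hut : MemLp (u t) 2) :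
    ∀ᵐ ξ, (𝓕 (hut.toLp (u t)) : Lp ℂ 2 (volume : Measure (EuclideanSpace ℝ (Fin n)))) ξ
      = (𝓕 (h0.toLp u₀) : Lp ℂ 2 (volume : Measure (EuclideanSpace ℝ (Fin n)))) ξ
        * resolventKernel G (‖(2 * Real.pi) • ξ‖ ^ 2) t := by
  obtain ⟨W, hW, hWu, hV⟩ := hu.exists_fourier_volterra hs ha
  obtain ⟨_, e1⟩ := hWu t ht.le
  obtain ⟨hu0, e0⟩ := hWu 0 le_rfl
  rw [← e1]
  have e0' : W 0 = 𝓕 (h0.toLp u₀) := by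
    rw [e0]
    congr 1
    exact (MemLp.toLp_eq_toLp_iff _ _).2 hu.initial
  rw [← e0']
  -- The multiplier `|2πξ|²` is unbounded. On each `S N` it coincides with its truncation at `N`,
  -- and these countably many sets exhaust the space.
  let S : ℕ → Set (EuclideanSpace ℝ (Fin n)) := fun N => {ξ | ‖(2 * Real.pi) • ξ‖ ^ 2 ≤ N}
  have hS : ∀ N, MeasurableSet (S N) := fun N => measurableSet_le (by fun_prop) measurable_const
  have key : ∀ N : ℕ, ∀ᵐ ξ, ξ ∈ S N → W t ξ
      = W 0 ξ * resolventKernel G (‖(2 * Real.pi) • ξ‖ ^ 2) t := by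
    intro N
    rw [← ae_restrict_iff' (hS N)]
    let Λ := LpToLpRestrictCLM (EuclideanSpace ℝ (Fin n)) ℂ ℂ volume 2 (S N)
    have hΛ : ∀ f, Λ f =ᵐ[volume.restrict (S N)] f := fun f => LpToLpRestrictCLM_coeFn ℂ (S N) f
    have h1 := ae_eq_mul_resolventKernel_of_volterra (μ := volume.restrict (S N)) (a₀ := a₀)
      (N := N) (ρ := fun ξ => min (‖(2 * Real.pi) • ξ‖ ^ 2) N) (W := fun t => Λ (W t)) ha hG hGa
      (by fun_prop) (fun ξ => by positivity) (fun ξ => min_le_right _ _) (by positivity)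
      (by fun_prop) (fun r hr => ?_) ht
    · filter_upwards [h1, hΛ (W t), hΛ (W 0), ae_restrict_mem (hS N)] with ξ h1 h2 h3 h4
      rw [← h2, ← h3, h1, min_eq_left h4]
    · have h2 : ∫ q in (0 : ℝ)..r, (integratedKernel a₀ a (r - q) : ℂ) • Λ (W q)
          = Λ (∫ q in (0 : ℝ)..r, (integratedKernel a₀ a (r - q) : ℂ) • W q) := by
        rw [← Λ.intervalIntegral_comp_comm (ha.intervalIntegrable_smul a₀ hW hr)]
        simp only [map_smul]
      rw [h2]
      filter_upwards [hΛ (W r), hΛ (W 0), ae_restrict_mem (hS N), ae_restrict_of_ae (hV r hr),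
        hΛ (∫ q in (0 : ℝ)..r, (integratedKernel a₀ a (r - q) : ℂ) • W q)] with ξ h1 h2 h3 h4 h5
      rw [h1, h2, h5, h4, min_eq_left h3]
  filter_upwards [ae_all_iff.2 key] with ξ hξ
  obtain ⟨N, hN⟩ := exists_nat_ge (‖(2 * Real.pi) • ξ‖ ^ 2)
  exact hξ N hN

end Solution

/-! ### Dominated convergence in `L²` and Gaussian majorants. -/

section Dominated

/-- Dominated convergence to zero in `L²`, along a countably generated filter. -/
theorem tendsto_eLpNorm_two_of_dominated {X ι : Type*} [MeasurableSpace X] {μ : Measure X}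
    {l : Filter ι} [l.IsCountablyGenerated] {F : ι → X → ℂ} {b : X → ℝ} (hb : MemLp b 2 μ)
    (hm : ∀ᶠ i in l, Measurable (F i)) (hF : ∀ᶠ i in l, ∀ x, ‖F i x‖ ≤ b x)
    (hlim : ∀ x, Tendsto (fun i => F i x) l (𝓝 0)) :
    Tendsto (fun i => eLpNorm (F i) 2 μ) l (𝓝 0) := by
  simp only [eLpNorm_eq_lintegral_rpow_enorm_toReal two_ne_zero ENNReal.ofNat_ne_top]
  have hpow : ∀ {ι : Type _} {l : Filter ι} {f : ι → ℝ≥0∞} {p : ℝ}, 0 < p → Tendsto f l (𝓝 0) →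
      Tendsto (fun i => f i ^ p) l (𝓝 0) := fun {ι l f p} hp hf => by
    have := ((ENNReal.continuous_rpow_const (y := p)).tendsto 0).comp hf
    rwa [ENNReal.zero_rpow_of_pos hp] at this
  refine hpow (by norm_num) ?_
  have h2 := tendsto_lintegral_filter_of_dominated_convergence (μ := μ) (l := l)
    (F := fun i x => ‖F i x‖ₑ ^ (2 : ℝ≥0∞).toReal) (f := fun _ => 0)
    (fun x => ‖b x‖ₑ ^ (2 : ℝ≥0∞).toReal) ?_ ?_ ?_ ?_
  · rwa [lintegral_zero] at h2
  · filter_upwards [hm] with i hi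
    exact hi.enorm.pow_const _
  · filter_upwards [hF] with i hi
    refine .of_forall fun x => ?_
    gcongr
    exact enorm_le_iff_norm_le.2 ((hi x).trans (le_abs_self _))
  · exact (lintegral_rpow_enorm_lt_top_of_eLpNorm_lt_top two_ne_zero ENNReal.ofNat_ne_top hb.2).ne
  · refine .of_forall fun x => hpow (by norm_num) ?_
    have := (hlim x).enorm
    rwa [enorm_zero] at this

end Dominated

section Gaussian

variable {E : Type*} [NormedAddCommGroup E] [InnerProductSpace ℝ E] [FiniteDimensional ℝ E]
  [MeasurableSpace E] [BorelSpace E]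

theorem integrable_exp_neg_mul_norm_sq {b : ℝ} (hb : 0 < b) :
    Integrable fun x : E => Real.exp (-(b * ‖x‖ ^ 2)) := by
  have h := (GaussianFourier.integrable_cexp_neg_mul_sq_norm_add (V := E) (b := b)
    (by simpa using hb) 0 0).norm
  refine h.congr (.of_forall fun x => ?_)
  simp only [Complex.norm_exp]
  congr 1
  simp [← Complex.ofReal_pow]

theorem memLp_two_exp_neg_mul_norm_sq {b : ℝ} (hb : 0 < b) :
    MemLp (fun x : E => Real.exp (-(b * ‖x‖ ^ 2))) 2 := by
  refine (memLp_two_iff_integrable_sq_norm (Continuous.aestronglyMeasurable (by fun_prop))).2 ?_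
  refine (integrable_exp_neg_mul_norm_sq (E := E) (mul_pos two_pos hb)).congr
    (.of_forall fun x => ?_)
  simp only
  rw [Real.norm_of_nonneg (Real.exp_pos _).le, ← Real.exp_nat_mul]
  congr 1
  push_cast
  ring

theorem exists_one_add_rpow_le_exp {m : ℝ} (hm : 0 < m) (p : ℝ) :
    ∃ C, 0 < C ∧ ∀ x : ℝ, 0 ≤ x → (1 + x) ^ p ≤ C * Real.exp (m * x) := by
  obtain ⟨N, hN⟩ := exists_nat_ge p
  refine ⟨N.factorial / m ^ N * Real.exp m, by positivity, fun x hx => ?_⟩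
  have h1 : (1 + x) ^ p ≤ (1 + x) ^ N := by
    rw [← Real.rpow_natCast]
    exact Real.rpow_le_rpow_of_exponent_le (by linarith) hN
  have h2 := Real.pow_div_factorial_le_exp (m * (1 + x)) (by positivity) N
  refine h1.trans ?_
  rw [div_le_iff₀ (by positivity), mul_pow] at h2
  rw [mul_assoc, ← Real.exp_add, show m + m * x = m * (1 + x) by ring, div_mul_eq_mul_div,
    le_div_iff₀ (by positivity)]
  linarith

/-- Half of the Gaussian exponent absorbs the polynomial weight; the other half is square
integrable. -/
theorem memLp_weight_mul_exp {m : ℝ} (hm : 0 < m) (p B : ℝ) :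
    MemLp (fun ξ : E => (1 + ‖(2 * Real.pi) • ξ‖ ^ 2) ^ p
      * (B * Real.exp (-(m * ‖(2 * Real.pi) • ξ‖ ^ 2)))) 2 := by
  obtain ⟨C, hC, h⟩ := exists_one_add_rpow_le_exp (half_pos hm) p
  have h1 := memLp_two_exp_neg_mul_norm_sq (E := E) (b := m / 2 * (2 * Real.pi) ^ 2)
    (by positivity)
  have hcont : Continuous fun ξ : E => (1 + ‖(2 * Real.pi) • ξ‖ ^ 2) ^ p :=
    Continuous.rpow_const (by fun_prop) fun ξ => Or.inl (by positivity)
  refine h1.of_le_mul (c := C * |B|) (Continuous.aestronglyMeasurable (by fun_prop))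
    (.of_forall fun ξ => ?_)
  set x := ‖(2 * Real.pi) • ξ‖ ^ 2 with hx
  have hx' : m / 2 * (2 * Real.pi) ^ 2 * ‖ξ‖ ^ 2 = m / 2 * x := by
    rw [hx, norm_smul, Real.norm_of_nonneg Real.two_pi_pos.le]
    ring
  have hx0 : 0 ≤ x := by positivity
  rw [hx', norm_mul, norm_mul, Real.norm_of_nonneg (by positivity), Real.norm_eq_abs B,
    Real.norm_of_nonneg (Real.exp_pos _).le, Real.norm_of_nonneg (Real.exp_pos _).le]
  calc (1 + x) ^ p * (|B| * Real.exp (-(m * x)))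
      ≤ C * Real.exp (m / 2 * x) * (|B| * Real.exp (-(m * x))) := by
        gcongr
        exact h x hx0
    _ = C * |B| * (Real.exp (m / 2 * x) * Real.exp (-(m * x))) := by ring
    _ = _ := by
        rw [← Real.exp_add]
        congr 2
        ring

theorem heatKernel_eq {n : ℕ} (t : ℝ) (x : EuclideanSpace ℝ (Fin n)) :
    heatKernel t x = (((4 * Real.pi * t) ^ (-(n : ℝ) / 2)
      * Real.exp (-((4 * t)⁻¹ * ‖x‖ ^ 2)) : ℝ) : ℂ) := by
  rw [heatKernel]
  congr 3
  rw [div_eq_mul_inv]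
  ring

theorem integrable_heatKernel {n : ℕ} {t : ℝ} (ht : 0 < t) :
    Integrable (heatKernel t : EuclideanSpace ℝ (Fin n) → ℂ) := by
  simp only [funext (heatKernel_eq (n := n) t)]
  exact ((integrable_exp_neg_mul_norm_sq (by positivity)).const_mul _).ofReal

theorem memLp_heatKernel {n : ℕ} {t : ℝ} (ht : 0 < t) :
    MemLp (heatKernel t : EuclideanSpace ℝ (Fin n) → ℂ) 2 := by
  simp only [funext (heatKernel_eq (n := n) t)]
  exact ((memLp_two_exp_neg_mul_norm_sq (by positivity)).const_mul _).ofReal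

end Gaussian

/-! ### The Sobolev distance on the Fourier side. -/

section Representation

variable {n : ℕ} {s : ℝ} {u₀ f : EuclideanSpace ℝ (Fin n) → ℂ} {R : EuclideanSpace ℝ (Fin n) → ℂ}

theorem sobolevENorm_eq_of_integrable (hu₀ : Integrable u₀) (hu₂ : MemLp u₀ 2) :
    sobolevENorm s u₀ = eLpNorm (fun ξ : EuclideanSpace ℝ (Fin n) =>
      (((1 + ‖(2 * Real.pi) • ξ‖ ^ 2) ^ (s / 2) : ℝ) : ℂ) * 𝓕 u₀ ξ) 2 := by
  rw [sobolevENorm_eq hu₂]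
  refine eLpNorm_congr_ae ?_
  filter_upwards [fourier_toLp_ae_eq hu₀ hu₂] with ξ hξ
  rw [hξ]

/-- The Sobolev distance of a dilated function from a multiple of the heat kernel. -/
theorem sobolevENorm_dilation_sub_heatKernel (hu₀ : Integrable u₀) (hu₂ : MemLp u₀ 2)
    (hf : MemLp f 2)
    (hfR : ∀ᵐ ξ, (𝓕 (hf.toLp f) : Lp ℂ 2 (volume : Measure (EuclideanSpace ℝ (Fin n)))) ξ
      = (𝓕 (hu₂.toLp u₀) : Lp ℂ 2 (volume : Measure (EuclideanSpace ℝ (Fin n)))) ξ * R ξ)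
    {k t : ℝ} (hk : 0 < k) (ht : 0 < t) (c : ℂ) :
    sobolevENorm s (fun x : EuclideanSpace ℝ (Fin n) =>
        ((k ^ n : ℝ) : ℂ) * f (k • x) - c * heatKernel t x)
      = eLpNorm (fun ξ : EuclideanSpace ℝ (Fin n) =>
        (((1 + ‖(2 * Real.pi) • ξ‖ ^ 2) ^ (s / 2) : ℝ) : ℂ) *
          (𝓕 u₀ (k⁻¹ • ξ) * R (k⁻¹ • ξ)
            - c * Complex.exp (-((‖(2 * Real.pi) • ξ‖ ^ 2 * t : ℝ) : ℂ)))) 2 := by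
  have hg : MemLp (fun x => ((k ^ n : ℝ) : ℂ) * f (k • x)) 2 := (hf.comp_smul hk.ne').const_mul _
  have hh : MemLp (heatKernel t : EuclideanSpace ℝ (Fin n) → ℂ) 2 := memLp_heatKernel ht
  have hd : MemLp (fun x => ((k ^ n : ℝ) : ℂ) * f (k • x) - c * heatKernel t x) 2 :=
    hg.sub (hh.const_mul c)
  rw [sobolevENorm_eq hd]
  refine eLpNorm_congr_ae ?_
  have e1 : hd.toLp _ = hg.toLp _ - c • hh.toLp _ := by
    rw [← MemLp.toLp_const_smul, ← MemLp.toLp_sub]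
    rfl
  have e2 : (𝓕 (hd.toLp _) : Lp ℂ 2 (volume : Measure (EuclideanSpace ℝ (Fin n))))
      = 𝓕 (hg.toLp _) - c • 𝓕 (hh.toLp _) := by
    rw [e1]
    let Φ := Lp.fourierTransformₗᵢ (EuclideanSpace ℝ (Fin n)) ℂ
    change Φ _ = Φ _ - c • Φ _
    rw [map_sub, map_smul]
  have hqm := Measure.quasiMeasurePreserving_smul
    (volume : Measure (EuclideanSpace ℝ (Fin n))) (inv_ne_zero hk.ne')
  have hfg := fourier_toLp_dilation (f := f) hk (by rw [finrank_euclideanSpace_fin]) hf hg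
  rw [e2]
  filter_upwards [hfg, hqm.ae hfR, hqm.ae (fourier_toLp_ae_eq hu₀ hu₂),
    fourier_toLp_ae_eq (integrable_heatKernel ht) hh,
    Lp.coeFn_sub (𝓕 (hg.toLp _) : Lp ℂ 2 (volume : Measure (EuclideanSpace ℝ (Fin n))))
      (c • 𝓕 (hh.toLp _)),
    Lp.coeFn_smul c (𝓕 (hh.toLp _) : Lp ℂ 2 (volume : Measure (EuclideanSpace ℝ (Fin n))))]
    with ξ h1 h2 h3 h4 h5 h6
  rw [h5, Pi.sub_apply, h6, Pi.smul_apply, h1, h2, h3, h4, fourier_heatKernel ht, smul_eq_mul]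
  push_cast
  simp only [neg_mul]

end Representation

/-! ### High and low frequencies in the diffusive limit. -/

section Limit

variable {E : Type*} [NormedAddCommGroup E] [InnerProductSpace ℝ E]
  {G : ℂ → ℂ} {β M L B g c d s : ℝ} {φ : E → ℂ} {k : ℝ → ℝ}

theorem norm_two_pi_smul_inv_smul_sq (r : ℝ) (ξ : E) :
    ‖(2 * Real.pi) • (r⁻¹ • ξ)‖ ^ 2 = ‖(2 * Real.pi) • ξ‖ ^ 2 / r ^ 2 := by
  rw [smul_comm, norm_smul, mul_pow, norm_inv, inv_pow, Real.norm_eq_abs, sq_abs]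
  ring

/-- The behaviour of a scaling function with `k(T)² ~ g T`. -/
theorem eventually_scaling_bounds (hk : ∀ᶠ T in atTop, 0 < k T) (hg : 0 < g)
    (hkT : Tendsto (fun T => k T ^ 2 / T) atTop (𝓝 g)) :
    (∀ᶠ T in atTop, 1 ≤ k T ∧ k T ≤ T ∧ k T ^ 2 ≤ 2 * g * T) ∧ Tendsto k atTop atTop := by
  have h1 : Tendsto (fun T => k T ^ 2) atTop atTop := by
    refine (hkT.pos_mul_atTop hg tendsto_id).congr' ?_
    filter_upwards [eventually_gt_atTop 0] with T hT
    exact div_mul_cancel₀ _ hT.ne'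
  have h2 : Tendsto k atTop atTop := by
    refine (Real.tendsto_sqrt_atTop.comp h1).congr' ?_
    filter_upwards [hk] with T hT
    exact Real.sqrt_sq hT.le
  refine ⟨?_, h2⟩
  filter_upwards [h2.eventually_ge_atTop 1, hkT.eventually_le_const (show g < 2 * g by linarith),
    eventually_gt_atTop 0, eventually_ge_atTop (2 * g)] with T h1 h2 h3 h4
  rw [div_le_iff₀ h3] at h2
  exact ⟨h1, by nlinarith, h2⟩

/-- A dilation by `k ≥ 1` costs at most a factor `k^s` in the Sobolev weight, negligible against the
exponential decay of high frequencies. -/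
theorem weight_le_rpow_mul {k x s : ℝ} (hk : 1 ≤ k) (hx : 0 ≤ x) (hs : 0 ≤ s) :
    (1 + x) ^ (s / 2) ≤ k ^ s * (1 + x / k ^ 2) ^ (s / 2) := by
  have hk0 : 0 < k := by linarith
  have h1 : k ^ s = (k ^ 2) ^ (s / 2) := by
    rw [← Real.rpow_natCast, ← Real.rpow_mul hk0.le]
    congr 1
    push_cast
    ring
  rw [h1, ← Real.mul_rpow (by positivity) (by positivity)]
  refine Real.rpow_le_rpow (by positivity) ?_ (by positivity)
  rw [mul_add, mul_one, mul_div_cancel₀ _ (by positivity)]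
  linarith [one_le_pow₀ hk (n := 2)]

variable [FiniteDimensional ℝ E] [MeasurableSpace E] [BorelSpace E]

/-- The contribution of the high frequencies vanishes in the diffusive limit. -/
theorem IsPassiveSymbol.tendsto_eLpNorm_high (hG : IsPassiveSymbol G β M L)
    (hφs : eLpNorm (fun ξ => (((1 + ‖(2 * Real.pi) • ξ‖ ^ 2) ^ (s / 2) : ℝ) : ℂ) * φ ξ) 2 < ⊤)
    (hs : 0 ≤ s) (hk : ∀ᶠ T in atTop, 0 < k T) (hg : 0 < g)
    (hkT : Tendsto (fun T => k T ^ 2 / T) atTop (𝓝 g)) (hc : 0 < c) {ρ₀ : ℝ} (hρ₀ : 0 < ρ₀) :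
    Tendsto (fun i : ℝ × ℝ => eLpNorm
      ({ξ : E | ρ₀ < ‖(2 * Real.pi) • ((k i.1)⁻¹ • ξ)‖ ^ 2}.indicator fun ξ =>
        (((1 + ‖(2 * Real.pi) • ξ‖ ^ 2) ^ (s / 2) : ℝ) : ℂ) *
          (φ ((k i.1)⁻¹ • ξ)
            * resolventKernel G (‖(2 * Real.pi) • ((k i.1)⁻¹ • ξ)‖ ^ 2) (i.1 * i.2))) 2)
      (atTop ×ˢ 𝓟 (Icc c d)) (𝓝 0) := by
  obtain ⟨δ, C, hδ, hC, hR⟩ := hG.exists_norm_resolventKernel_le_high hρ₀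
  obtain ⟨hkb, -⟩ := eventually_scaling_bounds hk hg hkT
  set N : ℝ := (Module.finrank ℝ E : ℝ) with hN
  have hN0 : 0 ≤ N := Nat.cast_nonneg _
  set ψ : E → ℂ := fun ξ => (((1 + ‖(2 * Real.pi) • ξ‖ ^ 2) ^ (s / 2) : ℝ) : ℂ) * φ ξ with hψ
  -- The weight contributes `k^s`, the dilation in `L²` contributes `k^{N/2}`, and `k ≤ T` turns
  -- both into powers of `T`.
  have hlim : Tendsto (fun i : ℝ × ℝ => ENNReal.ofReal
      (C * (i.1 ^ (s + N / 2) * Real.exp (-(δ * c) * i.1))) * eLpNorm ψ 2)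
      (atTop ×ˢ 𝓟 (Icc c d)) (𝓝 0) := by
    have h1 := ((tendsto_rpow_mul_exp_neg_mul_atTop_nhds_zero (s + N / 2) (δ * c)
      (by positivity)).const_mul C).comp (tendsto_fst (f := atTop) (g := 𝓟 (Icc c d)))
    rw [mul_zero] at h1
    have h2 := ENNReal.Tendsto.mul_const (ENNReal.tendsto_ofReal h1) (Or.inr hφs.ne)
    rwa [ENNReal.ofReal_zero, zero_mul] at h2
  refine tendsto_of_tendsto_of_tendsto_of_le_of_le' tendsto_const_nhds hlim
    (.of_forall fun _ => zero_le) ?_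
  filter_upwards [hkb.prod_inl (𝓟 (Icc c d)), (eventually_gt_atTop 0).prod_inl (𝓟 (Icc c d)),
    (eventually_ge_atTop (1 / c)).prod_inl (𝓟 (Icc c d)),
    (eventually_principal.2 fun t ht => ht : ∀ᶠ t in 𝓟 (Icc c d), t ∈ Icc c d).prod_inr atTop]
    with i h1 h2 h3 h4
  obtain ⟨T, t⟩ := i
  obtain ⟨hk1, hkT', -⟩ := h1
  simp only at hk1 hkT' h2 h3 h4 ⊢
  have hk0 : 0 < k T := by linarith
  have hTc : 1 ≤ T * c := by rwa [div_le_iff₀ hc] at h3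
  have hTt : T * c ≤ T * t := mul_le_mul_of_nonneg_left h4.1 h2.le
  have hbound : ∀ ξ : E, ‖({ξ : E | ρ₀ < ‖(2 * Real.pi) • ((k T)⁻¹ • ξ)‖ ^ 2}.indicator fun ξ =>
        (((1 + ‖(2 * Real.pi) • ξ‖ ^ 2) ^ (s / 2) : ℝ) : ℂ) *
          (φ ((k T)⁻¹ • ξ)
            * resolventKernel G (‖(2 * Real.pi) • ((k T)⁻¹ • ξ)‖ ^ 2) (T * t))) ξ‖
      ≤ C * Real.exp (-(δ * c) * T) * k T ^ s * ‖ψ ((k T)⁻¹ • ξ)‖ := by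
    intro ξ
    by_cases hξ : ξ ∈ {ξ : E | ρ₀ < ‖(2 * Real.pi) • ((k T)⁻¹ • ξ)‖ ^ 2}
    swap
    · rw [indicator_of_notMem hξ, norm_zero]
      positivity
    rw [indicator_of_mem hξ, norm_mul, norm_mul, hψ, norm_mul, Complex.norm_real,
      Complex.norm_real, Real.norm_of_nonneg (by positivity), Real.norm_of_nonneg (by positivity)]
    have hr := hR _ (T * t) (le_of_lt hξ) (by linarith)
    have hr2 : C * Real.exp (-(δ * (T * t))) / (T * t) ≤ C * Real.exp (-(δ * c) * T) := by
      refine (div_le_self (by positivity) (by linarith)).trans ?_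
      gcongr
      nlinarith
    have hw := weight_le_rpow_mul hk1 (sq_nonneg ‖(2 * Real.pi) • ξ‖) hs
    rw [← norm_two_pi_smul_inv_smul_sq] at hw
    calc _ ≤ (k T ^ s * (1 + ‖(2 * Real.pi) • ((k T)⁻¹ • ξ)‖ ^ 2) ^ (s / 2))
          * (‖φ ((k T)⁻¹ • ξ)‖ * (C * Real.exp (-(δ * c) * T))) := by
          gcongr
          exact hr.trans hr2
      _ = _ := by ring
  have h5 := eLpNorm_le_mul_eLpNorm_of_ae_le_mul (p := 2) (μ := (volume : Measure E))
    (.of_forall hbound)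
  refine h5.trans ?_
  rw [eLpNorm_two_comp_smul ψ (inv_ne_zero hk0.ne'), ← mul_assoc]
  gcongr
  rw [ENNReal.ofReal_rpow_of_nonneg (abs_nonneg _) (by norm_num),
    ← ENNReal.ofReal_mul (by positivity)]
  refine ENNReal.ofReal_le_ofReal ?_
  rw [inv_pow, inv_inv, abs_of_pos (by positivity), ← Real.rpow_natCast (k T), ← hN,
    ← Real.rpow_mul hk0.le, mul_assoc, mul_one_div, ← Real.rpow_add hk0, mul_assoc,
      mul_comm (_ ^ _)]
  gcongr

/-- The contribution of the low frequencies converges to the heat semigroup. -/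
theorem IsPassiveSymbol.tendsto_eLpNorm_low (hG : IsPassiveSymbol G β M L) (hφ : Continuous φ)
    (hφB : ∀ ξ, ‖φ ξ‖ ≤ B) (hk : ∀ᶠ T in atTop, 0 < k T)
    (hkT : Tendsto (fun T => k T ^ 2 / T) atTop (𝓝 (G 0).re)) (hc : 0 < c) {ρ₀ c₀ C : ℝ}
    (hρ₀ : 0 < ρ₀) (hc₀ : 0 < c₀) (hC : 0 < C)
    (hR : ∀ ρ t : ℝ, 0 ≤ ρ → ρ ≤ ρ₀ → 2 ≤ t →
      ‖resolventKernel G ρ t‖ ≤ C * Real.exp (-(c₀ * (ρ * t)))) :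
    Tendsto (fun i : ℝ × ℝ => eLpNorm (fun ξ : E =>
        (((1 + ‖(2 * Real.pi) • ξ‖ ^ 2) ^ (s / 2) : ℝ) : ℂ) *
          ({ξ : E | ‖(2 * Real.pi) • ((k i.1)⁻¹ • ξ)‖ ^ 2 ≤ ρ₀}.indicator (fun ξ =>
            φ ((k i.1)⁻¹ • ξ)
              * resolventKernel G (‖(2 * Real.pi) • ((k i.1)⁻¹ • ξ)‖ ^ 2) (i.1 * i.2)) ξ
            - φ 0 * Complex.exp (-((‖(2 * Real.pi) • ξ‖ ^ 2 * i.2 : ℝ) : ℂ)))) 2)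
      (atTop ×ˢ 𝓟 (Icc c d)) (𝓝 0) := by
  set g := (G 0).re with hgdef
  have hg : 0 < g := hG.re_pos 0 (by simpa using hG.pos)
  have hB : 0 ≤ B := (norm_nonneg _).trans (hφB 0)
  obtain ⟨hkb, hktop⟩ := eventually_scaling_bounds hk hg hkT
  -- A common Gaussian rate: eventually `k² ≤ 2gT`, so `Tt/k² ≥ c/(2g)` in the resolvent bound,
  -- while the heat factor decays at rate `t ≥ c`.
  set m : ℝ := min (c₀ * (c / (2 * g))) c with hm
  have hm0 : 0 < m := by positivity
  have hIcc : ∀ᶠ i in (atTop : Filter ℝ) ×ˢ 𝓟 (Icc c d), i.2 ∈ Icc c d :=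
    (eventually_principal.2 fun t ht => ht : ∀ᶠ t in 𝓟 (Icc c d), t ∈ Icc c d).prod_inr atTop
  have hw : Continuous fun ξ : E => (1 + ‖(2 * Real.pi) • ξ‖ ^ 2) ^ (s / 2) :=
    Continuous.rpow_const (by fun_prop) fun ξ => Or.inl (by positivity)
  refine tendsto_eLpNorm_two_of_dominated (memLp_weight_mul_exp hm0 (s / 2) (B * C + B)) ?_ ?_ ?_
  · refine .of_forall fun i => ?_
    have h1 : Measurable fun ξ : E =>
        resolventKernel G (‖(2 * Real.pi) • ((k i.1)⁻¹ • ξ)‖ ^ 2) (i.1 * i.2) :=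
      hG.measurable_resolventKernel (ρ := fun ξ => ‖(2 * Real.pi) • ((k i.1)⁻¹ • ξ)‖ ^ 2)
        (by fun_prop) _
    refine Measurable.mul (by fun_prop) (Measurable.sub (Measurable.indicator ?_ ?_) (by fun_prop))
    · exact (Continuous.measurable (by fun_prop)).mul h1
    · exact measurableSet_le (by fun_prop) measurable_const
  · filter_upwards [hkb.prod_inl (𝓟 (Icc c d)), (eventually_gt_atTop 0).prod_inl (𝓟 (Icc c d)),
      (eventually_ge_atTop (2 / c)).prod_inl (𝓟 (Icc c d)), hIcc] with i h1 h2 h3 h4 ξ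
    obtain ⟨T, t⟩ := i
    obtain ⟨hk1, -, hk2⟩ := h1
    simp only at hk1 hk2 h2 h3 h4 ⊢
    have hk0 : 0 < k T := by linarith
    have hTc : 2 ≤ T * c := by rwa [div_le_iff₀ hc] at h3
    have hTt : T * c ≤ T * t := mul_le_mul_of_nonneg_left h4.1 h2.le
    set x := ‖(2 * Real.pi) • ξ‖ ^ 2 with hx
    have hx0 : 0 ≤ x := by positivity
    rw [norm_mul, Complex.norm_real, Real.norm_of_nonneg (by positivity)]
    gcongr
    rw [add_mul]
    refine (norm_sub_le _ _).trans (add_le_add ?_ ?_)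
    · by_cases hξ : ξ ∈ {ξ : E | ‖(2 * Real.pi) • ((k T)⁻¹ • ξ)‖ ^ 2 ≤ ρ₀}
      swap
      · rw [indicator_of_notMem hξ, norm_zero]
        positivity
      rw [indicator_of_mem hξ, norm_mul, mul_assoc]
      refine mul_le_mul (hφB _) ((hR _ _ (by positivity) hξ (by linarith)).trans ?_)
        (norm_nonneg _) hB
      refine mul_le_mul_of_nonneg_left (Real.exp_le_exp.2 (neg_le_neg ?_)) hC.le
      rw [norm_two_pi_smul_inv_smul_sq, ← hx]
      have h5 : c / (2 * g) ≤ T * t / k T ^ 2 := by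
        rw [div_le_div_iff₀ (by positivity) (by positivity)]
        calc c * k T ^ 2 ≤ c * (2 * g * T) := by gcongr
          _ = T * c * (2 * g) := by ring
          _ ≤ _ := by gcongr
      calc m * x ≤ c₀ * (c / (2 * g)) * x := by gcongr; exact min_le_left _ _
        _ ≤ c₀ * (T * t / k T ^ 2) * x := by gcongr
        _ = _ := by ring
    · rw [norm_mul, Complex.norm_exp]
      refine mul_le_mul (hφB _) ?_ (Real.exp_pos _).le hB
      rw [Complex.neg_re, Complex.ofReal_re, mul_comm]
      refine Real.exp_le_exp.2 (neg_le_neg ?_)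
      gcongr
      exact (min_le_right _ _).trans h4.1
  · intro ξ
    set x := ‖(2 * Real.pi) • ξ‖ ^ 2 with hx
    have hx0 : 0 ≤ x := by positivity
    have hfst : Tendsto (Prod.fst : ℝ × ℝ → ℝ) (atTop ×ˢ 𝓟 (Icc c d)) atTop := tendsto_fst
    have hkinv : Tendsto (fun i : ℝ × ℝ => (k i.1)⁻¹) (atTop ×ˢ 𝓟 (Icc c d)) (𝓝 0) :=
      (tendsto_inv_atTop_zero.comp hktop).comp hfst
    have hsc : Tendsto (fun i : ℝ × ℝ => (k i.1)⁻¹ • ξ) (atTop ×ˢ 𝓟 (Icc c d)) (𝓝 0) := by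
      simpa using hkinv.smul_const ξ
    have hφ0 : Tendsto (fun i : ℝ × ℝ => φ ((k i.1)⁻¹ • ξ)) (atTop ×ˢ 𝓟 (Icc c d)) (𝓝 (φ 0)) :=
      (hφ.tendsto 0).comp hsc
    have hρ : Tendsto (fun i : ℝ × ℝ => ‖(2 * Real.pi) • ((k i.1)⁻¹ • ξ)‖ ^ 2)
        (atTop ×ˢ 𝓟 (Icc c d)) (𝓝 0) := by
      simpa using ((hsc.const_smul (2 * Real.pi)).norm).pow 2
    -- For fixed `ξ`, with `ρ = x/k²`, `τ = Tt` and `q = xt ≤ xd`, the difference `ρ τ G(0) - q`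
    -- tends to zero because `k²/T → G(0)`.
    have hK := hG.tendsto_resolventKernel_sub (l := atTop ×ˢ 𝓟 (Icc c d)) (Q := x * d)
      (ρ := fun i : ℝ × ℝ => ‖(2 * Real.pi) • ((k i.1)⁻¹ • ξ)‖ ^ 2) (τ := fun i => i.1 * i.2)
      (q := fun i => x * i.2) (.of_forall fun i => by positivity) ?_ ?_ ?_ ?_
    · have hlow : ∀ᶠ i : ℝ × ℝ in atTop ×ˢ 𝓟 (Icc c d),
          ξ ∈ {ξ : E | ‖(2 * Real.pi) • ((k i.1)⁻¹ • ξ)‖ ^ 2 ≤ ρ₀} :=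
        hρ.eventually_le_const hρ₀
      have h1 : Tendsto (fun i : ℝ × ℝ => (φ ((k i.1)⁻¹ • ξ) - φ 0)
          * Complex.exp (-((x * i.2 : ℝ) : ℂ))) (atTop ×ˢ 𝓟 (Icc c d)) (𝓝 0) := by
        refine squeeze_zero_norm' ?_ (tendsto_iff_norm_sub_tendsto_zero.1 hφ0)
        filter_upwards [hIcc] with i hi
        rw [norm_mul, Complex.norm_exp, Complex.neg_re, Complex.ofReal_re]
        refine mul_le_of_le_one_right (norm_nonneg _) (Real.exp_le_one_iff.2 ?_)
        have := mul_nonneg hx0 (hc.le.trans hi.1)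
        linarith
      have h2 := ((hφ0.mul hK).add h1).const_mul (((1 + x) ^ (s / 2) : ℝ) : ℂ)
      rw [mul_zero, add_zero, mul_zero] at h2
      refine h2.congr' ?_
      filter_upwards [hlow] with i hi
      rw [indicator_of_mem (s := {ξ : E | ‖(2 * Real.pi) • ((k i.1)⁻¹ • ξ)‖ ^ 2 ≤ ρ₀}) hi]
      ring
    · refine tendsto_atTop_mono' _ ?_ (hfst.atTop_mul_const hc)
      filter_upwards [hIcc, hfst.eventually_ge_atTop 0] with i h1 h2
      exact mul_le_mul_of_nonneg_left h1.1 h2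
    · filter_upwards [hIcc] with i h1
      exact mul_nonneg hx0 (hc.le.trans h1.1)
    · filter_upwards [hIcc] with i h1
      exact mul_le_mul_of_nonneg_left h1.2 hx0
    · have h1 : Tendsto (fun i : ℝ × ℝ => (k i.1 ^ 2 / i.1)⁻¹ * g - 1)
          (atTop ×ˢ 𝓟 (Icc c d)) (𝓝 0) := by
        have := ((hkT.inv₀ hg.ne').mul_const g).sub_const 1
        rw [inv_mul_cancel₀ hg.ne', sub_self] at this
        exact this.comp hfst
      have h2 : Tendsto (fun i : ℝ × ℝ => (x * d) * ‖(k i.1 ^ 2 / i.1)⁻¹ * g - 1‖)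
          (atTop ×ˢ 𝓟 (Icc c d)) (𝓝 0) := by
        simpa using h1.norm.const_mul (x * d)
      refine squeeze_zero_norm' ?_ h2
      filter_upwards [hIcc, hfst.eventually_gt_atTop 0] with i h3 h4
      rw [norm_two_pi_smul_inv_smul_sq, ← hx]
      have e : x / k i.1 ^ 2 * (i.1 * i.2) * g - x * i.2
          = x * i.2 * ((k i.1 ^ 2 / i.1)⁻¹ * g - 1) := by
        rw [inv_div]
        ring
      have := hc.le.trans h3.1
      rw [e, norm_mul, Real.norm_of_nonneg (by positivity)]
      gcongr
      exact h3.2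

end Limit

/-! ### Combination of the two regimes and conclusion. -/

section Final

variable {E : Type*} [NormedAddCommGroup E] [InnerProductSpace ℝ E] [FiniteDimensional ℝ E]
  [MeasurableSpace E] [BorelSpace E] {G : ℂ → ℂ} {β M L B c d s : ℝ} {φ : E → ℂ} {k : ℝ → ℝ}

/-- The diffusive limit on the Fourier side. -/
theorem IsPassiveSymbol.tendsto_eLpNorm_sub (hG : IsPassiveSymbol G β M L) (hφ : Continuous φ)
    (hφB : ∀ ξ, ‖φ ξ‖ ≤ B)
    (hφs : eLpNorm (fun ξ => (((1 + ‖(2 * Real.pi) • ξ‖ ^ 2) ^ (s / 2) : ℝ) : ℂ) * φ ξ) 2 < ⊤)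
    (hs : 0 ≤ s) (hk : ∀ᶠ T in atTop, 0 < k T)
    (hkT : Tendsto (fun T => k T ^ 2 / T) atTop (𝓝 (G 0).re)) (hc : 0 < c) :
    Tendsto (fun i : ℝ × ℝ => eLpNorm (fun ξ : E =>
        (((1 + ‖(2 * Real.pi) • ξ‖ ^ 2) ^ (s / 2) : ℝ) : ℂ) *
          (φ ((k i.1)⁻¹ • ξ)
              * resolventKernel G (‖(2 * Real.pi) • ((k i.1)⁻¹ • ξ)‖ ^ 2) (i.1 * i.2)
            - φ 0 * Complex.exp (-((‖(2 * Real.pi) • ξ‖ ^ 2 * i.2 : ℝ) : ℂ)))) 2)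
      (atTop ×ˢ 𝓟 (Icc c d)) (𝓝 0) := by
  have hg : 0 < (G 0).re := hG.re_pos 0 (by simpa using hG.pos)
  obtain ⟨ρ₀, c₀, C, hρ₀, hc₀, hC, hR⟩ := hG.exists_norm_resolventKernel_le_low
  have h1 := hG.tendsto_eLpNorm_low (s := s) (d := d) hφ hφB hk hkT hc hρ₀ hc₀ hC hR
  have h2 := hG.tendsto_eLpNorm_high (d := d) hφs hs hk hg hkT hc hρ₀
  have h3 := h1.add h2
  rw [add_zero] at h3
  refine tendsto_of_tendsto_of_tendsto_of_le_of_le tendsto_const_nhds h3 (fun _ => zero_le)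
    fun i => ?_
  have hw : Measurable fun ξ : E => (((1 + ‖(2 * Real.pi) • ξ‖ ^ 2) ^ (s / 2) : ℝ) : ℂ) := by
    fun_prop
  have hm : Measurable fun ξ : E => φ ((k i.1)⁻¹ • ξ)
      * resolventKernel G (‖(2 * Real.pi) • ((k i.1)⁻¹ • ξ)‖ ^ 2) (i.1 * i.2) :=
    (Continuous.measurable (by fun_prop)).mul
      (hG.measurable_resolventKernel (ρ := fun ξ => ‖(2 * Real.pi) • ((k i.1)⁻¹ • ξ)‖ ^ 2)
        (by fun_prop) _)
  refine le_trans (le_of_eq ?_) (eLpNorm_add_le ?_ ?_ one_le_two)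
  · congr 1
    funext ξ
    rw [Pi.add_apply]
    by_cases hξ : ‖(2 * Real.pi) • ((k i.1)⁻¹ • ξ)‖ ^ 2 ≤ ρ₀
    · rw [indicator_of_mem (s := {ξ : E | ‖(2 * Real.pi) • ((k i.1)⁻¹ • ξ)‖ ^ 2 ≤ ρ₀}) hξ,
        indicator_of_notMem (s := {ξ : E | ρ₀ < ‖(2 * Real.pi) • ((k i.1)⁻¹ • ξ)‖ ^ 2})
          (not_lt.2 hξ), add_zero]
    · rw [indicator_of_notMem (s := {ξ : E | ‖(2 * Real.pi) • ((k i.1)⁻¹ • ξ)‖ ^ 2 ≤ ρ₀}) hξ,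
        indicator_of_mem (s := {ξ : E | ρ₀ < ‖(2 * Real.pi) • ((k i.1)⁻¹ • ξ)‖ ^ 2})
          (not_le.1 hξ)]
      ring
  · exact (hw.mul ((hm.indicator (measurableSet_le (by fun_prop) measurable_const)).sub
      (by fun_prop))).aestronglyMeasurable
  · exact ((hw.mul hm).indicator
      (measurableSet_lt measurable_const (by fun_prop))).aestronglyMeasurable

end Final

theorem tendsto_scalingFunction_sq_div {a₀ g : ℝ} {a : ℝ → ℝ} (hg : 0 < g)
    (hA : Tendsto (integratedKernel a₀ a) atTop (𝓝 g)) :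
    (∀ᶠ T in atTop, 0 < scalingFunction a₀ a T) ∧
      Tendsto (fun T => scalingFunction a₀ a T ^ 2 / T) atTop (𝓝 g) := by
  have hpos : ∀ᶠ T in atTop, 0 < T ∧ 0 < integratedKernel a₀ a T :=
    (eventually_gt_atTop 0).and (hA.eventually (lt_mem_nhds hg))
  refine ⟨?_, hA.congr' ?_⟩
  · filter_upwards [hpos] with T hT
    exact Real.sqrt_pos.2 (mul_pos hT.1 hT.2)
  · filter_upwards [hpos] with T hT
    rw [scalingFunction, Real.sq_sqrt (mul_pos hT.1 hT.2).le, mul_div_cancel_left₀ _ hT.1.ne']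

theorem theorem5p1 (n : ℕ) (a₀ : ℝ) (a : ℝ → ℝ) (α s : ℝ) (F : ℂ → ℂ)
    (u₀ : EuclideanSpace ℝ (Fin n) → ℂ) (u : ℝ → EuclideanSpace ℝ (Fin n) → ℂ)
    (ha₀ : 0 ≤ a₀) (ha : IsMemoryKernel a)
    (hne : ¬ (a₀ = 0 ∧ a =ᵐ[volume.restrict (Ioi (0 : ℝ))] 0))
    (hs : 0 ≤ s) (hu₀_int : Integrable u₀ volume) (hu₀_Hs : MemHs s u₀)
    (hα : 0 < α) (hF : IsLaplaceExtension a α F)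
    (hpos : (0 < a₀ ∧ ∀ η : ℝ, 0 < a₀ + (F (Complex.I * (η : ℂ))).re) ∨
      ∀ η : ℝ, 0 ≤ (F (-(α : ℂ) + Complex.I * (η : ℂ))).re)
    (hu : IsHsSolution s a₀ a u₀ u) :
    ∀ c d : ℝ, 0 < c → c ≤ d →
      Tendsto (fun T : ℝ => ⨆ t ∈ Icc c d,
          sobolevENorm s (fun x : EuclideanSpace ℝ (Fin n) =>
            rescale (scalingFunction a₀ a) u T t x - (∫ y, u₀ y) * heatKernel t x))
        atTop (𝓝 0) := by
  intro c d hc _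
  obtain ⟨β, M, L, hG⟩ := hF.exists_isPassiveSymbol hα ha ha₀ hne hpos
  set G : ℂ → ℂ := fun z => a₀ + F z with hGdef
  have hGa : ∀ z : ℂ, 0 < z.re → G z = a₀ + laplaceTransform a z := fun z hz => by
    rw [hGdef, ← hF.eq_laplaceTransform z hz]
  have hg : 0 < (G 0).re := hG.re_pos 0 (by simpa using hG.pos)
  obtain ⟨hk, hkT⟩ := tendsto_scalingFunction_sq_div hg (hG.tendsto_integratedKernel ha hGa)
  have hu₂ := hu₀_Hs.memLp
  have hφ : Continuous (𝓕 u₀) :=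
    VectorFourier.fourierIntegral_continuous Real.continuous_fourierChar continuous_inner hu₀_int
  have hφB : ∀ ξ, ‖𝓕 u₀ ξ‖ ≤ ∫ x, ‖u₀ x‖ := fun ξ =>
    VectorFourier.norm_fourierIntegral_le_integral_norm _ _ _ _ _
  have hφ0 : 𝓕 u₀ 0 = ∫ y, u₀ y := by
    rw [Real.fourier_eq]
    simp
  have hφs : eLpNorm (fun ξ : EuclideanSpace ℝ (Fin n) =>
      (((1 + ‖(2 * Real.pi) • ξ‖ ^ 2) ^ (s / 2) : ℝ) : ℂ) * 𝓕 u₀ ξ) 2 < ⊤ := by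
    rw [← sobolevENorm_eq_of_integrable hu₀_int hu₂]
    exact hu₀_Hs
  have key := hG.tendsto_eLpNorm_sub (d := d) hφ hφB hφs hs hk hkT hc
  rw [ENNReal.tendsto_nhds_zero] at key ⊢
  intro ε hε
  -- The principal filter of `[c, d]` in the product makes the convergence uniform in `t`, which is
  -- what the supremum requires.
  have h1 := eventually_prod_principal_iff.1 (key ε hε)
  filter_upwards [h1, hk, eventually_gt_atTop 0] with T h1 h2 h3
  refine iSup₂_le fun t ht => ?_
  have ht0 : 0 < t := hc.trans_le ht.1
  have hut : MemLp (u (T * t)) 2 := (hu.continuousInHs.1 _ (by positivity)).memLp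
  have hfe := hu.fourier_eq hs ha hG hGa hu₂ (mul_pos h3 ht0) hut
  have e := sobolevENorm_dilation_sub_heatKernel (s := s) hu₀_int hu₂ hut hfe h2 ht0
    (∫ y, u₀ y)
  refine (le_of_eq ?_).trans (h1 t ht)
  rw [hφ0]
  exact e
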